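/- **Setting.** Strings are finite sequences of nonzero characters of $\beta\ge 1$ bits, ordered lexicographically and read as if followed by zeros (end-of-string characters). In particular "$s$ and $t$ have a common prefix of length $l$" means that the first $l$ characters agree in this reading. The input is an array of pointers to $n$ strings $s_1,\dots,s_n$ that have a common prefix of length $h$. Let $w\ge 1$ be a number of characters such that $w$ characters fit into one machine word, let $v=2^d-1$ with $d\ge 1$ be the number of splitters, let $\alpha\ge 1$ be the oversampling factor and $a=\alpha v+\alpha-1$ the sample size; assume $a\le n$. For a string $s$ let $\mathrm{chars}_h(s)$ be the machine word that consists of the $w$ characters of $s$ after the first $h$ (first character most significant). **A single step of super scalar string sample sort** does the following. It draws indices $r_1,\dots,r_a\in\{1,\dots,n\}$ at random, sorts the keys $\mathrm{chars}_h(s_{r_1}),\dots,\mathrm{chars}_h(s_{r_a})$ into $p_1\le\dots\le p_a$, and takes the splitters $x_i=p_{\alpha(i+1)}$, $0\le i<v$. The splitters form a perfect binary search tree with $d$ levels. Each string $s$ with $c=\mathrm{chars}_h(s)$ descends this tree, going at each node to the right if the splitter there is smaller than $c$ and to the left otherwise, and so reaches a leaf $i\in\{0,\dots,v\}$; it is put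 into bucket $2i+1$ if $i<v$ and $x_i=c$, and into bucket $2i$ otherwise. The output consists of - the bucket boundaries $b_0,\dots,b_{2v+1}$, where $b_i$ is the number of strings in buckets smaller than $i$ (so $b_0=0$ and $b_{2v+1}=n$); - a rearrangement $s'_0,\dots,s'_{n-1}$ of the pointers such that, for $0\le i\le 2v$, the subset $\mathcal S'_i=\{s'_j: b_i\le j<b_{i+1}\}$ consists of exactly the strings of bucket $i$; - the numbers $h'_0=0$, $h'_i=\mathrm{lcp}(x_{i-1},x_i)$ (in characters) for $1\le i\le v-1$, and $h'_v=0$. Every string of $\mathcal S'_i$ is smaller than every string of $\mathcal S'_{i'}$ if $i<i'$; the strings of $\mathcal S'_{2i}$ have a common prefix of length $h+h'_i$, and those of $\mathcal S'_{2i+1}$ one of length $h+w$. **Model.** A CREW PRAM with $p\ge 1$ processors and words of $W$ bits: in each time step, every processor that has not halted executes one instruction of the common program on its own registers (word arithmetic, comparison, shifts and bitwise operations, index of the most significant bit, a read or a write of one shared memory cell, $\mathrm{chars}_h$ of a string given by its pointer, or reading a random index) or tests one register; different processors may read the same cell in the same step but never write to the same cell in the same step. Initially the shared memory holds the array of pointers,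 and each processor knows its number and $p,n,v,\alpha,w,\beta$. Time is the number of steps until all processors have halted; work is the total number of steps executed by processors that have not yet halted. **Theorem.** There is one program that implements a single step of super scalar string sample sort on the CREW PRAM. More precisely, for every $\alpha\ge1$ there are constants $C$ and $K$, depending only on $\alpha$, such that for all $p$, $n$, $d$, $w$, $\beta$, $h$ and $W$ with $\beta w\le W$ and $K(n+pv)\le 2^W$, for all inputs as above and for every outcome of the random draws, the program never violates the exclusive write rule and halts with the correct output in the shared memory after time at most $$C\Big(\frac np\log_2(v+1)+\log_2(pv)+v\Big)$$ and with work at most $$C\big(n\log_2(v+1)+pv\big).$$ -/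

import Mathlib

namespace S5

/-! ### The problem instance and the sequential step -/

/-- The data on which one step of super scalar string sample sort operates.

A string is a list of characters; it is read as if it were followed by zeros (the end-of-string
terminator). Strings are referred to by pointers. The set of strings is an array of `n` pointers,
which occupies the cells `0, …, n - 1` of the shared memory `mem`. All other cells of `mem` have
arbitrary contents. -/
structure Instance where
  /-- the number of strings -/
  n : ℕ
  /-- the oversampling factor -/
  α : ℕ
  /-- the number of levels of the classification tree -/
  d : ℕ
  /-- the number of bits of a character -/
  β : ℕ
  /-- the number of characters in a key -/
  w : ℕ
  /-- the length of the known common prefix -/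
  h : ℕ
  /-- the string to which a pointer points -/
  str : ℕ → List ℕ
  /-- the outcomes of the successive calls of `random`, as indices into the pointer array -/
  draws : ℕ → ℕ
  /-- the initial contents of the shared memory -/
  mem : ℕ → ℕ

/-- The strings `s` and `t` agree in their first `l` characters. -/
def CommonPrefix (l : ℕ) (s t : List ℕ) : Prop :=
  ∀ k < l, s.getD k 0 = t.getD k 0

namespace Instance

variable (I : Instance)

/-- The number `v = 2 ^ d - 1` of splitters. -/
def v : ℕ := 2 ^ I.d - 1

/-- The sample size `a = α v + α - 1`. -/
def sampleSize : ℕ := I.α * I.v + I.α - 1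

/-- The `i`-th input string. -/
def input (i : ℕ) : List ℕ := I.str (I.mem i)

/-- The function `chars_h`: the `w` characters of `s` after the first `h`, as one number whose most
significant digit is the first of these characters. -/
def key (s : List ℕ) : ℕ :=
  ∑ j ∈ Finset.range I.w, s.getD (I.h + j) 0 * 2 ^ (I.β * (I.w - 1 - j))

/-- The requirements on an instance for a machine with words of `W` bits. -/
structure Admissible (W : ℕ) : Prop where
  one_le_α : 1 ≤ I.α
  one_le_d : 1 ≤ I.d
  one_le_β : 1 ≤ I.β
  one_le_w : 1 ≤ I.w
  /-- a key fits into one machine word -/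
  key_fits : I.β * I.w ≤ W
  /-- the sample is not larger than the input -/
  sample_le : I.sampleSize ≤ I.n
  /-- the memory consists of machine words -/
  mem_word : ∀ a, I.mem a < 2 ^ W
  /-- characters are nonzero and have `β` bits -/
  char_range : ∀ i < I.n, ∀ c ∈ I.input i, 0 < c ∧ c < 2 ^ I.β
  /-- the input strings have a common prefix of length `h` -/
  common_prefix : ∀ i < I.n, ∀ j < I.n, CommonPrefix I.h (I.input i) (I.input j)
  /-- random indices are indices of input strings -/
  draws_lt : ∀ k, I.draws k < I.n

/-- The sorted sample of keys (indexed from `0`). -/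
def sortedSample : List ℕ :=
  ((List.range I.sampleSize).map fun k => I.key (I.input (I.draws k))).mergeSort

/-- The splitter `x_j`, for `j = 0, …, v - 1`: every `α`-th element of the sorted sample. -/
def splitter (j : ℕ) : ℕ := I.sortedSample.getD (I.α * (j + 1) - 1) 0

/-- The `j`-th of the `w` characters of the key `x`. -/
def keyChar (x j : ℕ) : ℕ := x / 2 ^ (I.β * (I.w - 1 - j)) % 2 ^ I.β

/-- The length, in characters, of the longest common prefix of two keys. -/
def keyLcp (x y : ℕ) : ℕ :=
  Nat.findGreatest (fun l => ∀ j < l, I.keyChar x j = I.keyChar y j) I.w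

/-- The array `h'_0, …, h'_v`, that is `0`, the LCPs of consecutive splitters, and `0`. -/
def splitterLcp (i : ℕ) : ℕ :=
  if i = 0 ∨ I.v ≤ i then 0 else I.keyLcp (I.splitter (i - 1)) (I.splitter i)

/-- The classification tree in level order: the root is node `1`, the children of node `i` are
`2 i` and `2 i + 1`, and the in-order traversal visits `x_0, …, x_{v-1}`. -/
def treeNode (i : ℕ) : ℕ :=
  I.splitter ((2 * (i - 2 ^ Nat.log 2 i) + 1) * 2 ^ (I.d - 1 - Nat.log 2 i) - 1)

/-- The leaf in `0, …, v` at which the descent through the tree with key `c` ends: at each of the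
`d` nodes it goes to the right child if the splitter is smaller than `c`, otherwise to the left. -/
def leaf (c : ℕ) : ℕ :=
  (fun i => 2 * i + if I.treeNode i < c then 1 else 0)^[I.d] 1 - 2 ^ I.d

/-- The bucket in `0, …, 2 v` of the string `s`. -/
def bucket (s : List ℕ) : ℕ :=
  let c := I.key s
  let i := I.leaf c
  2 * i + if i < I.v ∧ I.splitter i = c then 1 else 0

/-- The bucket boundary `b_i`: the number of input strings in the buckets before bucket `i`. -/
def boundary (i : ℕ) : ℕ :=
  ((Finset.range I.n).filter fun j => I.bucket (I.input j) < i).card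

/-- The shared memory `M` holds the output of the step: the rearranged pointers `s'_0, …, s'_{n-1}`
in the cells from `n` on, then the boundaries `b_0, …, b_{2v+1}`, then `h'_0, …, h'_v`. -/
structure Output (M : ℕ → ℕ) : Prop where
  /-- the bucket boundaries -/
  boundary_eq : ∀ i ≤ 2 * I.v + 1, M (2 * I.n + i) = I.boundary i
  /-- the LCPs of the splitters -/
  lcp_eq : ∀ i ≤ I.v, M (2 * I.n + (2 * I.v + 2) + i) = I.splitterLcp i
  /-- the last boundary is `n`, so that the subsets below exhaust the output array -/
  boundary_last : M (2 * I.n + (2 * I.v + 1)) = I.n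
  /-- the pointers `s'_j` with `b_i ≤ j < b_{i+1}` are those of the input strings in bucket `i` -/
  subset_eq : ∀ i ≤ 2 * I.v,
    (Finset.Ico (M (2 * I.n + i)) (M (2 * I.n + (i + 1)))).val.map (fun j => M (I.n + j)) =
      ((Finset.range I.n).filter fun j => I.bucket (I.input j) = i).val.map I.mem
  /-- every string of an earlier subset is smaller than every string of a later one -/
  ordered : ∀ i i', i < i' → i' ≤ 2 * I.v →
    ∀ j ∈ Finset.Ico (M (2 * I.n + i)) (M (2 * I.n + (i + 1))),
    ∀ j' ∈ Finset.Ico (M (2 * I.n + i')) (M (2 * I.n + (i' + 1))),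
      I.str (M (I.n + j)) < I.str (M (I.n + j'))
  /-- the subset `2 i` has a common prefix of length `h + h'_i` -/
  prefix_even : ∀ i ≤ I.v,
    ∀ j ∈ Finset.Ico (M (2 * I.n + 2 * i)) (M (2 * I.n + (2 * i + 1))),
    ∀ j' ∈ Finset.Ico (M (2 * I.n + 2 * i)) (M (2 * I.n + (2 * i + 1))),
      CommonPrefix (I.h + M (2 * I.n + (2 * I.v + 2) + i))
        (I.str (M (I.n + j))) (I.str (M (I.n + j')))
  /-- the subset `2 i + 1` has a common prefix of length `h + w` -/
  prefix_odd : ∀ i < I.v,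
    ∀ j ∈ Finset.Ico (M (2 * I.n + (2 * i + 1))) (M (2 * I.n + (2 * i + 2))),
    ∀ j' ∈ Finset.Ico (M (2 * I.n + (2 * i + 1))) (M (2 * I.n + (2 * i + 2))),
      CommonPrefix (I.h + I.w) (I.str (M (I.n + j))) (I.str (M (I.n + j')))

end Instance

/-! ### The CREW PRAM

A synchronous parallel random access machine with words of `W` bits. All processors run the same
program, each with registers and a control state of its own. In one time step every processor that
has not halted executes one instruction or one test of a register. -/

/-- The binary operations on machine words. -/
inductive BinOp
  | add | sub | mul | div | mod | and | or | xor | shl | shr | lt | eq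

/-- The result of a binary operation on words of `W` bits; `sub` is truncated at `0`, and a
comparison yields `1` if it holds and `0` otherwise. -/
def BinOp.eval (W : ℕ) (o : BinOp) (x y : ℕ) : ℕ :=
  (match o with
    | add => x + y
    | sub => x - y
    | mul => x * y
    | div => x / y
    | mod => x % y
    | and => x &&& y
    | or => x ||| y
    | xor => x ^^^ y
    | shl => x <<< y
    | shr => x >>> y
    | lt => if x < y then 1 else 0
    | eq => if x = y then 1 else 0) % 2 ^ W

/-- Instructions. The letters `r, a, b` stand for numbers of registers. -/
inductive Instr
  /-- `r := c`, for a constant `c` -/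
  | const (r c : ℕ)
  /-- `r := a ∘ b` -/
  | bin (o : BinOp) (r a b : ℕ)
  /-- `r :=` the index of the most significant bit of `a` (and `0` if `a` is `0`) -/
  | msb (r a : ℕ)
  /-- `r := memory[a]` -/
  | load (r a : ℕ)
  /-- `memory[a] := b` -/
  | store (a b : ℕ)
  /-- `r := chars_h` of the string to which `a` points -/
  | chars (r a : ℕ)
  /-- `r :=` the outcome of the call of `random` that has number `a` -/
  | random (r a : ℕ)

/-- Statements; a program is a list of statements. -/
inductive Stmt
  | instr (i : Instr)
  /-- if register `r` is nonzero then `A` else `B` -/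
  | ite (r : ℕ) (A B : List Stmt)
  /-- while register `r` is nonzero do `A` -/
  | loop (r : ℕ) (A : List Stmt)

/-- The state of a processor: its registers and the statements that it still has to execute. -/
structure Proc where
  regs : ℕ → ℕ
  cont : List Stmt

/-- The new registers after an instruction, when the shared memory contains `M`. -/
def Instr.exec (W : ℕ) (I : Instance) (M : ℕ → ℕ) (R : ℕ → ℕ) : Instr → (ℕ → ℕ)
  | const r c => Function.update R r (c % 2 ^ W)
  | bin o r a b => Function.update R r (o.eval W (R a) (R b))
  | msb r a => Function.update R r (Nat.log 2 (R a))
  | load r a => Function.update R r (M (R a))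
  | store _ _ => R
  | chars r a => Function.update R r (I.key (I.str (R a)) % 2 ^ W)
  | random r a => Function.update R r (I.draws (R a))

/-- One time step of a processor. -/
def Proc.next (W : ℕ) (I : Instance) (M : ℕ → ℕ) (q : Proc) : Proc :=
  match q.cont with
  | [] => q
  | .instr i :: K => ⟨i.exec W I M q.regs, K⟩
  | .ite r A B :: K => ⟨q.regs, (if q.regs r ≠ 0 then A else B) ++ K⟩
  | .loop r A :: K => ⟨q.regs, if q.regs r ≠ 0 then A ++ .loop r A :: K else K⟩

/-- The address and the value that a processor writes in the current time step, if it writes. -/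
def Proc.write? (q : Proc) : Option (ℕ × ℕ) :=
  match q.cont with
  | .instr (.store a b) :: _ => some (q.regs a, q.regs b)
  | _ => none

/-- The state of a machine with `p` processors. -/
structure Config (p : ℕ) where
  procs : Fin p → Proc
  mem : ℕ → ℕ

/-- The memory after the writes of the current time step (on a CREW PRAM there is at most one write
to each cell, so that the order of the search does not matter). -/
def Config.nextMem {p : ℕ} (c : Config p) (a : ℕ) : ℕ :=
  ((List.finRange p).findSome? fun i =>
    (c.procs i).write?.bind fun y => if y.1 = a then some y.2 else none).getD (c.mem a)

/-- One time step of the machine: all reads see the memory as it was before the writes. -/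
def Config.step {p : ℕ} (W : ℕ) (I : Instance) (c : Config p) : Config p where
  procs i := (c.procs i).next W I c.mem
  mem := c.nextMem

/-- The exclusive write rule: no two processors write to the same cell in the same time step. -/
def Config.ExclusiveWrite {p : ℕ} (c : Config p) : Prop :=
  ∀ i j : Fin p, ∀ x y : ℕ × ℕ,
    (c.procs i).write? = some x → (c.procs j).write? = some y → x.1 = y.1 → i = j

/-- All processors have halted. -/
def Config.Halted {p : ℕ} (c : Config p) : Prop := ∀ i, (c.procs i).cont = []

/-- The number of processors that have not halted. -/
def Config.active {p : ℕ} (c : Config p) : ℕ :=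
  (Finset.univ.filter fun i => (c.procs i).cont.isEmpty = false).card

/-- The initial registers of processor `i`: its number and the parameters of the problem. -/
def initRegs (p : ℕ) (I : Instance) (i : ℕ) : ℕ → ℕ
  | 0 => i
  | 1 => p
  | 2 => I.n
  | 3 => I.v
  | 4 => I.α
  | 5 => I.w
  | 6 => I.β
  | _ => 0

/-- The initial state, with all processors at the beginning of the program. -/
def init (prog : List Stmt) (p : ℕ) (I : Instance) : Config p where
  procs i := ⟨initRegs p I i, prog⟩
  mem := I.mem

/-- The state after `t` time steps. -/
def run (prog : List Stmt) (p W : ℕ) (I : Instance) (t : ℕ) : Config p :=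
  (Config.step W I)^[t] (init prog p I)

/-- The work of the first `T` time steps: the total number of steps executed by processors that
have not halted. -/
def work (prog : List Stmt) (p W : ℕ) (I : Instance) (T : ℕ) : ℕ :=
  ∑ t ∈ Finset.range T, (run prog p W I t).active

end S5

/-!
One run of the step draws and sorts the sample, classifies the strings, computes the bucket boundaries
by prefix sums, and writes the output. The program consists of one piece of code for each of these
phases; with `P` processors the phases take the following time.

* The sample, padded with zeros to a power of two `N`, is sorted by bottom-up merge sort
  (`WP.sortCode`). On each level, a processor merges whole pairs of blocks, so that a level with blocks
  of length `2 ^ k` takes time `O(N / P + 2 ^ k)`. The terms `2 ^ k` add up to `O(N)`, which is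
  `O(α v)`, and the number of levels is `O(α log v)`. Hence no parallel merging is needed: the summand
  `v` in the time bound pays for a sequential merge.
* The strings are dealt out to the processors in `n / P + 1` rounds. A processor descends the
  classification tree, which is a binary search in the sorted sample (`Instance.offset_succ`), and
  increments a counter that belongs to the bucket and to the processor, so that there are no write
  conflicts (`WP.classifyRound`). The old value of the counter is the rank of the string among the
  strings that share the counter.
* The prefix sums of the `(2 v + 2) P` counters take time `O(v + log P)` (`WP.prefixCode`). The sum of
  all counters before that of a string, plus the rank of the string, is its position in the stable
  order by counters (`position`). Positions are distinct, and those of the strings of a bucket fill the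
  interval between two bucket boundaries (`Instance.Ico_boundary`).
* The longest common prefix of two splitters is read off the most significant bit of their exclusive
  or (`Instance.keyLcp_eq`).

Only about `P = min p (n / (log p / log v) + 1)` of the processors take part (`Instance.procs`). With
this number, `P log p` is `O(n log v + p)`, which bounds the work, while `n / P * log v` is
`O(n / p * log v + log p)`, so that the time does not suffer.

All processors that take part run in lockstep: the number of rounds of each loop is the same for all of
them, and choices are made by arithmetic with the results of comparisons. Programs can therefore be
verified by rules for weakest preconditions (`WP`) about the registers of all processors at once; the
rules also account for the time, the exclusive write rule, and the number of active processors.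

The output is correct (`Instance.Admissible.output`) since the key of a string in leaf `i` lies between
the splitters `x_{i-1}` and `x_i` (`Instance.Admissible.offset_spec`), and since keys are compared like
the strings that they come from (`Instance.Admissible.lt_of_key_lt`).
-/

namespace S5

/-! ### Lockstep execution -/

/-- In the configuration `c` the processors with numbers below `P` are in lockstep: all of them have
to execute `K`, and processor `i` has the contents `R i` in its registers below `64`. The other
processors have halted. The shared memory is `M`. -/
structure Lock {p : ℕ} (P : ℕ) (K : List Stmt) (R : ℕ → ℕ → ℕ) (M : ℕ → ℕ) (c : Config p) : Prop where
  mem_eq : c.mem = M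
  cont_eq : ∀ i : Fin p, i.val < P → (c.procs i).cont = K
  regs_eq : ∀ i : Fin p, i.val < P → ∀ r < 64, (c.procs i).regs r = R i r
  halted : ∀ i : Fin p, P ≤ i.val → (c.procs i).cont = []

/-- `P` processors in lockstep that execute `S` get in `t` steps from the registers `R` and the memory
`M` to `R'` and `M'`, obeying the exclusive write rule. -/
def Runs (p W : ℕ) (I : Instance) (P : ℕ) (S : List Stmt) (R : ℕ → ℕ → ℕ) (M : ℕ → ℕ)
    (R' : ℕ → ℕ → ℕ) (M' : ℕ → ℕ) (t : ℕ) : Prop :=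
  ∀ (c : Config p) (K : List Stmt), Lock P (S ++ K) R M c →
    Lock P K R' M' ((Config.step W I)^[t] c) ∧
    ∀ t' < t, ((Config.step W I)^[t'] c).ExclusiveWrite ∧ ((Config.step W I)^[t'] c).active ≤ P

/-- `P` processors in lockstep that execute `S` from the registers `R` and the memory `M` reach a
state that satisfies `Q` after at most `T` steps. -/
def WP (p W : ℕ) (I : Instance) (P : ℕ) (S : List Stmt) (R : ℕ → ℕ → ℕ) (M : ℕ → ℕ) (T : ℕ)
    (Q : (ℕ → ℕ → ℕ) → (ℕ → ℕ) → Prop) : Prop :=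
  ∃ t ≤ T, ∃ R' M', Runs p W I P S R M R' M' t ∧ Q R' M'

section Rules

variable {p W P : ℕ} {I : Instance} {S S₁ S₂ : List Stmt} {R : ℕ → ℕ → ℕ} {M : ℕ → ℕ} {T : ℕ}
  {Q : (ℕ → ℕ → ℕ) → (ℕ → ℕ) → Prop}

theorem Lock.active_le {c : Config p} {K : List Stmt} (h : Lock P K R M c) : c.active ≤ P := by
  unfold Config.active
  calc _ ≤ (Finset.range P).card := by
        apply Finset.card_le_card_of_injOn (fun i : Fin p => i.val)
        · intro i hi
          simp only [Finset.coe_filter, Finset.mem_univ, true_and, Set.mem_ofPred_eq] at hi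
          simp only [Finset.coe_range, Set.mem_Iio]
          by_contra hc
          simp [h.halted i (by omega)] at hi
        · intro i _ j _ hij
          exact Fin.ext hij
    _ = P := Finset.card_range P

theorem Runs.append {R₁ R₂ M₁ M₂ t₁ t₂} (h₁ : Runs p W I P S₁ R M R₁ M₁ t₁)
    (h₂ : Runs p W I P S₂ R₁ M₁ R₂ M₂ t₂) : Runs p W I P (S₁ ++ S₂) R M R₂ M₂ (t₁ + t₂) := by
  intro c K hc
  rw [List.append_assoc] at hc
  obtain ⟨a₁, b₁⟩ := h₁ c _ hc
  obtain ⟨a₂, b₂⟩ := h₂ _ K a₁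
  refine ⟨by rw [Nat.add_comm, Function.iterate_add_apply]; exact a₂, fun t' ht' => ?_⟩
  by_cases h : t' < t₁
  · exact b₁ t' h
  · obtain ⟨k, rfl⟩ := Nat.exists_eq_add_of_le (not_lt.1 h)
    rw [Nat.add_comm, Function.iterate_add_apply]
    exact b₂ k (by omega)

theorem WP.mono {T' : ℕ} {Q' : (ℕ → ℕ → ℕ) → (ℕ → ℕ) → Prop} (h : WP p W I P S R M T Q)
    (hT : T ≤ T') (hQ : ∀ R' M', Q R' M' → Q' R' M') : WP p W I P S R M T' Q' := by
  obtain ⟨t, ht, R', M', h1, h2⟩ := h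
  exact ⟨t, ht.trans hT, R', M', h1, hQ _ _ h2⟩

theorem WP.append {T₁ T₂ : ℕ}
    (h : WP p W I P S₁ R M T₁ fun R' M' => WP p W I P S₂ R' M' T₂ Q) :
    WP p W I P (S₁ ++ S₂) R M (T₁ + T₂) Q := by
  obtain ⟨t, ht, R', M', h1, t', ht', R'', M'', h2, h3⟩ := h
  exact ⟨t + t', by omega, R'', M'', h1.append h2, h3⟩

theorem WP.nil (h : Q R M) : WP p W I P [] R M T Q :=
  ⟨0, Nat.zero_le _, R, M, fun _ _ hc => ⟨hc, fun _ h => absurd h (Nat.not_lt_zero _)⟩, h⟩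

/-- A configuration in which no processor is about to write. -/
theorem nextMem_of_no_write {c : Config p} (h : ∀ i, (c.procs i).write? = none) :
    c.nextMem = c.mem := by
  funext a
  unfold Config.nextMem
  rw [List.findSome?_eq_none_iff.2 (by intro i _; simp [h i])]
  rfl

theorem exclusiveWrite_of_no_write {c : Config p} (h : ∀ i, (c.procs i).write? = none) :
    c.ExclusiveWrite := by
  intro i j x y hx
  simp [h i] at hx

theorem Proc.write?_of_nil {q : Proc} (h : q.cont = []) : q.write? = none := by
  simp [Proc.write?, h]

theorem Proc.next_of_nil {M : ℕ → ℕ} {q : Proc} (h : q.cont = []) : q.next W I M = q := by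
  simp [Proc.next, h]

theorem Runs.loop_step {r : ℕ} {A : List Stmt} (h : ∀ i < P, R i r ≠ 0) (hr : r < 64) :
    ∀ (c : Config p) (K : List Stmt), Lock P (.loop r A :: K) R M c →
      Lock P (A ++ .loop r A :: K) R M (c.step W I) ∧ c.ExclusiveWrite ∧ c.active ≤ P := by
  intro c K hc
  have hw : ∀ i, (c.procs i).write? = none := by
    intro i
    by_cases hi : i.val < P
    · simp [Proc.write?, hc.cont_eq i hi]
    · exact Proc.write?_of_nil (hc.halted i (by omega))
  refine ⟨⟨?_, ?_, ?_, ?_⟩, exclusiveWrite_of_no_write hw, hc.active_le⟩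
  · exact (nextMem_of_no_write hw).trans hc.mem_eq
  · intro i hi
    simp [Config.step, Proc.next, hc.cont_eq i hi, hc.regs_eq i hi r hr, h i hi]
  · intro i hi r' hr'
    simp [Config.step, Proc.next, hc.cont_eq i hi, hc.regs_eq i hi r' hr']
  · intro i hi
    simp [Config.step, Proc.next, hc.halted i hi]

theorem Runs.loop_exit {r : ℕ} {A : List Stmt} (h : ∀ i < P, R i r = 0) (hr : r < 64) :
    Runs p W I P [.loop r A] R M R M 1 := by
  intro c K hc
  rw [List.singleton_append] at hc
  have hw : ∀ i, (c.procs i).write? = none := by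
    intro i
    by_cases hi : i.val < P
    · simp [Proc.write?, hc.cont_eq i hi]
    · exact Proc.write?_of_nil (hc.halted i (by omega))
  refine ⟨⟨?_, ?_, ?_, ?_⟩, ?_⟩
  · exact (nextMem_of_no_write hw).trans hc.mem_eq
  · intro i hi
    simp [Config.step, Proc.next, hc.cont_eq i hi, hc.regs_eq i hi r hr, h i hi]
  · intro i hi r' hr'
    simp [Config.step, Proc.next, hc.cont_eq i hi, hc.regs_eq i hi r' hr']
  · intro i hi
    simp [Config.step, Proc.next, hc.halted i hi]
  · intro t' ht'
    obtain rfl : t' = 0 := by omega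
    exact ⟨exclusiveWrite_of_no_write hw, hc.active_le⟩

/-- A loop with invariant `Inv`, which all processors leave after `m` rounds. -/
theorem WP.loop {r : ℕ} {A : List Stmt} (Inv : ℕ → (ℕ → ℕ → ℕ) → (ℕ → ℕ) → Prop)
    (m : ℕ) (Tb : ℕ → ℕ) (hr : r < 64) (h0 : Inv 0 R M)
    (hbody : ∀ j < m, ∀ R M, Inv j R M →
      (∀ i < P, R i r ≠ 0) ∧ WP p W I P A R M (Tb j) (Inv (j + 1)))
    (hexit : ∀ R M, Inv m R M → ∀ i < P, R i r = 0) :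
    WP p W I P [.loop r A] R M (∑ j ∈ Finset.range m, (Tb j + 1) + 1) (Inv m) := by
  induction m generalizing Inv Tb R M with
  | zero => exact ⟨1, by simp, R, M, Runs.loop_exit (hexit R M h0) hr, h0⟩
  | succ m ih =>
    obtain ⟨hz, t, ht, R₁, M₁, h1, h2⟩ := hbody 0 (by omega) R M h0
    obtain ⟨t', ht', R₂, M₂, h3, h4⟩ := ih (R := R₁) (M := M₁) (fun j => Inv (j + 1))
      (fun j => Tb (j + 1)) h2 (fun j hj => hbody (j + 1) (by omega)) hexit
    refine ⟨(t + t') + 1, ?_, R₂, M₂, ?_, h4⟩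
    · rw [Finset.sum_range_succ']
      omega
    · intro c K hc
      obtain ⟨a, b⟩ := Runs.loop_step (W := W) (I := I) hz hr c K hc
      obtain ⟨a', b'⟩ := (h1.append h3) _ K (by simpa using a)
      refine ⟨by rw [Function.iterate_succ_apply]; exact a', ?_⟩
      intro t'' ht''
      cases t'' with
      | zero => exact b
      | succ k =>
        rw [Function.iterate_succ_apply]
        exact b' k (by omega)

end Rules

/-! ### Expressions -/

/-- Expressions over the registers of a processor. -/
inductive Ex
  | reg (r : ℕ)
  | lit (c : ℕ)
  | bin (o : BinOp) (a b : Ex)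
  | msb (a : Ex)
  | load (a : Ex)
  | chars (a : Ex)
  | random (a : Ex)

/-- The value of an expression. -/
def Ex.eval (W : ℕ) (I : Instance) (M : ℕ → ℕ) (R : ℕ → ℕ) : Ex → ℕ
  | reg r => R r
  | lit c => c % 2 ^ W
  | bin o a b => o.eval W (a.eval W I M R) (b.eval W I M R)
  | msb a => Nat.log 2 (a.eval W I M R)
  | load a => M (a.eval W I M R)
  | chars a => I.key (I.str (a.eval W I M R)) % 2 ^ W
  | random a => I.draws (a.eval W I M R)

/-- The register that holds the value of an expression after the execution of `Ex.code`. -/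
def Ex.res (dst : ℕ) : Ex → ℕ
  | reg r => r
  | _ => dst

/-- Instructions, none of them a write, that compute the value of an expression in the register `dst`, using the registers
from `k` on for intermediate results. Nothing is computed for a register; see `Ex.res`. -/
def Ex.code : Ex → ℕ → ℕ → List Instr
  | reg _, _, _ => []
  | lit c, dst, _ => [.const dst c]
  | bin o a b, dst, k =>
      a.code k (k + 1) ++ (b.code (k + 1) (k + 2) ++ [.bin o dst (a.res k) (b.res (k + 1))])
  | msb a, dst, k => a.code k (k + 1) ++ [.msb dst (a.res k)]
  | load a, dst, k => a.code k (k + 1) ++ [.load dst (a.res k)]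
  | chars a, dst, k => a.code k (k + 1) ++ [.chars dst (a.res k)]
  | random a, dst, k => a.code k (k + 1) ++ [.random dst (a.res k)]

/-- The expression mentions only registers below `64`. -/
def Ex.ok : Ex → Bool
  | reg r => r < 64
  | lit _ => true
  | bin _ a b => a.ok && b.ok
  | msb a => a.ok
  | load a => a.ok
  | chars a => a.ok
  | random a => a.ok

/-- The number of instructions for an expression. -/
def Ex.cost : Ex → ℕ
  | reg _ => 0
  | lit _ => 1
  | bin _ a b => a.cost + (b.cost + 1)
  | msb a => a.cost + 1
  | load a => a.cost + 1
  | chars a => a.cost + 1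
  | random a => a.cost + 1

/-- The effect of a sequence of instructions on the registers, while the memory is `M`. -/
def execList (W : ℕ) (I : Instance) (M : ℕ → ℕ) (l : List Instr) (R : ℕ → ℕ) : ℕ → ℕ :=
  l.foldl (fun R i => i.exec W I M R) R

/-- Whether an instruction writes to the shared memory. -/
def Instr.isStore : Instr → Bool
  | .store _ _ => true
  | _ => false

section Expressions

variable {p W P : ℕ} {I : Instance} {S : List Stmt} {M : ℕ → ℕ}

theorem execList_append (l l' : List Instr) (R : ℕ → ℕ) :
    execList W I M (l ++ l') R = execList W I M l' (execList W I M l R) := by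
  simp [execList]

theorem Ex.length_code (e : Ex) : ∀ dst k, (e.code dst k).length = e.cost := by
  induction e <;> simp_all [Ex.code, Ex.cost]

theorem Ex.code_no_store (e : Ex) : ∀ dst k, ∀ i ∈ e.code dst k, i.isStore = false := by
  induction e with
  | bin o a b ha hb =>
    intro dst k i hi
    simp only [Ex.code, List.mem_append, List.mem_singleton] at hi
    rcases hi with hi | hi | rfl
    · exact ha _ _ _ hi
    · exact hb _ _ _ hi
    · rfl
  | reg => simp [Ex.code]
  | lit => simp [Ex.code, Instr.isStore]
  | _ a ha =>
    intro dst k i hi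
    simp only [Ex.code, List.mem_append, List.mem_singleton] at hi
    rcases hi with hi | rfl
    · exact ha _ _ _ hi
    · rfl

theorem Ex.eval_congr (e : Ex) (he : e.ok = true) {R R' : ℕ → ℕ} (h : ∀ r < 64, R r = R' r) :
    e.eval W I M R = e.eval W I M R' := by
  induction e with
  | reg r => exact h r (by simpa [Ex.ok] using he)
  | lit => rfl
  | bin o a b ha hb =>
    simp only [Ex.ok, Bool.and_eq_true] at he
    simp only [Ex.eval, ha he.1, hb he.2]
  | _ a ha => simp only [Ex.eval, ha he]

theorem Ex.res_le (e : Ex) (he : e.ok = true) {k : ℕ} (hk : 64 ≤ k) : e.res k ≤ k := by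
  cases e <;> simp_all [Ex.ok, Ex.res]
  omega

/-- The instructions for an expression leave its value in the result register, and change no other
register below `k`. -/
theorem Ex.code_spec (e : Ex) (he : e.ok = true) : ∀ dst k, 64 ≤ k → dst < k → ∀ R : ℕ → ℕ,
    execList W I M (e.code dst k) R (e.res dst) = e.eval W I M R ∧
    ∀ r, r ≠ dst → r < k → execList W I M (e.code dst k) R r = R r := by
  induction e with
  | reg r => intro dst k hk hd R; simp [Ex.code, execList, Ex.res, Ex.eval]
  | lit c =>
    intro dst k hk hd R
    refine ⟨by simp [Ex.code, execList, Ex.res, Ex.eval, Instr.exec], fun r hr hrk => ?_⟩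
    simp [Ex.code, execList, Instr.exec, hr]
  | bin o a b ha hb =>
    intro dst k hk hd R
    simp only [Ex.ok, Bool.and_eq_true] at he
    obtain ⟨ha1, ha2⟩ := ha he.1 k (k + 1) (by omega) (by omega) R
    obtain ⟨hb1, hb2⟩ := hb he.2 (k + 1) (k + 2) (by omega) (by omega)
      (execList W I M (a.code k (k + 1)) R)
    have hres := Ex.res_le a he.1 hk
    rw [b.eval_congr he.2 (R' := R) fun r hr => ha2 r (by omega) (by omega)] at hb1
    have h2 := hb2 (a.res k) (by omega) (by omega)
    rw [ha1] at h2
    simp only [Ex.code, execList_append]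
    refine ⟨?_, fun r hr hrk => ?_⟩
    · rw [Ex.eval, ← h2, ← hb1]
      exact Function.update_self ..
    · have : ∀ R' : ℕ → ℕ, execList W I M [Instr.bin o dst (a.res k) (b.res (k + 1))] R' r = R' r := by
        intro R'; simp [execList, Instr.exec, hr]
      rw [this, hb2 r (by omega) (by omega), ha2 r (by omega) (by omega)]
  | _ a ha =>
    intro dst k hk hd R
    obtain ⟨ha1, ha2⟩ := ha he k (k + 1) (by omega) (by omega) R
    simp only [Ex.code, execList_append]
    refine ⟨?_, fun r hr hrk => ?_⟩
    · rw [Ex.eval, ← ha1]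
      exact Function.update_self ..
    · rw [← ha2 r (by omega) (by omega)]
      simp [execList, Instr.exec, hr]

/-- Processors in lockstep execute a sequence of instructions without writes. -/
theorem steps_instrs (l : List Instr) (hl : ∀ i ∈ l, i.isStore = false) :
    ∀ (c : Config p) (K : List Stmt),
      (∀ i : Fin p, i.val < P → (c.procs i).cont = l.map .instr ++ K) →
      (∀ i : Fin p, P ≤ i.val → (c.procs i).cont = []) →
      ((Config.step W I)^[l.length] c).mem = c.mem ∧
      (∀ i : Fin p, i.val < P → ((Config.step W I)^[l.length] c).procs i =
        ⟨execList W I c.mem l (c.procs i).regs, K⟩) ∧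
      (∀ i : Fin p, P ≤ i.val → (((Config.step W I)^[l.length] c).procs i).cont = []) ∧
      ∀ t' < l.length, ((Config.step W I)^[t'] c).ExclusiveWrite ∧
        ((Config.step W I)^[t'] c).active ≤ P := by
  induction l with
  | nil =>
    intro c K hc hh
    refine ⟨rfl, fun i hi => ?_, hh, fun _ h => absurd h (Nat.not_lt_zero _)⟩
    have := hc i hi
    simp only [List.map_nil, List.nil_append] at this
    simp [execList, ← this]
  | cons x l ih =>
    intro c K hc hh
    have hx : x.isStore = false := hl x (by simp)
    have hw : ∀ i, (c.procs i).write? = none := by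
      intro i
      by_cases hi : i.val < P
      · cases x <;> simp_all [Proc.write?, Instr.isStore]
      · exact Proc.write?_of_nil (hh i (by omega))
    have hm : (c.step W I).mem = c.mem := nextMem_of_no_write hw
    have hp : ∀ i : Fin p, i.val < P → (c.step W I).procs i =
        ⟨x.exec W I c.mem (c.procs i).regs, l.map .instr ++ K⟩ := by
      intro i hi
      simp [Config.step, Proc.next, hc i hi]
    obtain ⟨h1, h2, h3, h4⟩ := ih (fun i hi => hl i (by simp [hi])) (c.step W I) K
      (fun i hi => by rw [hp i hi])
      (fun i hi => by simp [Config.step, Proc.next, hh i hi])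
    simp only [List.length_cons, Function.iterate_succ_apply]
    refine ⟨h1.trans hm, ?_, h3, ?_⟩
    · intro i hi
      rw [h2 i hi, hp i hi, hm]
      rfl
    · intro t' ht'
      cases t' with
      | zero =>
        refine ⟨exclusiveWrite_of_no_write hw, ?_⟩
        refine Lock.active_le (P := P) (K := (x :: l).map .instr ++ K)
          (R := fun i r => if hi : i < p then (c.procs ⟨i, hi⟩).regs r else 0) (M := c.mem)
          (c := c) ⟨rfl, hc, ?_, hh⟩
        intro i hi r hr
        simp
      | succ k =>
        rw [Function.iterate_succ_apply]
        exact h4 k (by omega)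

/-- The statement `r := e`. Since `Ex.code` generates no instructions for a register, `e` must not be a
mere register; a register `s` is copied by expressions like `s + 0`. -/
def assign (r : ℕ) (e : Ex) : List Stmt := (e.code r 64).map .instr

/-- The statement `memory[a] := b`. -/
def put (a b : Ex) : List Stmt :=
  (a.code 64 66 ++ b.code 65 66).map .instr ++ [.instr (.store (a.res 64) (b.res 65))]

variable {R : ℕ → ℕ → ℕ} {Q : (ℕ → ℕ → ℕ) → (ℕ → ℕ) → Prop}

theorem Runs.assign {r : ℕ} {e : Ex} (hr : r < 64) (he : e.ok = true) (hres : e.res r = r) :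
    Runs p W I P (assign r e) R M
      (fun i => Function.update (R i) r (e.eval W I M (R i))) M e.cost := by
  intro c K hc
  obtain ⟨h1, h2, h3, h4⟩ := steps_instrs (W := W) (I := I) (e.code r 64) (e.code_no_store _ _) c K
    hc.cont_eq hc.halted
  rw [e.length_code] at h1 h2 h3 h4
  refine ⟨⟨h1.trans hc.mem_eq, fun i hi => by rw [h2 i hi], fun i hi r' hr' => ?_, h3⟩, h4⟩
  rw [h2 i hi]
  obtain ⟨h5, h6⟩ := e.code_spec (W := W) (I := I) (M := c.mem) he r 64 le_rfl hr (c.procs i).regs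
  rw [hres] at h5
  have h7 : ∀ r < 64, (c.procs i).regs r = R i r := hc.regs_eq i hi
  rw [e.eval_congr he h7] at h5
  by_cases hrr : r' = r
  · subst hrr
    rw [Function.update_self]
    exact h5.trans (by rw [hc.mem_eq])
  · rw [Function.update_of_ne hrr]
    exact (h6 r' hrr hr').trans (h7 r' hr')

theorem Runs.congr_regs {R₁ R₂ M₂ t} {S : List Stmt} (h : Runs p W I P S R M R₁ M₂ t)
    (h' : ∀ i < P, ∀ r < 64, R₁ i r = R₂ i r) : Runs p W I P S R M R₂ M₂ t := by
  intro c K hc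
  obtain ⟨a, b⟩ := h c K hc
  exact ⟨⟨a.mem_eq, a.cont_eq, fun i hi r hr => (a.regs_eq i hi r hr).trans (h' i hi r hr), a.halted⟩, b⟩

/-- The rule for an assignment; `f i` is the value that processor `i` computes. Of the `k` steps that are
set aside for a sequence of assignments, those that are left are handed on to `S`. -/
theorem WP.assign {r : ℕ} {e : Ex} {k X : ℕ} (f : ℕ → ℕ)
    (hf : ∀ i < P, e.eval W I M (R i) = f i)
    (h : WP p W I P S (fun i => Function.update (R i) r (f i)) M (k - e.cost + X) Q)
    (hr : r < 64 := by decide) (he : e.ok = true := by decide) (hres : e.res r = r := by decide)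
    (hk : e.cost ≤ k := by decide) :
    WP p W I P (assign r e ++ S) R M (k + X) Q := by
  obtain ⟨t, ht, R', M', h1, h2⟩ := h
  refine ⟨e.cost + t, by omega, R', M', ?_, h2⟩
  refine Runs.append ((Runs.assign hr he hres).congr_regs ?_) h1
  intro i hi r' _
  simp only [hf i hi]

/-- When all processors below `P` write, to distinct cells, then these cells change as intended, and no
others do. -/
theorem nextMem_of_writes {c : Config p} (ad val : ℕ → ℕ) (hP : P ≤ p)
    (hw : ∀ i : Fin p, i.val < P → (c.procs i).write? = some (ad i, val i))
    (hh : ∀ i : Fin p, P ≤ i.val → (c.procs i).write? = none)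
    (hinj : ∀ i < P, ∀ j < P, ad i = ad j → i = j) :
    (∀ i < P, c.nextMem (ad i) = val i) ∧
    ∀ a, (∀ i < P, ad i ≠ a) → c.nextMem a = c.mem a := by
  constructor
  · intro i hi
    unfold Config.nextMem
    have : ∃ x, ((List.finRange p).findSome? fun j =>
        (c.procs j).write?.bind fun y => if y.1 = ad i then some y.2 else none) = some x := by
      rw [← Option.isSome_iff_exists, List.findSome?_isSome_iff]
      exact ⟨⟨i, by omega⟩, by simp, by rw [hw _ hi]; simp⟩
    obtain ⟨x, hx⟩ := this
    rw [hx]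
    obtain ⟨j, _, hj⟩ := List.exists_of_findSome?_eq_some hx
    by_cases hjP : j.val < P
    · rw [hw j hjP] at hj
      simp only [Option.bind_some, Option.ite_none_right_eq_some, Option.some.injEq] at hj
      rw [← hj.2, hinj _ hjP _ hi hj.1]
      rfl
    · rw [hh j (by omega)] at hj
      simp at hj
  · intro a ha
    unfold Config.nextMem
    rw [List.findSome?_eq_none_iff.2]
    · rfl
    · intro j _
      by_cases hjP : j.val < P
      · rw [hw j hjP]
        simp [ha _ hjP]
      · rw [hh j (by omega)]
        rfl

/-- The rule for a parallel write; processor `i` writes `val i` to the cell `ad i`. -/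
theorem WP.put {a b : Ex} {k X : ℕ} (hP : P ≤ p) (ad val : ℕ → ℕ)
    (had : ∀ i < P, a.eval W I M (R i) = ad i)
    (hval : ∀ i < P, b.eval W I M (R i) = val i)
    (hinj : ∀ i < P, ∀ j < P, ad i = ad j → i = j)
    (h : ∀ M', (∀ i < P, M' (ad i) = val i) → (∀ x, (∀ i < P, ad i ≠ x) → M' x = M x) →
      WP p W I P S R M' (k - (a.cost + b.cost + 1) + X) Q)
    (ha : a.ok = true := by decide) (hb : b.ok = true := by decide)
    (hk : a.cost + b.cost + 1 ≤ k := by decide) :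
    WP p W I P (put a b ++ S) R M (k + X) Q := by
  classical
  set M' : ℕ → ℕ := fun x => if hx : ∃ i < P, ad i = x then val hx.choose else M x with hM'
  have hM1 : ∀ i < P, M' (ad i) = val i := by
    intro i hi
    have hx : ∃ j < P, ad j = ad i := ⟨i, hi, rfl⟩
    simp only [hM', dif_pos hx]
    rw [hinj _ hx.choose_spec.1 _ hi hx.choose_spec.2]
  have hM2 : ∀ x, (∀ i < P, ad i ≠ x) → M' x = M x := by
    intro x hx
    have : ¬ ∃ i < P, ad i = x := by push Not; exact hx
    simp only [hM', dif_neg this]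
  obtain ⟨t, ht, R', M'', h1, h2⟩ := h M' hM1 hM2
  refine ⟨(a.cost + b.cost + 1) + t, by omega, R', M'', Runs.append ?_ h1, h2⟩
  intro c K hc
  obtain ⟨h1, h2, h3, h4⟩ := steps_instrs (W := W) (I := I) (a.code 64 66 ++ b.code 65 66)
    (by
      intro i hi
      rcases List.mem_append.1 hi with hi | hi
      · exact a.code_no_store _ _ _ hi
      · exact b.code_no_store _ _ _ hi) c ([.instr (.store (a.res 64) (b.res 65))] ++ K)
    (fun i hi => by rw [hc.cont_eq i hi]; simp [S5.put]) hc.halted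
  rw [List.length_append, a.length_code, b.length_code] at h1 h2 h3 h4
  set c' := (Config.step W I)^[a.cost + b.cost] c with hc'
  have key : ∀ i : Fin p, i.val < P →
      execList W I c.mem (a.code 64 66 ++ b.code 65 66) (c.procs i).regs (a.res 64) = ad i ∧
      execList W I c.mem (a.code 64 66 ++ b.code 65 66) (c.procs i).regs (b.res 65) = val i ∧
      ∀ r < 64, execList W I c.mem (a.code 64 66 ++ b.code 65 66) (c.procs i).regs r = R i r := by
    intro i hi
    have h7 : ∀ r < 64, (c.procs i).regs r = R i r := hc.regs_eq i hi
    obtain ⟨ha1, ha2⟩ := a.code_spec (W := W) (I := I) (M := c.mem) ha 64 66 (by omega) (by omega)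
      (c.procs i).regs
    obtain ⟨hb1, hb2⟩ := b.code_spec (W := W) (I := I) (M := c.mem) hb 65 66 (by omega) (by omega)
      (execList W I c.mem (a.code 64 66) (c.procs i).regs)
    have hres := a.res_le ha (le_refl 64)
    rw [execList_append]
    have h8 : ∀ r < 64, execList W I c.mem (a.code 64 66) (c.procs i).regs r = R i r :=
      fun r hr => (ha2 r (by omega) (by omega)).trans (h7 r hr)
    refine ⟨?_, ?_, fun r hr => ?_⟩
    · rw [hb2 _ (by omega) (by omega), ha1, a.eval_congr ha h7, hc.mem_eq, had i hi]
    · rw [hb1, b.eval_congr hb h8, hc.mem_eq, hval i hi]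
    · rw [hb2 r (by omega) (by omega), h8 r hr]
  have hw : ∀ i : Fin p, i.val < P → (c'.procs i).write? = some (ad i, val i) := by
    intro i hi
    rw [h2 i hi]
    simp [Proc.write?, key i hi]
  have hh : ∀ i : Fin p, P ≤ i.val → (c'.procs i).write? = none :=
    fun i hi => Proc.write?_of_nil (h3 i hi)
  obtain ⟨n1, n2⟩ := nextMem_of_writes ad val hP hw hh hinj
  refine ⟨⟨?_, ?_, ?_, ?_⟩, ?_⟩
  · rw [Function.iterate_succ_apply', ← hc']
    funext x
    by_cases hx : ∃ i < P, ad i = x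
    · obtain ⟨i, hi, rfl⟩ := hx
      rw [hM1 i hi]
      exact n1 i hi
    · have hx : ∀ i < P, ad i ≠ x := by push Not at hx; exact hx
      rw [hM2 x hx, ← hc.mem_eq, ← h1]
      exact n2 x hx
  · intro i hi
    rw [Function.iterate_succ_apply', ← hc']
    simp [Config.step, Proc.next, h2 i hi]
  · intro i hi r hr
    rw [Function.iterate_succ_apply', ← hc']
    simp [Config.step, Proc.next, h2 i hi, Instr.exec, key i hi, hr]
  · intro i hi
    rw [Function.iterate_succ_apply', ← hc']
    simp [Config.step, Proc.next, h3 i hi]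
  · intro t' ht'
    by_cases ht : t' < a.cost + b.cost
    · exact h4 t' ht
    · obtain rfl : t' = a.cost + b.cost := by omega
      rw [← hc']
      refine ⟨?_, ?_⟩
      · intro i j x y hx hy hxy
        by_cases hi : i.val < P
        · by_cases hj : j.val < P
          · rw [hw i hi] at hx
            rw [hw j hj] at hy
            simp only [Option.some.injEq] at hx hy
            subst hx hy
            exact Fin.ext (hinj _ hi _ hj hxy)
          · rw [hh j (by omega)] at hy
            simp at hy
        · rw [hh i (by omega)] at hx
          simp at hx
      · exact Lock.active_le (P := P) (K := [.instr (.store (a.res 64) (b.res 65))] ++ K)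
          (R := R) (M := c'.mem) ⟨rfl, fun i hi => by rw [h2 i hi],
            fun i hi r hr => by rw [h2 i hi]; exact (key i hi).2.2 r hr, h3⟩

end Expressions

/-! ### Notation for expressions, counting loops -/

instance : Add Ex := ⟨.bin .add⟩
instance : Sub Ex := ⟨.bin .sub⟩
instance : Mul Ex := ⟨.bin .mul⟩
instance : Div Ex := ⟨.bin .div⟩
instance (c : ℕ) : OfNat Ex c := ⟨.lit c⟩

/-- The comparison `a < b`, with value `1` or `0`. -/
abbrev Ex.lt (a b : Ex) : Ex := .bin .lt a b
/-- The comparison `a = b`, with value `1` or `0`. -/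
abbrev Ex.eq (a b : Ex) : Ex := .bin .eq a b
/-- The bitwise exclusive or. -/
abbrev Ex.xor (a b : Ex) : Ex := .bin .xor a b

section Eval

variable {W : ℕ} {I : Instance} {M R : ℕ → ℕ}

theorem Ex.eval_add (a b : Ex) :
    (a + b).eval W I M R = (a.eval W I M R + b.eval W I M R) % 2 ^ W := rfl
theorem Ex.eval_sub (a b : Ex) :
    (a - b).eval W I M R = (a.eval W I M R - b.eval W I M R) % 2 ^ W := rfl
theorem Ex.eval_mul (a b : Ex) :
    (a * b).eval W I M R = (a.eval W I M R * b.eval W I M R) % 2 ^ W := rfl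
theorem Ex.eval_div (a b : Ex) :
    (a / b).eval W I M R = (a.eval W I M R / b.eval W I M R) % 2 ^ W := rfl
theorem Ex.eval_lt (a b : Ex) : (a.lt b).eval W I M R =
    (if a.eval W I M R < b.eval W I M R then 1 else 0) % 2 ^ W := rfl
theorem Ex.eval_eq (a b : Ex) : (a.eq b).eval W I M R =
    (if a.eval W I M R = b.eval W I M R then 1 else 0) % 2 ^ W := rfl
theorem Ex.eval_xor (a b : Ex) :
    (a.xor b).eval W I M R = (a.eval W I M R ^^^ b.eval W I M R) % 2 ^ W := rfl
theorem Ex.eval_reg (r : ℕ) : (Ex.reg r).eval W I M R = R r := rfl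
theorem Ex.eval_lit (c : ℕ) : (OfNat.ofNat c : Ex).eval W I M R = (OfNat.ofNat c : ℕ) % 2 ^ W := rfl
theorem Ex.eval_zero : (0 : Ex).eval W I M R = 0 % 2 ^ W := rfl
theorem Ex.eval_one : (1 : Ex).eval W I M R = 1 % 2 ^ W := rfl
theorem Ex.eval_two : (2 : Ex).eval W I M R = 2 % 2 ^ W := rfl
theorem Ex.eval_three : (3 : Ex).eval W I M R = 3 % 2 ^ W := rfl
theorem Ex.eval_four : (4 : Ex).eval W I M R = 4 % 2 ^ W := rfl
theorem Ex.eval_five : (5 : Ex).eval W I M R = 5 % 2 ^ W := rfl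
theorem Ex.eval_six : (6 : Ex).eval W I M R = 6 % 2 ^ W := rfl
theorem Ex.eval_sixteen : (16 : Ex).eval W I M R = 16 % 2 ^ W := rfl
theorem Ex.eval_msb (a : Ex) : a.msb.eval W I M R = Nat.log 2 (a.eval W I M R) := rfl
theorem Ex.eval_load (a : Ex) : a.load.eval W I M R = M (a.eval W I M R) := rfl
theorem Ex.eval_chars (a : Ex) :
    a.chars.eval W I M R = I.key (I.str (a.eval W I M R)) % 2 ^ W := rfl
theorem Ex.eval_random (a : Ex) : a.random.eval W I M R = I.draws (a.eval W I M R) := rfl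

end Eval

/-- The registers below `b` have the same contents in `R` and `R'`. -/
def Same (P b : ℕ) (R R' : ℕ → ℕ → ℕ) : Prop := ∀ i < P, ∀ r < b, R' i r = R i r

theorem Same.refl (P b : ℕ) (R : ℕ → ℕ → ℕ) : Same P b R R := fun _ _ _ _ => rfl

theorem Same.trans {P b : ℕ} {R R' R'' : ℕ → ℕ → ℕ} (h : Same P b R R') (h' : Same P b R' R'') :
    Same P b R R'' := fun i hi r hr => (h' i hi r hr).trans (h i hi r hr)

theorem Same.mono {P b b' : ℕ} {R R' : ℕ → ℕ → ℕ} (h : Same P b R R') (hb : b' ≤ b) :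
    Same P b' R R' := fun i hi r hr => h i hi r (hr.trans_le hb)

theorem Same.update {P b r : ℕ} {R R' : ℕ → ℕ → ℕ} {f : ℕ → ℕ} (hr : b ≤ r) (h : Same P b R R') :
    Same P b R (fun i => Function.update (R' i) r (f i)) := by
  intro i hi r' hr'
  simp only
  rw [Function.update_of_ne (by omega)]
  exact h i hi r' hr'

/-- `for c in 0, …, lim - 1 do body`; the register `f` holds the value of the loop test. -/
def forLoop (c f : ℕ) (lim : Ex) (body : List Stmt) : List Stmt :=
  assign c 0 ++ (assign f (.lt (.reg c) lim) ++
    ([.loop f (body ++ (assign c (.reg c + 1) ++ (assign f (.lt (.reg c) lim) ++ [])))] ++ []))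

/-- The rule for a counting loop with invariant `Inv`, which must not depend on the registers `c` and
`f`. -/
theorem WP.forLoop {p W P : ℕ} {I : Instance} {R : ℕ → ℕ → ℕ} {M : ℕ → ℕ} {c f : ℕ} {lim : Ex}
    {body S : List Stmt} {T : ℕ} {Q : (ℕ → ℕ → ℕ) → (ℕ → ℕ) → Prop}
    (Inv : ℕ → (ℕ → ℕ → ℕ) → (ℕ → ℕ) → Prop) (m tb : ℕ) (hm : m < 2 ^ W) (hcf : c ≠ f)
    (hc : c < 64) (hf : f < 64) (hok : lim.ok = true)
    (hlim : ∀ j R M, Inv j R M → ∀ i < P, lim.eval W I M (R i) = m)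
    (hcongr : ∀ j R M, ∀ r ∈ [c, f], ∀ x : ℕ → ℕ, Inv j R M →
      Inv j (fun i => Function.update (R i) r (x i)) M)
    (h0 : Inv 0 R M)
    (hbody : ∀ j < m, ∀ R M, Inv j R M → (∀ i < P, R i c = j) →
      WP p W I P body R M tb fun R' M' => Inv (j + 1) R' M' ∧ ∀ i < P, R' i c = j)
    (hQ : ∀ R' M', Inv m R' M' → WP p W I P S R' M' T Q) :
    WP p W I P (forLoop c f lim body ++ S) R M ((lim.cost + 3 + m * (tb + lim.cost + 4)) + T) Q := by
  have hW : 1 ≤ 2 ^ W := Nat.one_le_two_pow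
  refine WP.append ?_
  have hupd : ∀ (R : ℕ → ℕ → ℕ) (k : ℕ) (g : ℕ → ℕ) i,
      Function.update (Function.update (R i) c k) f (g i) c = k := by
    intro R k g i
    rw [Function.update_of_ne hcf, Function.update_self]
  unfold S5.forLoop
  refine WP.mono (T := (1 + (lim.cost + 1) + (∑ j ∈ Finset.range m, (tb + lim.cost + 3 + 1) + 1)))
    (Q := Inv m) ?_ ?_ hQ
  swap
  · rw [Finset.sum_const, Finset.card_range, smul_eq_mul]
    ring_nf
    omega
  rw [Nat.add_assoc]
  refine WP.assign (fun _ => 0) (fun i hi => Nat.zero_mod _) ?_ hc rfl rfl le_rfl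
  rw [show 1 - Ex.cost (0 : Ex) + (lim.cost + 1 + (∑ j ∈ Finset.range m, (tb + lim.cost + 3 + 1) + 1))
    = (lim.cost + 1) + (∑ j ∈ Finset.range m, (tb + lim.cost + 3 + 1) + 1) from Nat.zero_add _]
  have h0' : Inv 0 (fun i => Function.update (R i) c 0) M := hcongr _ _ _ c (by simp) _ h0
  refine WP.assign (fun i => if 0 < m then 1 else 0) (fun i hi => ?_) ?_ hf
    (by simp [Ex.ok, hok, hc]) rfl (by simp [Ex.cost])
  · rw [Ex.eval_lt, hlim _ _ _ h0' i hi, Ex.eval_reg, Function.update_self]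
    split_ifs with h
    · exact Nat.mod_eq_of_lt (by omega)
    · simp
  rw [show (lim.cost + 1 - ((Ex.reg c).lt lim).cost) = 0 from by simp [Ex.cost], Nat.zero_add]
  refine WP.append (T₂ := 0) ?_
  refine (WP.loop (fun j R M => Inv j R M ∧ (∀ i < P, R i c = j) ∧
    ∀ i < P, R i f = if j < m then 1 else 0) m (fun _ => tb + lim.cost + 3) hf ?_ ?_ ?_).mono le_rfl
    (fun R' M' h => WP.nil h.1)
  · refine ⟨hcongr _ _ _ f (by simp) _ h0', fun i hi => hupd _ _ (fun _ => _) i, fun i hi => ?_⟩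
    simp
  · rintro j hj R M ⟨hI, hRc, hRf⟩
    refine ⟨fun i hi => by simp [hRf i hi, hj], ?_⟩
    rw [Nat.add_assoc]
    refine WP.append ((hbody j hj R M hI hRc).mono le_rfl ?_)
    rintro R' M' ⟨hI', hRc'⟩
    rw [show lim.cost + 3 = 2 + (lim.cost + 1) by omega]
    refine WP.assign (fun _ => j + 1) (fun i hi => ?_) ?_ hc (by change (decide (c < 64) && true) = true; simp [hc]) rfl le_rfl
    · rw [Ex.eval_add, Ex.eval_lit, Ex.eval_reg, hRc' i hi, Nat.add_mod_mod]
      exact Nat.mod_eq_of_lt (by omega)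
    have hI'' : Inv (j + 1) (fun i => Function.update (R' i) c (j + 1)) M' :=
      hcongr _ _ _ c (by simp) _ hI'
    rw [show 2 - (Ex.reg c + 1).cost + (lim.cost + 1) = (lim.cost + 1) + 0 from by
      change 2 - 2 + _ = _; omega]
    refine WP.assign (fun i => if j + 1 < m then 1 else 0) (fun i hi => ?_) ?_ hf
      (by simp [Ex.ok, hok, hc]) rfl (by simp [Ex.cost])
    · rw [Ex.eval_lt, hlim _ _ _ hI'' i hi, Ex.eval_reg, Function.update_self]
      split_ifs with h
      · exact Nat.mod_eq_of_lt (by omega)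
      · simp
    refine WP.nil ⟨hcongr _ _ _ f (by simp) _ hI'', fun i hi => hupd _ _ (fun _ => _) i, fun i hi => ?_⟩
    simp
  · rintro R M ⟨_, _, h⟩ i hi
    simp [h i hi]

/-! ### The memory layout

With `D = stride P`, the cells from `D` and from `2 D` on are the working areas of the merge sort, the
counters are at `3 D`, the buckets of the strings at `4 D`, their ranks at `5 D`, and the sums of the
processors at `6 D`. The output lies before `D`.
-/

namespace Instance

variable (I : Instance)

/-- The distance of consecutive working areas in the shared memory when `P` processors are used. -/
def stride (P : ℕ) : ℕ := 16 * I.α * (I.n + P * I.v)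

/-- The number of sorted elements: a power of two that is larger than the sample size. -/
def sortSize : ℕ := 2 ^ (Nat.log 2 I.sampleSize + 1)

end Instance

/-- The standing assumptions for `P` processors that work in lockstep. -/
structure Setup (p W P : ℕ) (I : Instance) : Prop where
  one_le_P : 1 ≤ P
  P_le : P ≤ p
  adm : I.Admissible W
  bound : 64 * I.stride P ≤ 2 ^ W

/-- The contents of the registers below `12` that are constant in most of the program. The registers
from `16` on hold local variables, and register `13` holds the address of the sorted sample. -/
structure Env (I : Instance) (P : ℕ) (E : ℕ → ℕ → ℕ) : Prop where
  id : ∀ i < P, E i 0 = i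
  n : ∀ i < P, E i 2 = I.n
  v : ∀ i < P, E i 3 = I.v
  α : ∀ i < P, E i 4 = I.α
  w : ∀ i < P, E i 5 = I.w
  β : ∀ i < P, E i 6 = I.β
  procs : ∀ i < P, E i 7 = P
  D : ∀ i < P, E i 9 = I.stride P
  a : ∀ i < P, E i 10 = I.sampleSize
  N : ∀ i < P, E i 11 = I.sortSize

theorem Env.same {I : Instance} {P b : ℕ} {E E' : ℕ → ℕ → ℕ} (h : Env I P E) (hs : Same P b E E')
    (hb : 12 ≤ b := by decide) : Env I P E' where
  id i hi := (hs i hi 0 (by omega)).trans (h.id i hi)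
  n i hi := (hs i hi 2 (by omega)).trans (h.n i hi)
  v i hi := (hs i hi 3 (by omega)).trans (h.v i hi)
  α i hi := (hs i hi 4 (by omega)).trans (h.α i hi)
  w i hi := (hs i hi 5 (by omega)).trans (h.w i hi)
  β i hi := (hs i hi 6 (by omega)).trans (h.β i hi)
  procs i hi := (hs i hi 7 (by omega)).trans (h.procs i hi)
  D i hi := (hs i hi 9 (by omega)).trans (h.D i hi)
  a i hi := (hs i hi 10 (by omega)).trans (h.a i hi)
  N i hi := (hs i hi 11 (by omega)).trans (h.N i hi)

/-- A parallel loop that writes the value of `val` to the cells `base + k` for `k < cnt * P`.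
In round `r`, processor `i` is responsible for `k = r P + i`, which it holds in register `22`. -/
def parFor (cnt base val : Ex) : List Stmt :=
  forLoop 20 21 cnt
    (assign 22 (.reg 20 * .reg 7 + .reg 0) ++ (put (base + .reg 22) val ++ []))

/-- The rule for a parallel loop: the cells `base + k` with `k < m` get the values `g k`, provided that
the values do not depend on the cells that the loop writes. -/
theorem WP.parFor {p W P : ℕ} {I : Instance} (hS : Setup p W P I) {E R : ℕ → ℕ → ℕ} {M : ℕ → ℕ}
    {S : List Stmt} {T : ℕ} {Q : (ℕ → ℕ → ℕ) → (ℕ → ℕ) → Prop} {cntE baseE valE : Ex}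
    (cnt base m : ℕ) (g : ℕ → ℕ)
    (hE : Env I P E) (hR : Same P 16 E R)
    (hm : m ≤ cnt * P) (hmem : base + cnt * P < 2 ^ W)
    (hcnt : ∀ M R, Same P 16 E R → ∀ i < P, cntE.eval W I M (R i) = cnt)
    (hbase : ∀ M R, Same P 16 E R → ∀ i < P, baseE.eval W I M (R i) = base)
    (hval : ∀ M' R, (∀ x, x < base ∨ base + cnt * P ≤ x → M' x = M x) → Same P 16 E R →
      ∀ i < P, R i 22 < m → valE.eval W I M' (R i) = g (R i 22))
    (hQ : ∀ R' M', Same P 16 E R' → (∀ k < m, M' (base + k) = g k) →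
      (∀ x, x < base ∨ base + cnt * P ≤ x → M' x = M x) → WP p W I P S R' M' T Q)
    (hok1 : cntE.ok = true := by decide) (hok2 : baseE.ok = true := by decide)
    (hok3 : valE.ok = true := by decide) :
    WP p W I P (parFor cntE baseE valE ++ S) R M
      ((cntE.cost + 3 + cnt * (baseE.cost + valE.cost + 4 + cntE.cost + 4)) + T) Q := by
  have hP := hS.one_le_P
  have hcP : cnt ≤ cnt * P := Nat.le_mul_of_pos_right _ hP
  refine WP.forLoop (fun j R' M' => Same P 16 E R' ∧
      (∀ k < j * P, k < m → M' (base + k) = g k) ∧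
      (∀ x, x < base ∨ base + cnt * P ≤ x → M' x = M x)) cnt _ (by omega) (by decide) (by decide)
    (by decide) hok1 (fun j R M h => hcnt M R h.1) ?_ ?_ ?_ ?_
  · rintro j R M r hr x ⟨h1, h2⟩
    refine ⟨h1.update ?_, h2⟩
    simp at hr
    omega
  · exact ⟨hR, fun k hk => by omega, fun _ _ => rfl⟩
  · rintro j hj R' M' ⟨h1, h2, h3⟩ hRj
    have hE' := hE.same h1
    have hj1 : (j + 1) * P ≤ cnt * P := Nat.mul_le_mul_right _ hj
    rw [Nat.add_mul, Nat.one_mul] at hj1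
    rw [show baseE.cost + valE.cost + 4 = 2 + (baseE.cost + valE.cost + 2) by omega]
    refine WP.assign (fun i => j * P + i) (fun i hi => ?_) ?_ (by decide) rfl rfl le_rfl
    · simp only [Ex.eval_add, Ex.eval_mul, Ex.eval_reg, hRj i hi, hE'.procs i hi, hE'.id i hi,
        Nat.mod_add_mod]
      exact Nat.mod_eq_of_lt (by omega)
    have h1' : Same P 16 E (fun i => Function.update (R' i) 22 (j * P + i)) := h1.update (by decide)
    change WP _ _ _ _ _ _ _ (0 + (baseE.cost + valE.cost + 2)) _
    rw [Nat.zero_add]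
    classical
    refine WP.put (k := baseE.cost + valE.cost + 2) (X := 0) hS.P_le (fun i => base + (j * P + i))
      (fun i => valE.eval W I M' (Function.update (R' i) 22 (j * P + i))) (fun i hi => ?_)
      (fun i hi => rfl) (fun i hi i' hi' h => by omega) ?_ ?_ hok3 ?_
    · simp only [Ex.eval_add, hbase M' _ h1' i hi, Ex.eval_reg, Function.update_self]
      exact Nat.mod_eq_of_lt (by omega)
    · intro M'' hM1 hM2
      refine WP.nil ⟨⟨h1', ?_, ?_⟩, fun i hi => ?_⟩
      · intro k hk hkm
        rw [Nat.add_mul, Nat.one_mul] at hk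
        by_cases hkj : k < j * P
        · rw [hM2 _ (fun i hi => by omega)]
          exact h2 k hkj hkm
        · obtain ⟨i, rfl⟩ := Nat.exists_eq_add_of_le (not_lt.1 hkj)
          rw [hM1 i (by omega)]
          have := hval M' _ h3 h1' i (by omega)
          simp only [Function.update_self] at this
          exact this hkm
      · intro x hx
        rw [hM2 x (fun i hi => by omega)]
        exact h3 x hx
      · simp [Function.update_of_ne, hRj i hi]
    · change (baseE.ok && true) = true
      simp [hok2]
    · change baseE.cost + (0 + 1) + valE.cost + 1 ≤ _
      omega
  · rintro R' M' ⟨h1, h2, h3⟩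
    exact hQ R' M' h1 (fun k hk => h2 k (by omega) hk) h3

/-! ### Size estimates -/

section Sizes

variable {p W P : ℕ} {I : Instance}

theorem Instance.v_add_one (I : Instance) : I.v + 1 = 2 ^ I.d := by
  have := Nat.one_le_two_pow (n := I.d)
  unfold Instance.v
  omega

theorem Instance.Admissible.one_le_v {W : ℕ} (h : I.Admissible W) : 1 ≤ I.v := by
  have h1 := I.v_add_one
  have h2 : 2 ^ 1 ≤ 2 ^ I.d := Nat.pow_le_pow_right (by decide) h.one_le_d
  omega

theorem Instance.Admissible.log_v {W : ℕ} (h : I.Admissible W) : Nat.log 2 I.v + 1 = I.d := by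
  have h1 := I.v_add_one
  obtain ⟨e, he⟩ := Nat.exists_eq_add_of_le' h.one_le_d
  rw [he, pow_succ] at h1
  have := Nat.one_le_two_pow (n := e)
  rw [he, Nat.log_eq_of_pow_le_of_lt_pow (m := e) (by omega) (by rw [pow_succ]; omega)]

theorem Instance.Admissible.sampleSize_add_one {W : ℕ} (h : I.Admissible W) :
    I.sampleSize + 1 = I.α * (I.v + 1) := by
  have := h.one_le_α
  unfold Instance.sampleSize
  rw [Nat.mul_add]
  omega

theorem Instance.Admissible.v_le_sampleSize {W : ℕ} (h : I.Admissible W) : I.v ≤ I.sampleSize := by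
  have h1 := h.sampleSize_add_one
  have := Nat.mul_le_mul_right (I.v + 1) h.one_le_α
  omega

theorem Instance.Admissible.v_le_n {W : ℕ} (h : I.Admissible W) : I.v ≤ I.n :=
  h.v_le_sampleSize.trans h.sample_le

theorem Instance.sampleSize_lt_sortSize : I.sampleSize < I.sortSize :=
  Nat.lt_pow_succ_log_self (by decide) _

theorem Instance.Admissible.sortSize_le {W : ℕ} (h : I.Admissible W) :
    I.sortSize ≤ 2 * I.sampleSize := by
  have h1 := h.v_le_sampleSize
  have h2 := h.one_le_v
  unfold Instance.sortSize
  rw [pow_succ, mul_comm]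
  exact Nat.mul_le_mul_left _ (Nat.pow_log_le_self 2 (by omega))

theorem Instance.Admissible.sampleSize_le {W : ℕ} (h : I.Admissible W) :
    I.sampleSize ≤ 2 * (I.α * I.v) := by
  have h1 := h.sampleSize_add_one
  have h2 := Nat.mul_le_mul_left I.α h.one_le_v
  rw [Nat.mul_add] at h1
  omega

namespace Setup

variable (h : Setup p W P I)
include h

theorem le_stride : 16 * (I.n + P * I.v) ≤ I.stride P := by
  have := Nat.mul_le_mul_right (I.n + P * I.v) (Nat.mul_le_mul_left 16 h.adm.one_le_α)
  simpa [Instance.stride] using this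

theorem P_le_mul : P ≤ P * I.v := Nat.le_mul_of_pos_right _ h.adm.one_le_v

theorem v_le_mul : I.v ≤ P * I.v := Nat.le_mul_of_pos_left _ h.one_le_P

/-- The working areas of the merge sort have room for the blocks of all processors, also for those that
lie behind the end of the sequence. -/
theorem sort_le : I.sortSize * P + I.sortSize ≤ I.stride P := by
  have h1 := h.adm.sortSize_le
  have h2 := h.adm.sampleSize_le
  have h3 : I.sortSize * P ≤ 4 * (I.α * I.v) * P := Nat.mul_le_mul_right _ (by omega)
  have h4 : I.sortSize * 1 ≤ I.sortSize * P := Nat.mul_le_mul_left _ h.one_le_P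
  unfold Instance.stride
  nlinarith [Nat.zero_le (I.α * I.n), Nat.zero_le (I.α * I.v * P)]

theorem P_lt : P < 2 ^ W := by
  have := h.le_stride
  have := h.P_le_mul
  have := h.bound
  have := h.one_le_P
  omega

end Setup

theorem div_add_one_mul_le (a b : ℕ) : (a / b + 1) * b ≤ a + b := by
  rw [Nat.add_mul, Nat.one_mul]
  exact Nat.add_le_add_right (Nat.div_mul_le_self a b) b

theorem lt_div_add_one_mul {b : ℕ} (a : ℕ) (hb : 0 < b) : a < (a / b + 1) * b := by
  rw [mul_comm]
  exact Nat.lt_mul_div_succ a hb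

end Sizes

/-! ### Keys -/

section Keys

variable {W : ℕ} {I : Instance}

/-- A number with `w` digits, given from the most significant to the least significant. -/
theorem sum_digits_lt (β : ℕ) (f : ℕ → ℕ) (hf : ∀ j, f j < 2 ^ β) (w : ℕ) :
    ∑ j ∈ Finset.range w, f j * 2 ^ (β * (w - 1 - j)) < 2 ^ (β * w) := by
  induction w generalizing f with
  | zero => simp
  | succ w ih =>
    rw [Finset.sum_range_succ']
    have := ih (fun j => f (j + 1)) (fun j => hf _)
    have h2 : ∑ k ∈ Finset.range w, f (k + 1) * 2 ^ (β * (w + 1 - 1 - (k + 1))) =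
      ∑ k ∈ Finset.range w, f (k + 1) * 2 ^ (β * (w - 1 - k)) :=
      Finset.sum_congr rfl fun k _ => by congr 3; omega
    rw [h2]
    have h3 := Nat.mul_le_mul_right (2 ^ (β * w)) (Nat.succ_le_of_lt (hf 0))
    rw [Nat.mul_add, pow_add, mul_one, mul_comm (2 ^ (β * w))]
    simp only [Nat.succ_eq_add_one, Nat.add_mul, one_mul] at h3
    simp only [Nat.add_sub_cancel, Nat.sub_zero]
    omega

theorem Instance.Admissible.getD_lt (h : I.Admissible W) {i : ℕ} (hi : i < I.n) (j : ℕ) :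
    (I.input i).getD j 0 < 2 ^ I.β := by
  by_cases hj : j < (I.input i).length
  · rw [List.getD_eq_getElem _ _ hj]
    exact (h.char_range i hi _ (List.getElem_mem hj)).2
  · rw [List.getD_eq_default _ _ (not_lt.1 hj)]
    positivity

theorem Instance.Admissible.key_lt_pow (h : I.Admissible W) {i : ℕ} (hi : i < I.n) :
    I.key (I.input i) < 2 ^ (I.β * I.w) :=
  sum_digits_lt I.β (fun j => (I.input i).getD (I.h + j) 0) (fun _ => h.getD_lt hi _) I.w

theorem Instance.Admissible.key_lt (h : I.Admissible W) {i : ℕ} (hi : i < I.n) :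
    I.key (I.input i) < 2 ^ W :=
  (h.key_lt_pow hi).trans_le (Nat.pow_le_pow_right (by decide) h.key_fits)

end Keys

/-! ### The sample -/

/-- Element `k` of the sample; from the sample size on, it is padded with zeros. -/
def Instance.sampleKey (I : Instance) (k : ℕ) : ℕ :=
  if k < I.sampleSize then I.key (I.input (I.draws k)) else 0

/-- The keys of the sample are written to the cells from `D` on, followed by zeros. -/
def sampleCode : List Stmt :=
  parFor (.reg 11 / .reg 7 + 1) (.reg 9)
    (.lt (.reg 22) (.reg 10) * .chars (.load (.random (.reg 22))))

theorem WP.sampleCode {p W P : ℕ} {I : Instance} (hS : Setup p W P I) {E R : ℕ → ℕ → ℕ} {M : ℕ → ℕ}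
    {S : List Stmt} {T : ℕ} {Q : (ℕ → ℕ → ℕ) → (ℕ → ℕ) → Prop}
    (hE : Env I P E) (hR : Same P 16 E R) (hM : ∀ x < I.n, M x = I.mem x)
    (hQ : ∀ R' M', Same P 16 E R' → (∀ k < I.sortSize, M' (I.stride P + k) = I.sampleKey k) →
      (∀ x < I.stride P, M' x = M x) → WP p W I P S R' M' T Q) :
    WP p W I P (sampleCode ++ S) R M (100 * (I.sortSize / P + 1) + T) Q := by
  have h1 := hS.sort_le
  have h2 := hS.bound
  have h3 := div_add_one_mul_le I.sortSize P
  have h4 := hS.le_stride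
  have h5 := hS.P_le_mul
  have h6 := hS.one_le_P
  have h8 := hS.P_lt
  have h9 : I.sortSize / P ≤ I.sortSize := Nat.div_le_self _ _
  refine (WP.parFor hS (I.sortSize / P + 1) (I.stride P) I.sortSize I.sampleKey hE hR
    (lt_div_add_one_mul _ h6).le (by omega) (fun M R hR i hi => ?_) (fun M R hR i hi => ?_) ?_
    (fun R' M' a b c => hQ R' M' a b fun x hx => c x (Or.inl hx))).mono ?_ (fun _ _ h => h)
  · have hE' := hE.same hR
    rw [Ex.eval_add, Ex.eval_div, Ex.eval_reg, Ex.eval_reg, hE'.N i hi, hE'.procs i hi, Ex.eval_lit,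
      Nat.mod_add_mod, Nat.add_mod_mod]
    exact Nat.mod_eq_of_lt (by omega)
  · exact (hE.same hR).D i hi
  · intro M' R hM' hR i hi hk
    have hE' := hE.same hR
    have hd := hS.adm.draws_lt (R i 22)
    simp only [Ex.eval_mul, Ex.eval_lt, Ex.eval_reg, Ex.eval_chars, Ex.eval_load, Ex.eval_random,
      hE'.a i hi]
    rw [hM' _ (Or.inl (by omega)), hM _ hd]
    have hk := hS.adm.key_lt hd
    unfold Instance.sampleKey
    split_ifs with hlt
    · rw [Nat.mod_mul_mod, one_mul, Nat.mod_mod]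
      exact Nat.mod_eq_of_lt hk
    · simp
  -- the costs of the expressions are computed by definitional unfolding
  · change 3 + 3 + (I.sortSize / P + 1) * (0 + 5 + 4 + 3 + 4) + T ≤ _
    generalize I.sortSize / P = y
    omega

/-- The counters are set to zero. -/
def zeroCode : List Stmt := parFor (2 * .reg 3 + 2) (3 * .reg 9) 0

theorem WP.zeroCode {p W P : ℕ} {I : Instance} (hS : Setup p W P I) {E R : ℕ → ℕ → ℕ} {M : ℕ → ℕ}
    {S : List Stmt} {T : ℕ} {Q : (ℕ → ℕ → ℕ) → (ℕ → ℕ) → Prop}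
    (hE : Env I P E) (hR : Same P 16 E R)
    (hQ : ∀ R' M', Same P 16 E R' → (∀ k < (2 * I.v + 2) * P, M' (3 * I.stride P + k) = 0) →
      (∀ x < 3 * I.stride P, M' x = M x) → WP p W I P S R' M' T Q) :
    WP p W I P (zeroCode ++ S) R M (100 * (2 * I.v + 3) + T) Q := by
  have h2 := hS.bound
  have h4 := hS.le_stride
  have h5 := hS.P_le_mul
  have h6 := hS.one_le_P
  have h7 := hS.v_le_mul
  have h8 : (2 * I.v + 2) * P = 2 * (P * I.v) + 2 * P := by ring
  refine (WP.parFor hS (2 * I.v + 2) (3 * I.stride P) ((2 * I.v + 2) * P) (fun _ => 0) hE hR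
    le_rfl (by omega) (fun M R hR i hi => ?_) (fun M R hR i hi => ?_) ?_
    (fun R' M' a b c => hQ R' M' a b fun x hx => c x (Or.inl hx))).mono ?_ (fun _ _ h => h)
  · have hE' := hE.same hR
    simp only [Ex.eval_add, Ex.eval_mul, Ex.eval_reg, Ex.eval_two, hE'.v i hi,
      Nat.mod_add_mod, Nat.add_mod_mod, Nat.mod_mul_mod]
    exact Nat.mod_eq_of_lt (by omega)
  · have hE' := hE.same hR
    simp only [Ex.eval_mul, Ex.eval_reg, Ex.eval_three, hE'.D i hi, Nat.mod_mul_mod]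
    exact Nat.mod_eq_of_lt (by omega)
  · intro M' R hM' hR i hi hk
    exact Nat.zero_mod _
  · change 4 + 3 + (2 * I.v + 2) * (2 + 1 + 4 + 4 + 4) + T ≤ _
    omega

/-! ### Merging lists -/

section Merge

/-- A merge that has output `t` elements, `i` of them from `A` and `j` from `B`, takes the next element
from `A`. -/
theorem merge_step_left {A B : List ℕ} {i j t : ℕ} (hi : i < A.length)
    (h : j < B.length → A.getD i 0 ≤ B.getD j 0)
    (hd : (A.merge B (· ≤ ·)).drop t = (A.drop i).merge (B.drop j) (· ≤ ·)) :
    (A.merge B (· ≤ ·)).drop (t + 1) = (A.drop (i + 1)).merge (B.drop j) (· ≤ ·) ∧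
      (A.merge B (· ≤ ·)).getD t 0 = A.getD i 0 := by
  have key : (A.merge B (· ≤ ·)).drop t =
      A.getD i 0 :: (A.drop (i + 1)).merge (B.drop j) (· ≤ ·) := by
    rw [hd, List.drop_eq_getElem_cons hi, List.getD_eq_getElem _ _ hi]
    by_cases hj : j < B.length
    · rw [List.drop_eq_getElem_cons hj, List.cons_merge_cons]
      have := h hj
      rw [List.getD_eq_getElem _ _ hi, List.getD_eq_getElem _ _ hj] at this
      simp [this]
    · rw [List.drop_eq_nil_of_le (not_lt.1 hj)]
      simp
  constructor
  · rw [← List.drop_drop, key]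
    rfl
  · have := congrArg (fun l => l.getD 0 0) key
    simpa [List.getD_eq_getElem?_getD, List.getElem?_drop] using this

/-- A merge that has output `t` elements, `i` of them from `A` and `j` from `B`, takes the next element
from `B`. -/
theorem merge_step_right {A B : List ℕ} {i j t : ℕ} (hj : j < B.length)
    (h : i < A.length → B.getD j 0 < A.getD i 0)
    (hd : (A.merge B (· ≤ ·)).drop t = (A.drop i).merge (B.drop j) (· ≤ ·)) :
    (A.merge B (· ≤ ·)).drop (t + 1) = (A.drop i).merge (B.drop (j + 1)) (· ≤ ·) ∧
      (A.merge B (· ≤ ·)).getD t 0 = B.getD j 0 := by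
  have key : (A.merge B (· ≤ ·)).drop t =
      B.getD j 0 :: (A.drop i).merge (B.drop (j + 1)) (· ≤ ·) := by
    rw [hd, List.drop_eq_getElem_cons hj, List.getD_eq_getElem _ _ hj]
    by_cases hi : i < A.length
    · rw [List.drop_eq_getElem_cons hi, List.cons_merge_cons]
      have := h hi
      rw [List.getD_eq_getElem _ _ hi, List.getD_eq_getElem _ _ hj] at this
      simp [this]
    · rw [List.drop_eq_nil_of_le (not_lt.1 hi)]
      simp
  constructor
  · rw [← List.drop_drop, key]
    rfl
  · have := congrArg (fun l => l.getD 0 0) key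
    simpa [List.getD_eq_getElem?_getD, List.getElem?_drop] using this

/-- The `s`-th block after `k` rounds of bottom-up merge sort of the sequence `x`: the elements
`x (s * 2 ^ k), …, x ((s + 1) * 2 ^ k - 1)` in sorted order. -/
def sortedBlock (x : ℕ → ℕ) : ℕ → ℕ → List ℕ
  | 0, s => [x s]
  | k + 1, s => (sortedBlock x k (2 * s)).merge (sortedBlock x k (2 * s + 1)) (· ≤ ·)

theorem length_sortedBlock (x : ℕ → ℕ) (k s : ℕ) : (sortedBlock x k s).length = 2 ^ k := by
  induction k generalizing s with
  | zero => rfl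
  | succ k ih =>
    simp [sortedBlock, List.length_merge, ih, pow_succ]
    omega

theorem pairwise_sortedBlock (x : ℕ → ℕ) (k s : ℕ) : (sortedBlock x k s).Pairwise (· ≤ ·) := by
  induction k generalizing s with
  | zero => simp [sortedBlock]
  | succ k ih =>
    exact List.Pairwise.merge (r := (· ≤ ·)) (ih _) (ih _)

theorem sortedBlock_perm (x : ℕ → ℕ) (k s : ℕ) :
    (sortedBlock x k s).Perm ((List.range' (s * 2 ^ k) (2 ^ k)).map x) := by
  induction k generalizing s with
  | zero => simp [sortedBlock]
  | succ k ih =>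
    refine List.Perm.trans (List.merge_perm_append _) ?_
    refine ((ih (2 * s)).append (ih (2 * s + 1))).trans ?_
    rw [← List.map_append]
    rw [show (2 * s + 1) * 2 ^ k = 2 * s * 2 ^ k + 2 ^ k by ring, List.range'_append_1,
      show s * 2 ^ (k + 1) = 2 * s * 2 ^ k by ring, show 2 ^ (k + 1) = 2 ^ k + 2 ^ k by ring]

/-- After the sort, the zeros with which the sample is padded precede the sorted sample. -/
theorem sortedBlock_sampleKey (I : Instance) (u : ℕ) :
    (sortedBlock I.sampleKey (Nat.log 2 I.sampleSize + 1) 0).getD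
      (I.sortSize - I.sampleSize + u) 0 = I.sortedSample.getD u 0 := by
  have hlt := I.sampleSize_lt_sortSize
  have key : sortedBlock I.sampleKey (Nat.log 2 I.sampleSize + 1) 0 =
      List.replicate (I.sortSize - I.sampleSize) 0 ++ I.sortedSample := by
    refine List.Perm.eq_of_pairwise (le := (· ≤ ·)) (fun a b _ _ => le_antisymm) (pairwise_sortedBlock _ _ _) ?_ ?_
    · rw [List.pairwise_append]
      refine ⟨List.pairwise_replicate.2 (Or.inr le_rfl), ?_, ?_⟩
      · exact List.pairwise_mergeSort' (r := (· ≤ ·)) _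
      · intro a ha b _
        rw [List.eq_of_mem_replicate ha]
        exact Nat.zero_le _
    · refine (sortedBlock_perm _ _ _).trans ?_
      rw [Nat.zero_mul, ← List.range_eq_range']
      change ((List.range I.sortSize).map _).Perm _
      obtain ⟨z, hz⟩ := Nat.exists_eq_add_of_le hlt.le
      rw [hz, List.range_add, List.map_append]
      refine List.perm_append_comm.trans (List.Perm.append ?_ ?_)
      · rw [Nat.add_sub_cancel_left]
        refine List.Perm.of_eq (List.eq_replicate_iff.2 ⟨by simp, ?_⟩)
        intro b hb
        simp only [List.map_map, List.mem_map] at hb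
        obtain ⟨y, _, rfl⟩ := hb
        simp [Instance.sampleKey]
      · refine List.Perm.trans ?_ (List.mergeSort_perm _ _).symm
        refine List.Perm.of_eq (List.map_congr_left fun k hk => ?_)
        simp [Instance.sampleKey, List.mem_range.1 hk]
  rw [key, List.getD_append_right _ _ _ _ (by simp)]
  simp

end Merge
/-! ### Parallel merge sort -/

/-- One step of a merge. Register `31` gets the next element of the left block, `32` the next element
of the right block, and `33` says whether the left one is taken. -/
def mergeStepCode : List Stmt :=
  assign 31 (.load (.reg 16 + .reg 26 + .reg 27)) ++
  (assign 32 (.load (.reg 16 + .reg 26 + .reg 18 + .reg 28)) ++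
  (assign 33 (.lt (.reg 27) (.reg 18) *
    (1 - .lt (.reg 28) (.reg 18) * .lt (.reg 32) (.reg 31))) ++
  (put (.reg 17 + .reg 26 + .reg 29) (.reg 33 * .reg 31 + (1 - .reg 33) * .reg 32) ++
  (assign 27 (.reg 27 + .reg 33) ++
  (assign 28 (.reg 28 + (1 - .reg 33)) ++ [])))))

/-- Each processor merges one pair of adjacent blocks. -/
def mergePairCode : List Stmt :=
  assign 26 ((.reg 23 * .reg 7 + .reg 0) * (2 * .reg 18)) ++
  (assign 27 0 ++ (assign 28 0 ++ (forLoop 29 30 (2 * .reg 18) mergeStepCode ++ [])))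

/-- One level of the merge sort, for blocks with the length in register `18`, from the working area
at register `16` to that at register `17`, whose roles are exchanged afterwards. -/
def mergeLevelCode : List Stmt :=
  assign 22 (.reg 11 / (2 * .reg 18) / .reg 7 + 1) ++
  (forLoop 23 24 (.reg 22) mergePairCode ++
  (assign 16 (3 * .reg 9 - .reg 16) ++
  (assign 17 (3 * .reg 9 - .reg 17) ++
  (assign 18 (2 * .reg 18) ++
  (assign 19 (.lt (.reg 18) (.reg 11)) ++ [])))))

/-- Merge sort of the padded sample. Register `13` gets the address before that of the smallest element
of the sample. -/
def sortCode : List Stmt :=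
  assign 16 (1 * .reg 9) ++ (assign 17 (2 * .reg 9) ++ (assign 18 1 ++
  (assign 19 (.lt (.reg 18) (.reg 11)) ++
  ([.loop 19 mergeLevelCode] ++
  (assign 13 (.reg 16 + .reg 11 - .reg 10 - 1) ++ [])))))

section

variable {p W P : ℕ} {I : Instance} {M : ℕ → ℕ}

/-- The invariant of a merge after `t` steps. Block `A` is stored at `src + lo i`, followed by block
`B`, and the result at `dst + lo i`. In the last round some processors have blocks behind the end of the
sequence, about which nothing is known; `good i` says that processor `i` has proper blocks. -/
structure MergeInv (P : ℕ) (R₀ : ℕ → ℕ → ℕ) (M₀ : ℕ → ℕ) (good : ℕ → Prop) (A B : ℕ → List ℕ)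
    (w dst : ℕ) (lo : ℕ → ℕ) (t : ℕ) (R : ℕ → ℕ → ℕ) (M : ℕ → ℕ) : Prop where
  same : Same P 27 R₀ R
  sum : ∀ i < P, good i → R i 27 + R i 28 = t
  left : ∀ i < P, good i → R i 27 ≤ w
  right : ∀ i < P, good i → R i 28 ≤ w
  rest : ∀ i < P, good i → ((A i).merge (B i) (· ≤ ·)).drop t =
    ((A i).drop (R i 27)).merge ((B i).drop (R i 28)) (· ≤ ·)
  out : ∀ i < P, good i → ∀ u < t, M (dst + lo i + u) = ((A i).merge (B i) (· ≤ ·)).getD u 0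
  frame : ∀ x, (∀ i < P, x < dst + lo i ∨ dst + lo i + 2 * w ≤ x) → M x = M₀ x

theorem MergeInv.step (hP : P ≤ p) (hW : 1 < 2 ^ W) {R₀ : ℕ → ℕ → ℕ} {M₀ : ℕ → ℕ} {good : ℕ → Prop}
    {A B : ℕ → List ℕ} {w src dst t : ℕ} {lo : ℕ → ℕ} {R : ℕ → ℕ → ℕ}
    (h : MergeInv P R₀ M₀ good A B w dst lo t R M) (ht : t < 2 * w) (hRt : ∀ i < P, R i 29 = t)
    (h16 : ∀ i < P, R₀ i 16 = src) (h17 : ∀ i < P, R₀ i 17 = dst) (h18 : ∀ i < P, R₀ i 18 = w)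
    (h26 : ∀ i < P, R₀ i 26 = lo i)
    (hA : ∀ i < P, good i → (A i).length = w) (hB : ∀ i < P, good i → (B i).length = w)
    (hAW : ∀ i < P, good i → ∀ u, (A i).getD u 0 < 2 ^ W)
    (hBW : ∀ i < P, good i → ∀ u, (B i).getD u 0 < 2 ^ W)
    (hsrcA : ∀ i < P, good i → ∀ u < w, M₀ (src + lo i + u) = (A i).getD u 0)
    (hsrcB : ∀ i < P, good i → ∀ u < w, M₀ (src + lo i + w + u) = (B i).getD u 0)
    (hdisj : ∀ i < P, ∀ u < 2 * w, ∀ j < P, src + lo i + u < dst + lo j ∨ dst + lo j + 2 * w ≤ src + lo i + u)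
    (hlo : ∀ i < P, ∀ j < P, i ≠ j → lo i + 2 * w ≤ lo j ∨ lo j + 2 * w ≤ lo i)
    (hsrcW : ∀ i < P, src + lo i + 2 * w < 2 ^ W) (hdstW : ∀ i < P, dst + lo i + 2 * w < 2 ^ W) :
    WP p W I P mergeStepCode R M (40 + 0) fun R' M' =>
      MergeInv P R₀ M₀ good A B w dst lo (t + 1) R' M' ∧ ∀ i < P, R' i 29 = t := by
  have r16 : ∀ i < P, R i 16 = src := fun i hi => (h.same i hi 16 (by decide)).trans (h16 i hi)
  have r17 : ∀ i < P, R i 17 = dst := fun i hi => (h.same i hi 17 (by decide)).trans (h17 i hi)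
  have r18 : ∀ i < P, R i 18 = w := fun i hi => (h.same i hi 18 (by decide)).trans (h18 i hi)
  have r26 : ∀ i < P, R i 26 = lo i := fun i hi => (h.same i hi 26 (by decide)).trans (h26 i hi)
  have hM : ∀ i < P, ∀ u < 2 * w, M (src + lo i + u) = M₀ (src + lo i + u) :=
    fun i hi u hu => h.frame _ fun j hj => hdisj i hi u hu j hj
  -- both next elements are read, even if one of the blocks is used up, where the value is not used
  refine WP.assign (fun i => M ((src + lo i + R i 27) % 2 ^ W)) (fun i hi => ?_) ?_
  · simp only [Ex.eval_load, Ex.eval_add, Ex.eval_reg, r16 i hi, r26 i hi, Nat.mod_add_mod]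
  refine WP.assign (fun i => M ((src + lo i + w + R i 28) % 2 ^ W)) (fun i hi => ?_) ?_
  · simp only [Ex.eval_load, Ex.eval_add, Ex.eval_reg, Function.update_apply, Nat.reduceEqDiff,
      reduceIte, r16 i hi, r26 i hi, r18 i hi, Nat.mod_add_mod]
  classical
  -- whether the next element comes from the left block
  let tk : ℕ → ℕ := fun i => if R i 27 < w ∧ ¬ (R i 28 < w ∧
      M ((src + lo i + w + R i 28) % 2 ^ W) < M ((src + lo i + R i 27) % 2 ^ W)) then 1 else 0
  have m1 : 1 % 2 ^ W = 1 := Nat.mod_eq_of_lt hW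
  refine WP.assign tk (fun i hi => ?_) ?_
  · simp only [Ex.eval_mul, Ex.eval_sub, Ex.eval_lt, Ex.eval_one, Ex.eval_reg, Function.update_apply,
      Nat.reduceEqDiff, reduceIte, r18 i hi, tk]
    by_cases c1 : R i 27 < w <;> by_cases c2 : R i 28 < w <;>
      by_cases c3 : M ((src + lo i + w + R i 28) % 2 ^ W) < M ((src + lo i + R i 27) % 2 ^ W) <;>
      simp [c1, c2, c3, m1]
  refine WP.put hP (fun i => dst + lo i + t) (fun i => if tk i = 1 then
    M ((src + lo i + R i 27) % 2 ^ W) % 2 ^ W else M ((src + lo i + w + R i 28) % 2 ^ W) % 2 ^ W)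
    (fun i hi => ?_) (fun i hi => ?_) (fun i hi j hj hij => ?_) ?_
  · simp only [Ex.eval_add, Ex.eval_reg, Function.update_apply, Nat.reduceEqDiff, reduceIte,
      r17 i hi, r26 i hi, hRt i hi, Nat.mod_add_mod]
    have := hdstW i hi
    exact Nat.mod_eq_of_lt (by omega)
  · simp only [Ex.eval_add, Ex.eval_mul, Ex.eval_sub, Ex.eval_one, Ex.eval_reg,
      Function.update_apply, Nat.reduceEqDiff, reduceIte, m1]
    have : tk i = 0 ∨ tk i = 1 := by simp only [tk]; split_ifs <;> simp
    rcases this with h | h <;> simp [h, m1]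
  · by_contra hne
    have := hlo i hi j hj hne
    omega
  intro M' hM1 hM2
  refine WP.assign (fun i => (R i 27 + tk i) % 2 ^ W) (fun i hi => ?_) ?_
  · simp only [Ex.eval_add, Ex.eval_reg, Function.update_apply, Nat.reduceEqDiff, reduceIte]
  refine WP.assign (fun i => (R i 28 + (1 - tk i)) % 2 ^ W) (fun i hi => ?_) ?_
  · simp only [Ex.eval_add, Ex.eval_sub, Ex.eval_one, Ex.eval_reg, Function.update_apply,
      Nat.reduceEqDiff, reduceIte, m1, Nat.add_mod_mod]
  have key : ∀ i < P, good i →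
      ((R i 27 + tk i) % 2 ^ W = R i 27 + tk i ∧
        (R i 28 + (1 - tk i)) % 2 ^ W = R i 28 + (1 - tk i)) ∧
      R i 27 + tk i ≤ w ∧ R i 28 + (1 - tk i) ≤ w ∧ tk i ≤ 1 ∧
      ((A i).merge (B i) (· ≤ ·)).drop (t + 1) =
        ((A i).drop (R i 27 + tk i)).merge ((B i).drop (R i 28 + (1 - tk i))) (· ≤ ·) ∧
      M' (dst + lo i + t) = ((A i).merge (B i) (· ≤ ·)).getD t 0 := by
    intro i hi hg
    have e1 := h.sum i hi hg
    have e2 := h.left i hi hg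
    have e3 := h.right i hi hg
    have e4 := hsrcW i hi
    have f1 : (src + lo i + R i 27) % 2 ^ W = src + lo i + R i 27 := Nat.mod_eq_of_lt (by omega)
    have f2 : (src + lo i + w + R i 28) % 2 ^ W = src + lo i + w + R i 28 :=
      Nat.mod_eq_of_lt (by omega)
    have g1 : R i 27 < w → M (src + lo i + R i 27) = (A i).getD (R i 27) 0 := fun hl => by
      rw [hM i hi _ (by omega), hsrcA i hi hg _ hl]
    have g2 : R i 28 < w → M (src + lo i + w + R i 28) = (B i).getD (R i 28) 0 := fun hl => by
      have := hM i hi (w + R i 28) (by omega)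
      rw [← Nat.add_assoc] at this
      rw [this, hsrcB i hi hg _ hl]
    have hv := hM1 i hi
    simp only [f1, f2] at hv
    by_cases hc : R i 27 < w ∧ ¬ (R i 28 < w ∧
      M (src + lo i + w + R i 28) < M (src + lo i + R i 27))
    · have htk : tk i = 1 := by simp only [tk, f1, f2]; rw [if_pos hc]
      rw [htk] at hv ⊢
      obtain ⟨a1, a2⟩ := merge_step_left (A := A i) (B := B i) (i := R i 27) (j := R i 28) (t := t)
        (by rw [hA i hi hg]; exact hc.1) (by
          rw [hB i hi hg]
          intro hl
          rw [← g1 hc.1, ← g2 hl]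
          have := hc.2
          push Not at this
          exact this hl) (h.rest i hi hg)
      refine ⟨⟨Nat.mod_eq_of_lt (by omega), Nat.mod_eq_of_lt (by omega)⟩, by omega, by omega, le_rfl, a1, ?_⟩
      rw [hv, if_pos rfl, g1 hc.1, a2]
      exact Nat.mod_eq_of_lt (hAW i hi hg _)
    · have htk : tk i = 0 := by simp only [tk, f1, f2]; rw [if_neg hc]
      have hj : R i 28 < w := by
        by_contra hj
        exact hc ⟨by omega, fun hh => hj hh.1⟩
      rw [htk] at hv ⊢
      obtain ⟨a1, a2⟩ := merge_step_right (A := A i) (B := B i) (i := R i 27) (j := R i 28) (t := t)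
        (by rw [hB i hi hg]; exact hj) (by
          rw [hA i hi hg]
          intro hl
          rw [← g1 hl, ← g2 hj]
          by_contra hh
          exact hc ⟨hl, fun hh' => hh hh'.2⟩) (h.rest i hi hg)
      refine ⟨⟨Nat.mod_eq_of_lt (by omega), Nat.mod_eq_of_lt (by omega)⟩, by omega, by omega, by omega, a1, ?_⟩
      rw [hv, if_neg (by decide), g2 hj, a2]
      exact Nat.mod_eq_of_lt (hBW i hi hg _)
  refine WP.nil ⟨⟨?_, ?_, ?_, ?_, ?_, ?_, ?_⟩, fun i hi => ?_⟩
  · repeat refine Same.update (by decide) ?_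
    exact h.same
  · intro i hi hg
    have := key i hi hg
    have := h.sum i hi hg
    simp only [Function.update_apply, Nat.reduceEqDiff, reduceIte]
    omega
  · intro i hi hg
    have := key i hi hg
    simp only [Function.update_apply, Nat.reduceEqDiff, reduceIte]
    omega
  · intro i hi hg
    have := key i hi hg
    simp only [Function.update_apply, Nat.reduceEqDiff, reduceIte]
    omega
  · intro i hi hg
    obtain ⟨⟨k1, k2⟩, -, -, -, k3, -⟩ := key i hi hg
    simp only [Function.update_apply, Nat.reduceEqDiff, reduceIte, k1, k2]
    exact k3
  · intro i hi hg u hu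
    by_cases hut : u = t
    · subst hut
      exact (key i hi hg).2.2.2.2.2
    · rw [hM2 _ fun j hj => ?_]
      · exact h.out i hi hg u (by omega)
      · by_cases hij : i = j
        · subst hij
          omega
        · have := hlo i hi j hj hij
          omega
  · intro x hx
    rw [hM2 x fun j hj => ?_]
    · exact h.frame x hx
    · have := hx j hj
      omega
  · simp only [Function.update_apply, Nat.reduceEqDiff, reduceIte, hRt i hi]

end

section

variable {p W P : ℕ} {I : Instance} {M : ℕ → ℕ}

theorem getD_sortedBlock_lt {x : ℕ → ℕ} (hx : ∀ u, x u < 2 ^ W) (k s u : ℕ) :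
    (sortedBlock x k s).getD u 0 < 2 ^ W := by
  by_cases hu : u < (sortedBlock x k s).length
  · rw [List.getD_eq_getElem _ _ hu]
    have := (sortedBlock_perm x k s).subset (List.getElem_mem hu)
    obtain ⟨y, -, hy⟩ := List.mem_map.1 this
    rw [← hy]
    exact hx y
  · rw [List.getD_eq_default _ _ (not_lt.1 hu)]
    positivity

theorem WP.mergePairCode (hP1 : 1 ≤ P) (hP : P ≤ p) (hW : 1 < 2 ^ W) {R₁ R : ℕ → ℕ → ℕ}
    {M₁ : ℕ → ℕ} {x : ℕ → ℕ} (hx : ∀ u, x u < 2 ^ W) {k r N src dst D : ℕ}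
    (hR : Same P 23 R₁ R) (hr : ∀ i < P, R i 23 = r)
    (h0 : ∀ i < P, R₁ i 0 = i) (h7 : ∀ i < P, R₁ i 7 = P)
    (h16 : ∀ i < P, R₁ i 16 = src) (h17 : ∀ i < P, R₁ i 17 = dst) (h18 : ∀ i < P, R₁ i 18 = 2 ^ k)
    (hsrc : ∀ s, (s + 1) * 2 ^ k ≤ N → ∀ u < 2 ^ k, M₁ (src + s * 2 ^ k + u) =
      (sortedBlock x k s).getD u 0)
    (hrD : (r * P + P) * (2 * 2 ^ k) ≤ D)
    (hdisj : src + D ≤ dst ∨ dst + D ≤ src) (hsD : src + D < 2 ^ W) (hdD : dst + D < 2 ^ W)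
    (hfr : ∀ a, a < dst ∨ dst + D ≤ a → M a = M₁ a)
    (hdone : ∀ s < r * P, (s + 1) * 2 ^ (k + 1) ≤ N → ∀ u < 2 ^ (k + 1),
      M (dst + s * 2 ^ (k + 1) + u) = (sortedBlock x (k + 1) s).getD u 0) :
    WP p W I P mergePairCode R M (10 + ((5 + 2 * 2 ^ k * 46) + 0)) fun R' M' =>
      (Same P 23 R₁ R' ∧ (∀ a, a < dst ∨ dst + D ≤ a → M' a = M₁ a) ∧
        ∀ s < (r + 1) * P, (s + 1) * 2 ^ (k + 1) ≤ N → ∀ u < 2 ^ (k + 1),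
          M' (dst + s * 2 ^ (k + 1) + u) = (sortedBlock x (k + 1) s).getD u 0) ∧
      ∀ i < P, R' i 23 = r := by
  have r0 : ∀ i < P, R i 0 = i := fun i hi => (hR i hi 0 (by decide)).trans (h0 i hi)
  have r7 : ∀ i < P, R i 7 = P := fun i hi => (hR i hi 7 (by decide)).trans (h7 i hi)
  have r16 : ∀ i < P, R i 16 = src := fun i hi => (hR i hi 16 (by decide)).trans (h16 i hi)
  have r17 : ∀ i < P, R i 17 = dst := fun i hi => (hR i hi 17 (by decide)).trans (h17 i hi)
  have r18 : ∀ i < P, R i 18 = 2 ^ k := fun i hi => (hR i hi 18 (by decide)).trans (h18 i hi)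
  have hk1 : 2 ^ (k + 1) = 2 * 2 ^ k := by rw [pow_succ, mul_comm]
  rw [hk1] at hdone ⊢
  have hkpos : 1 ≤ 2 ^ k := Nat.one_le_two_pow
  have hlo : ∀ i < P, (r * P + i) * (2 * 2 ^ k) + 2 * 2 ^ k ≤ (r * P + P) * (2 * 2 ^ k) := by
    intro i hi
    have := Nat.mul_le_mul_right (2 * 2 ^ k) (show r * P + i + 1 ≤ r * P + P by omega)
    rw [Nat.add_mul (r * P + i), Nat.one_mul] at this
    exact this
  have hsep : ∀ s s' : ℕ, s < s' → s * (2 * 2 ^ k) + 2 * 2 ^ k ≤ s' * (2 * 2 ^ k) := by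
    intro s s' h
    have := Nat.mul_le_mul_right (2 * 2 ^ k) (Nat.succ_le_of_lt h)
    rwa [Nat.succ_eq_add_one, Nat.add_mul, Nat.one_mul] at this
  refine WP.assign (fun i => (r * P + i) * (2 * 2 ^ k)) (fun i hi => ?_) ?_
  · have := hlo i hi
    simp only [Ex.eval_add, Ex.eval_mul, Ex.eval_two, Ex.eval_reg, hr i hi, r7 i hi, r0 i hi,
      r18 i hi, Nat.mod_add_mod, Nat.mod_mul_mod, Nat.mul_mod_mod]
    exact Nat.mod_eq_of_lt (by omega)
  refine WP.assign (fun i => 0) (fun i hi => Nat.zero_mod _) ?_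
  refine WP.assign (fun i => 0) (fun i hi => Nat.zero_mod _) ?_
  set R₂ : ℕ → ℕ → ℕ := fun i => Function.update (Function.update (Function.update (R i) 26
    ((r * P + i) * (2 * 2 ^ k))) 27 0) 28 0 with hR₂
  have s23 : Same P 23 R₁ R₂ := by
    simp only [hR₂]
    repeat refine Same.update (by decide) ?_
    exact hR
  have hlim : ∀ R', Same P 27 R₂ R' → ∀ M', ∀ i < P,
      (2 * Ex.reg 18).eval W I M' (R' i) = 2 * 2 ^ k := by
    intro R' h' M' i hi
    have h18' : R' i 18 = 2 ^ k := by
      rw [h' i hi 18 (by decide)]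
      simp only [hR₂, Function.update_apply, Nat.reduceEqDiff, reduceIte, r18 i hi]
    have := hlo i hi
    simp only [Ex.eval_mul, Ex.eval_two, Ex.eval_reg, h18', Nat.mod_mul_mod]
    exact Nat.mod_eq_of_lt (by omega)
  have e2 : ∀ i r', (r' = 16 ∨ r' = 17 ∨ r' = 18 ∨ r' = 23) → R₂ i r' = R i r' := by
    intro i r' h
    rcases h with rfl | rfl | rfl | rfl <;>
      simp only [hR₂, Function.update_apply, Nat.reduceEqDiff, reduceIte]
  have hsub : ∀ s, (s + 1) * (2 * 2 ^ k) ≤ N → (2 * s + 1) * 2 ^ k ≤ N ∧ (2 * s + 1 + 1) * 2 ^ k ≤ N := by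
    intro s hs
    constructor <;> nlinarith
  refine WP.mono (T := 10 - Ex.cost ((.reg 23 * .reg 7 + .reg 0) * (2 * .reg 18)) - Ex.cost 0 -
    Ex.cost 0 + (((2 * Ex.reg 18).cost + 3 + 2 * 2 ^ k * (40 + 0 + (2 * Ex.reg 18).cost + 4)) + 0))
    (WP.append (T₁ := 10 - Ex.cost ((.reg 23 * .reg 7 + .reg 0) * (2 * .reg 18)) - Ex.cost 0 -
    Ex.cost 0) (S₁ := []) (WP.nil ?_)) ?_ (fun _ _ h => h)
  swap
  · change 10 - 5 - 1 - 1 + ((2 + 3 + 2 * 2 ^ k * (40 + 0 + 2 + 4)) + 0) ≤ 10 - 5 - 1 - 1 + _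
    omega
  refine WP.forLoop (fun t R' M' => MergeInv P R₂ M (fun i => (r * P + i + 1) * (2 * 2 ^ k) ≤ N)
    (fun i => sortedBlock x k (2 * (r * P + i))) (fun i => sortedBlock x k (2 * (r * P + i) + 1))
    (2 ^ k) dst (fun i => (r * P + i) * (2 * 2 ^ k)) t R' M' ∧ ∀ i < P, R' i 23 = r) (2 * 2 ^ k) (40 + 0) (by
      have := hlo 0 hP1
      omega) (by decide) (by decide) (by decide) rfl
    (fun j R' M' h => hlim R' h.1.same M') ?_ ?_ ?_ ?_
  · rintro t R' M' c hc y ⟨h, hr'⟩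
    have hc27 : c = 29 ∨ c = 30 := by simpa using hc
    have hne : ∀ i, Function.update (R' i) c (y i) 27 = R' i 27 ∧
        Function.update (R' i) c (y i) 28 = R' i 28 ∧ Function.update (R' i) c (y i) 23 = R' i 23 := by
      intro i
      rcases hc27 with rfl | rfl <;>
        simp only [Function.update_apply, Nat.reduceEqDiff, reduceIte, and_self]
    refine ⟨⟨h.same.update (by omega), fun i hi hg => ?_, fun i hi hg => ?_, fun i hi hg => ?_,
      fun i hi hg => ?_, h.out, h.frame⟩, fun i hi => ?_⟩
    · simp only [hne]; exact h.sum i hi hg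
    · simp only [hne]; exact h.left i hi hg
    · simp only [hne]; exact h.right i hi hg
    · simp only [hne]; exact h.rest i hi hg
    · simp only [hne]; exact hr' i hi
  · refine ⟨⟨Same.refl _ _ _, fun i hi hg => rfl, fun i hi hg => Nat.zero_le _,
      fun i hi hg => Nat.zero_le _, fun i hi hg => rfl, fun i hi hg u hu => by omega,
      fun _ _ => rfl⟩, fun i hi => by rw [e2 i _ (by simp), hr i hi]⟩
  · rintro t ht R' M' ⟨h, hr'⟩ hRt
    refine (h.step (src := src) hP hW ht hRt (fun i hi => by rw [e2 i _ (by simp), r16 i hi])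
      (fun i hi => by rw [e2 i _ (by simp), r17 i hi]) (fun i hi => by rw [e2 i _ (by simp), r18 i hi])
      (fun i hi => ?_) (fun i hi _ => length_sortedBlock _ _ _) (fun i hi _ => length_sortedBlock _ _ _)
      (fun i hi _ u => getD_sortedBlock_lt hx _ _ _) (fun i hi _ u => getD_sortedBlock_lt hx _ _ _)
      (fun i hi hg u hu => ?_) (fun i hi hg u hu => ?_) (fun i hi u hu j hj => ?_)
      (fun i hi j hj hij => ?_) (fun i hi => ?_) (fun i hi => ?_)).mono le_rfl
      (fun R'' M'' h => ⟨⟨h.1, fun i hi => ?_⟩, h.2⟩)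
    · simp only [hR₂, Function.update_apply, Nat.reduceEqDiff, reduceIte]
    · have := hsub _ hg
      have h1 := hlo i hi
      rw [hfr _ (by omega), ← hsrc _ this.1 u hu]
      congr 2
      ring
    · have := hsub _ hg
      have h1 := hlo i hi
      rw [hfr _ (by omega), ← hsrc _ this.2 u hu]
      congr 1
      ring
    · have := hlo i hi
      have := hlo j hj
      omega
    · rcases Nat.lt_or_gt_of_ne hij with hij | hij
      · exact Or.inl (hsep _ _ (by omega))
      · exact Or.inr (hsep _ _ (by omega))
    · have := hlo i hi
      omega
    · have := hlo i hi
      omega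
    · rw [h.1.same i hi 23 (by decide), e2 i _ (by simp), hr i hi]
  · rintro R' M' ⟨h, hr'⟩
    refine WP.nil ⟨⟨s23.trans (h.same.mono (by decide)), fun a ha => ?_, fun s hs hg u hu => ?_⟩, hr'⟩
    · rw [h.frame a fun i hi => ?_]
      · exact hfr a ha
      · have := hlo i hi
        omega
    · by_cases hsr : s < r * P
      · rw [h.frame _ fun i hi => ?_]
        · exact hdone s hsr hg u hu
        · have := hsep s (r * P + i) (by omega)
          omega
      · obtain ⟨i, rfl⟩ := Nat.exists_eq_add_of_le (not_lt.1 hsr)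
        rw [Nat.add_mul, Nat.one_mul] at hs
        exact h.out i (by omega) hg u hu

end

section

variable {p W P : ℕ} {I : Instance} {M : ℕ → ℕ}

/-- The state of the merge sort after `k` levels: the sorted blocks of length `2 ^ k` are in one of the two
working areas, at `src`, and the other one is free. -/
structure SortInv (I : Instance) (P : ℕ) (E : ℕ → ℕ → ℕ) (M₀ : ℕ → ℕ) (k : ℕ)
    (R : ℕ → ℕ → ℕ) (M : ℕ → ℕ) : Prop where
  same : Same P 16 E R
  bases : ∃ src dst, src + dst = 3 * I.stride P ∧ (src = I.stride P ∨ src = 2 * I.stride P) ∧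
    (∀ i < P, R i 16 = src) ∧ (∀ i < P, R i 17 = dst) ∧
    ∀ s, (s + 1) * 2 ^ k ≤ I.sortSize → ∀ u < 2 ^ k,
      M (src + s * 2 ^ k + u) = (sortedBlock I.sampleKey k s).getD u 0
  width : ∀ i < P, R i 18 = 2 ^ k
  test : ∀ i < P, R i 19 = if 2 ^ k < I.sortSize then 1 else 0
  frame : ∀ x < I.stride P, M x = M₀ x

/-- A bound for the number of steps of one level of the merge sort, for blocks of length `2 ^ k`. -/
def levelTime (N P k : ℕ) : ℕ := 100 * ((N / (2 * 2 ^ k) / P + 1) * (2 * 2 ^ k))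

/-- The area that is covered by all rounds of a level, including the blocks behind the end. -/
theorem rounds_le (N P w : ℕ) (hwN : w ≤ N) :
    (N / w / P + 1) * P * w ≤ N * P + N := by
  calc (N / w / P + 1) * P * w ≤ (N / w + P) * w :=
        Nat.mul_le_mul_right _ (div_add_one_mul_le _ _)
    _ = N / w * w + P * w := by ring
    _ ≤ N + P * N := Nat.add_le_add (Nat.div_mul_le_self _ _) (Nat.mul_le_mul_left _ hwN)
    _ = N * P + N := by ring

theorem sampleKey_lt {W : ℕ} (h : I.Admissible W) (u : ℕ) : I.sampleKey u < 2 ^ W := by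
  unfold Instance.sampleKey
  split_ifs
  · exact h.key_lt (h.draws_lt _)
  · positivity

theorem SortInv.level (hS : Setup p W P I) {E : ℕ → ℕ → ℕ} {M₀ : ℕ → ℕ} {k : ℕ}
    {R : ℕ → ℕ → ℕ} (hE : Env I P E) (h : SortInv I P E M₀ k R M) (hk : k < Nat.log 2 I.sampleSize + 1) :
    WP p W I P mergeLevelCode R M (levelTime I.sortSize P k - 1) (SortInv I P E M₀ (k + 1)) := by
  obtain ⟨src, dst, hsum, hor, r16, r17, hsrc⟩ := h.bases
  have hE' := hE.same h.same
  have hP1 := hS.one_le_P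
  have b1 := hS.bound
  have b2 := hS.le_stride
  have b3 := hS.sort_le
  have b4 := hS.P_le_mul
  have hkN : 2 * 2 ^ k ≤ I.sortSize := by
    rw [← pow_succ']
    exact Nat.pow_le_pow_right (by decide) hk
  have hkpos : 1 ≤ 2 ^ k := Nat.one_le_two_pow
  have hround := rounds_le I.sortSize P (2 * 2 ^ k) hkN
  have hdiv : I.sortSize / (2 * 2 ^ k) ≤ I.sortSize := Nat.div_le_self _ _
  have hdiv2 : I.sortSize / (2 * 2 ^ k) / P ≤ I.sortSize / (2 * 2 ^ k) := Nat.div_le_self _ _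
  obtain ⟨cnt, hcnt⟩ : ∃ cnt, cnt = I.sortSize / (2 * 2 ^ k) / P + 1 := ⟨_, rfl⟩
  have hcntW : cnt < 2 ^ W := by
    generalize I.sortSize / (2 * 2 ^ k) / P = a at *
    generalize I.sortSize / (2 * 2 ^ k) = b at *
    omega
  rw [← hcnt] at hround
  have htime : levelTime I.sortSize P k - 1 = 100 * (cnt * (2 * 2 ^ k)) - 1 := by
    rw [levelTime, hcnt]
  rw [htime]
  have hcpos : 1 * (2 * 2 ^ k) ≤ cnt * (2 * 2 ^ k) :=
    Nat.mul_le_mul_right _ (by rw [hcnt]; exact Nat.le_add_left _ _)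
  unfold mergeLevelCode
  refine WP.mono (T := 10 + ((0 + 3 + cnt * ((10 + ((5 + 2 * 2 ^ k * 46) + 0)) + 0 + 4)) + (10 + 0))) ?_ ?_
    (fun _ _ h => h)
  swap
  · have : cnt * ((10 + ((5 + 2 * 2 ^ k * 46) + 0)) + 0 + 4) = 19 * cnt + 46 * (cnt * (2 * 2 ^ k)) := by ring
    have : cnt ≤ cnt * (2 * 2 ^ k) := Nat.le_mul_of_pos_right _ (by positivity)
    rw [hcnt] at *
    generalize I.sortSize / (2 * 2 ^ k) / P + 1 = c at *
    have : 2 * c ≤ c * (2 * 2 ^ k) := by nlinarith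
    have h2 : 1 ≤ c * 2 ^ k := by nlinarith
    have h3 : c * (2 * 2 ^ k) = 2 * (c * 2 ^ k) := by ring
    omega
  refine WP.assign (fun _ => cnt) (fun i hi => ?_) ?_
  · simp only [Ex.eval_add, Ex.eval_div, Ex.eval_mul, Ex.eval_one, Ex.eval_two, Ex.eval_reg, h.width i hi,
      hE'.N i hi, hE'.procs i hi, Nat.mod_mul_mod, Nat.mod_add_mod, Nat.add_mod_mod]
    rw [Nat.mod_eq_of_lt (a := 2 * 2 ^ k) (b := 2 ^ W) (by omega), Nat.mod_eq_of_lt (a := _ / _), ← hcnt]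
    · exact Nat.mod_eq_of_lt hcntW
    · exact lt_of_le_of_lt hdiv (by omega)
  set R₁ : ℕ → ℕ → ℕ := fun i => Function.update (R i) 22 cnt with hR₁
  have hs1 : Same P 16 E R₁ := h.same.update (by decide)
  have hE1 := hE.same hs1
  have f16 : ∀ i < P, R₁ i 16 = src := fun i hi => by
    simp only [hR₁, Function.update_apply, Nat.reduceEqDiff, reduceIte, r16 i hi]
  have f17 : ∀ i < P, R₁ i 17 = dst := fun i hi => by
    simp only [hR₁, Function.update_apply, Nat.reduceEqDiff, reduceIte, r17 i hi]
  have f18 : ∀ i < P, R₁ i 18 = 2 ^ k := fun i hi => by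
    simp only [hR₁, Function.update_apply, Nat.reduceEqDiff, reduceIte, h.width i hi]
  have f22 : ∀ i < P, R₁ i 22 = cnt := fun _ _ => Function.update_self ..
  -- with an empty first part, `WP.append` drops the steps that the assignments left over
  refine WP.append (T₁ := 10 - Ex.cost (.reg 11 / (2 * .reg 18) / .reg 7 + 1)) (S₁ := []) (WP.nil ?_)
  refine WP.forLoop (fun r R' M' => Same P 23 R₁ R' ∧
    (∀ a, a < dst ∨ dst + I.stride P ≤ a → M' a = M a) ∧
    ∀ s < r * P, (s + 1) * 2 ^ (k + 1) ≤ I.sortSize → ∀ u < 2 ^ (k + 1),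
      M' (dst + s * 2 ^ (k + 1) + u) = (sortedBlock I.sampleKey (k + 1) s).getD u 0)
    cnt _ hcntW (by decide) (by decide) (by decide) rfl ?_ ?_ ?_ ?_ ?_
  · intro j R' M' h' i hi
    exact (h'.1 i hi 22 (by decide)).trans (f22 i hi)
  · rintro j R' M' c hc x ⟨h1, h2⟩
    refine ⟨h1.update ?_, h2⟩
    simp at hc
    omega
  · exact ⟨Same.refl _ _ _, fun _ _ => rfl, fun s hs => by omega⟩
  · rintro r hr R' M' ⟨h1, h2, h3⟩ hRr
    have hrP : (r * P + P) * (2 * 2 ^ k) ≤ cnt * P * (2 * 2 ^ k) := by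
      refine Nat.mul_le_mul_right _ ?_
      have := Nat.mul_le_mul_right P (Nat.succ_le_of_lt hr)
      rwa [Nat.succ_eq_add_one, Nat.add_mul, Nat.one_mul] at this
    refine (WP.mergePairCode hP1 hS.P_le (by omega) (sampleKey_lt hS.adm) h1 hRr hE1.id hE1.procs f16 f17
      f18 hsrc (D := I.stride P) (by omega) (by omega) (by omega) (by omega) h2 h3)
  rintro R' M' ⟨h1, h2, h3⟩
  have g9 : ∀ i < P, R' i 9 = I.stride P := fun i hi => (h1 i hi 9 (by decide)).trans (hE1.D i hi)
  have g11 : ∀ i < P, R' i 11 = I.sortSize := fun i hi => (h1 i hi 11 (by decide)).trans (hE1.N i hi)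
  have g16 : ∀ i < P, R' i 16 = src := fun i hi => (h1 i hi 16 (by decide)).trans (f16 i hi)
  have g17 : ∀ i < P, R' i 17 = dst := fun i hi => (h1 i hi 17 (by decide)).trans (f17 i hi)
  have g18 : ∀ i < P, R' i 18 = 2 ^ k := fun i hi => (h1 i hi 18 (by decide)).trans (f18 i hi)
  have hm1 : (3 * I.stride P) % 2 ^ W = 3 * I.stride P := Nat.mod_eq_of_lt (by omega)
  refine WP.assign (fun _ => dst) (fun i hi => ?_) ?_
  · simp only [Ex.eval_sub, Ex.eval_mul, Ex.eval_three, Ex.eval_reg, g9 i hi, g16 i hi,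
      Nat.mod_mul_mod, hm1]
    rw [show 3 * I.stride P - src = dst by omega]
    exact Nat.mod_eq_of_lt (by omega)
  refine WP.assign (fun _ => src) (fun i hi => ?_) ?_
  · simp only [Ex.eval_sub, Ex.eval_mul, Ex.eval_three, Ex.eval_reg, Function.update_apply,
      Nat.reduceEqDiff, reduceIte, g9 i hi, g17 i hi, Nat.mod_mul_mod, hm1]
    rw [show 3 * I.stride P - dst = src by omega]
    exact Nat.mod_eq_of_lt (by omega)
  refine WP.assign (fun _ => 2 ^ (k + 1)) (fun i hi => ?_) ?_
  · simp only [Ex.eval_mul, Ex.eval_two, Ex.eval_reg, Function.update_apply,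
      Nat.reduceEqDiff, reduceIte, g18 i hi, Nat.mod_mul_mod, pow_succ']
    exact Nat.mod_eq_of_lt (by omega)
  refine WP.assign (fun _ => if 2 ^ (k + 1) < I.sortSize then 1 else 0) (fun i hi => ?_) ?_
  · simp only [Ex.eval_lt, Ex.eval_reg, Function.update_apply,
      Nat.reduceEqDiff, reduceIte, g11 i hi]
    split_ifs
    · exact Nat.mod_eq_of_lt (by omega)
    · exact Nat.zero_mod _
  refine WP.nil ⟨?_, ⟨dst, src, by omega, by omega, ?_, ?_, ?_⟩, ?_, ?_, ?_⟩
  · repeat refine Same.update (by decide) ?_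
    exact hs1.trans (h1.mono (by decide))
  · intro i hi
    simp only [Function.update_apply, Nat.reduceEqDiff, reduceIte]
  · intro i hi
    simp only [Function.update_apply, Nat.reduceEqDiff, reduceIte]
  · intro s hs u hu
    refine h3 s ?_ hs u hu
    -- the rounds cover all pairs of blocks
    have hlt := lt_div_add_one_mul (I.sortSize / (2 * 2 ^ k)) hP1
    rw [← hcnt] at hlt
    refine lt_of_lt_of_le ?_ hlt.le
    rw [pow_succ'] at hs
    exact (Nat.le_div_iff_mul_le (by omega)).2 hs
  · intro i hi
    simp only [Function.update_apply, Nat.reduceEqDiff, reduceIte]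
  · intro i hi
    simp only [Function.update_apply, Nat.reduceEqDiff, reduceIte]
  · intro x hx
    rw [h2 x (Or.inl (by omega))]
    exact h.frame x hx

/-- A bound for the number of steps of the merge sort. -/
def sortTime (N P e : ℕ) : ℕ := ∑ k ∈ Finset.range e, levelTime N P k + 40

theorem WP.sortCode (hS : Setup p W P I) {E R : ℕ → ℕ → ℕ}
    {S : List Stmt} {T : ℕ} {Q : (ℕ → ℕ → ℕ) → (ℕ → ℕ) → Prop}
    (hE : Env I P E) (hR : Same P 16 E R)
    (hM : ∀ k < I.sortSize, M (I.stride P + k) = I.sampleKey k)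
    (hQ : ∀ R' M' X, Same P 13 E R' → (∀ i < P, R' i 13 = X) → 2 * X < 2 ^ W →
      (∀ u, 1 ≤ u → u ≤ I.sampleSize → I.stride P ≤ X + u ∧ X + u < 3 * I.stride P ∧
        M' (X + u) = I.sortedSample.getD (u - 1) 0) →
      (∀ x < I.stride P, M' x = M x) → WP p W I P S R' M' T Q) :
    WP p W I P (sortCode ++ S) R M
      (sortTime I.sortSize P (Nat.log 2 I.sampleSize + 1) + T) Q := by
  have hE' := hE.same hR
  have b1 := hS.bound
  have b2 := hS.le_stride
  have b3 := hS.sort_le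
  have b4 := hS.P_le_mul
  have b5 := hS.one_le_P
  have b6 := I.sampleSize_lt_sortSize
  refine WP.append (WP.mono (T := 20 + ((∑ k ∈ Finset.range (Nat.log 2 I.sampleSize + 1),
    (levelTime I.sortSize P k - 1 + 1) + 1) + (10 + 0)))
    (Q := fun R' M' => WP p W I P S R' M' T Q) ?_ ?_ (fun _ _ h => h))
  swap
  · have : ∑ k ∈ Finset.range (Nat.log 2 I.sampleSize + 1), (levelTime I.sortSize P k - 1 + 1) =
        ∑ k ∈ Finset.range (Nat.log 2 I.sampleSize + 1), levelTime I.sortSize P k := by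
      refine Finset.sum_congr rfl fun k _ => Nat.sub_add_cancel ?_
      have h2 : 0 < (I.sortSize / (2 * 2 ^ k) / P + 1) * (2 * 2 ^ k) := by positivity
      unfold levelTime
      omega
    rw [this, sortTime]
    omega
  unfold S5.sortCode
  refine WP.assign (fun _ => I.stride P) (fun i hi => ?_) ?_
  · simp only [Ex.eval_mul, Ex.eval_one, Ex.eval_reg, hE'.D i hi, Nat.mod_mul_mod, one_mul]
    exact Nat.mod_eq_of_lt (by omega)
  refine WP.assign (fun _ => 2 * I.stride P) (fun i hi => ?_) ?_
  · simp only [Ex.eval_mul, Ex.eval_two, Ex.eval_reg, Function.update_apply, Nat.reduceEqDiff,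
      reduceIte, hE'.D i hi, Nat.mod_mul_mod]
    exact Nat.mod_eq_of_lt (by omega)
  refine WP.assign (fun _ => 1) (fun i hi => ?_) ?_
  · rw [Ex.eval_one]
    exact Nat.mod_eq_of_lt (by omega)
  refine WP.assign (fun _ => if 2 ^ 0 < I.sortSize then 1 else 0) (fun i hi => ?_) ?_
  · simp only [Ex.eval_lt, Ex.eval_reg, Function.update_apply, Nat.reduceEqDiff,
      reduceIte, hE'.N i hi, pow_zero]
    split_ifs
    · exact Nat.mod_eq_of_lt (by omega)
    · exact Nat.zero_mod _
  refine WP.append (S₁ := []) (T₁ := 20 - Ex.cost (1 * .reg 9) - Ex.cost (2 * .reg 9) - Ex.cost 1 -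
    Ex.cost (.lt (.reg 18) (.reg 11))) (WP.nil ?_)
  refine WP.append (S₁ := [.loop 19 mergeLevelCode]) ?_
  refine (WP.loop (SortInv I P E M) _ (fun k => levelTime I.sortSize P k - 1) (by decide) ?_ ?_ ?_).mono
    le_rfl ?_
  · refine ⟨?_, ⟨I.stride P, 2 * I.stride P, by omega, by omega, fun i hi => ?_, fun i hi => ?_, ?_⟩,
      fun i hi => ?_, fun i hi => ?_, fun _ _ => rfl⟩
    · repeat refine Same.update (by decide) ?_
      exact hR
    · simp only [Function.update_apply, Nat.reduceEqDiff, reduceIte]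
    · simp only [Function.update_apply, Nat.reduceEqDiff, reduceIte]
    · intro s hs u hu
      simp only [pow_zero, mul_one] at hs hu ⊢
      obtain rfl : u = 0 := by omega
      exact hM s (by omega)
    · simp only [Function.update_apply, Nat.reduceEqDiff, reduceIte, pow_zero]
    · simp only [Function.update_apply, reduceIte]
  · intro k hk R' M' h
    refine ⟨fun i hi => ?_, h.level hS hE hk⟩
    rw [h.test i hi, if_pos]
    · decide
    · exact Nat.pow_lt_pow_right (by decide) hk
  · intro R' M' h i hi
    rw [h.test i hi, if_neg]
    simp [Instance.sortSize]
  · intro R' M' h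
    obtain ⟨src, dst, hsum, hor, r16, -, hsrc⟩ := h.bases
    have hE'' := hE.same h.same
    refine WP.assign (fun _ => src + I.sortSize - I.sampleSize - 1) (fun i hi => ?_) ?_
    · simp only [Ex.eval_sub, Ex.eval_add, Ex.eval_one, Ex.eval_reg, hE''.N i hi, hE''.a i hi, r16 i hi]
      rw [Nat.mod_eq_of_lt (a := src + I.sortSize) (by omega), Nat.mod_eq_of_lt (a := 1) (by omega),
        Nat.mod_eq_of_lt (a := src + I.sortSize - I.sampleSize) (by omega)]
      exact Nat.mod_eq_of_lt (by omega)
    refine WP.nil (hQ _ _ (src + I.sortSize - I.sampleSize - 1) ?_ ?_ (by omega) ?_ h.frame)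
    · exact Same.update (by decide) (h.same.mono (by decide))
    · intro i hi
      simp only [Function.update_self]
    · intro u hu1 hu2
      refine ⟨by omega, by omega, ?_⟩
      have := hsrc 0 (by rw [zero_add, one_mul]; rfl) (I.sortSize - I.sampleSize + (u - 1)) (by
        change _ < I.sortSize
        omega)
      rw [sortedBlock_sampleKey] at this
      rw [← this]
      congr 1
      omega

end

/-! ### Classification -/

section

variable {p W P : ℕ} {I : Instance}

/-- The node that a key reaches after `l` steps of its descent. -/
def Instance.node (I : Instance) (c l : ℕ) : ℕ :=
  (fun i => 2 * i + if I.treeNode i < c then 1 else 0)^[l] 1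

theorem Instance.node_succ (c l : ℕ) :
    I.node c (l + 1) = 2 * I.node c l + if I.treeNode (I.node c l) < c then 1 else 0 := by
  exact Function.iterate_succ_apply' ..

theorem Instance.node_bounds (c l : ℕ) : 2 ^ l ≤ I.node c l ∧ I.node c l < 2 ^ (l + 1) := by
  induction l with
  | zero => simp [Instance.node]
  | succ l ih =>
    rw [I.node_succ, pow_succ _ (l + 1), pow_succ]
    rw [pow_succ] at ih
    split_ifs <;> omega

/-- The number of splitters to the left of the subtree that a key reaches after `l` steps. -/
def Instance.offset (I : Instance) (c l : ℕ) : ℕ := (I.node c l - 2 ^ l) * 2 ^ (I.d - l)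

theorem Instance.offset_le (c : ℕ) {l : ℕ} (hl : l ≤ I.d) :
    I.offset c l + 2 ^ (I.d - l) ≤ I.v + 1 := by
  have h := I.node_bounds c l
  have h1 : (I.node c l - 2 ^ l + 1) * 2 ^ (I.d - l) ≤ 2 ^ l * 2 ^ (I.d - l) :=
    Nat.mul_le_mul_right _ (by rw [pow_succ] at h; omega)
  rw [← pow_add, Nat.add_sub_cancel' hl, Nat.add_mul, one_mul] at h1
  rw [I.v_add_one]
  exact h1

/-- In terms of the offset, the descent is a binary search, which needs no explicit tree. -/
theorem Instance.offset_succ (c : ℕ) {l : ℕ} (hl : l < I.d) :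
    I.offset c (l + 1) = I.offset c l +
      2 ^ (I.d - 1 - l) * if I.splitter (I.offset c l + 2 ^ (I.d - 1 - l) - 1) < c then 1 else 0 := by
  have h := I.node_bounds c l
  have hlog : Nat.log 2 (I.node c l) = l :=
    Nat.log_eq_of_pow_le_of_lt_pow h.1 h.2
  have e : I.d - l = (I.d - 1 - l) + 1 := by omega
  have htn : I.treeNode (I.node c l) = I.splitter (I.offset c l + 2 ^ (I.d - 1 - l) - 1) := by
    unfold Instance.treeNode Instance.offset
    rw [hlog, e, pow_succ]
    congr 2
    ring
  unfold Instance.offset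
  rw [I.node_succ, htn]
  unfold Instance.offset
  have e' : I.d - (l + 1) = I.d - 1 - l := by omega
  rw [e', e, pow_succ, pow_succ]
  obtain ⟨y, hy⟩ := Nat.exists_eq_add_of_le h.1
  rw [hy]
  split_ifs
  · rw [show 2 * (2 ^ l + y) + 1 - 2 ^ l * 2 = 2 * y + 1 by omega, Nat.add_sub_cancel_left]
    ring
  · rw [show 2 * (2 ^ l + y) + 0 - 2 ^ l * 2 = 2 * y by omega, Nat.add_sub_cancel_left]
    ring

theorem Instance.offset_d (c : ℕ) : I.offset c I.d = I.leaf c := by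
  simp [Instance.offset, Instance.node, Instance.leaf]

theorem Instance.offset_zero (c : ℕ) : I.offset c 0 = 0 := by
  simp [Instance.offset, Instance.node]

theorem Instance.leaf_le (c : ℕ) : I.leaf c ≤ I.v := by
  have := I.offset_le c le_rfl
  rw [I.offset_d, Nat.sub_self] at this
  omega

theorem Instance.bucket_le (s : List ℕ) : I.bucket s ≤ 2 * I.v := by
  have := I.leaf_le (I.key s)
  unfold Instance.bucket
  simp only
  split_ifs <;> omega

/-- The splitters are stored in the memory `M`: splitter `j` in the cell `X + α (j + 1)`. -/
structure Splitters (I : Instance) (P X : ℕ) (M : ℕ → ℕ) : Prop where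
  eq : ∀ j < I.v, M (X + I.α * (j + 1)) = I.splitter j
  range : ∀ j < I.v, I.stride P ≤ X + I.α * (j + 1) ∧ X + I.α * (j + 1) < 3 * I.stride P

theorem Splitters.congr {X : ℕ} {M M' : ℕ → ℕ} (h : Splitters I P X M)
    (hM : ∀ x, I.stride P ≤ x → x < 3 * I.stride P → M' x = M x) : Splitters I P X M' :=
  ⟨fun j hj => (hM _ (h.range j hj).1 (h.range j hj).2).trans (h.eq j hj), h.range⟩

/-- One step of the descent. Register `19` holds the key, `20` the offset of the current subtree, and
`21` the number of splitters up to its root. -/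
def descendCode : List Stmt :=
  assign 20 (.reg 20 + .reg 21 * .lt (.load (.reg 13 + .reg 4 * (.reg 20 + .reg 21))) (.reg 19)) ++
  (assign 21 (.reg 21 / 2) ++ [])

theorem WP.descend (hS : Setup p W P I) {R : ℕ → ℕ → ℕ} {M : ℕ → ℕ} {X : ℕ}
    (hE : Env I P R) (h13 : ∀ i < P, R i 13 = X) (hX : Splitters I P X M)
    {c : ℕ → ℕ} (hc : ∀ i < P, R i 19 = c i) (hq : ∀ i < P, R i 20 = 0)
    (hst : ∀ i < P, R i 21 = (I.v + 1) / 2) :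
    WP p W I P [.loop 21 descendCode] R M (∑ _l ∈ Finset.range I.d, (20 + 0 + 1) + 1) fun R' M' =>
      Same P 20 R R' ∧ (∀ i < P, R' i 20 = I.leaf (c i)) ∧ M' = M := by
  have b1 := hS.bound
  have b2 := hS.le_stride
  have b3 := hS.v_le_mul
  have b5 := hS.adm.one_le_v
  have hpow : ∀ l < I.d, 2 ^ I.d / 2 ^ (l + 1) = 2 ^ (I.d - 1 - l) := by
    intro l hl
    rw [Nat.pow_div (by omega) (by decide)]
    congr 1
    omega
  refine (WP.loop (fun l R' M' => Same P 20 R R' ∧ (∀ i < P, R' i 20 = I.offset (c i) l) ∧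
    (∀ i < P, R' i 21 = 2 ^ I.d / 2 ^ (l + 1)) ∧ M' = M) I.d (fun _ => 20 + 0) (by decide) ?_ ?_ ?_).mono
    le_rfl ?_
  · refine ⟨Same.refl _ _ _, fun i hi => ?_, fun i hi => ?_, rfl⟩
    · rw [hq i hi, I.offset_zero]
    · rw [hst i hi, I.v_add_one, zero_add, pow_one]
  · rintro l hl R' M' ⟨h1, h2, h3, rfl⟩
    rw [hpow l hl] at h3
    refine ⟨fun i hi => by rw [h3 i hi]; positivity, ?_⟩
    have hE' := hE.same h1
    have g13 : ∀ i < P, R' i 13 = X := fun i hi => (h1 i hi 13 (by decide)).trans (h13 i hi)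
    have g19 : ∀ i < P, R' i 19 = c i := fun i hi => (h1 i hi 19 (by decide)).trans (hc i hi)
    have hle : ∀ i, I.offset (c i) l + 2 ^ (I.d - 1 - l) ≤ I.v ∧ 1 ≤ 2 ^ (I.d - 1 - l) := by
      intro i
      have h := I.offset_le (c i) hl.le
      have h' : 1 ≤ 2 ^ (I.d - 1 - l) := Nat.one_le_two_pow
      rw [show I.d - l = (I.d - 1 - l) + 1 by omega, pow_succ] at h
      omega
    refine WP.assign (fun i => I.offset (c i) (l + 1)) (fun i hi => ?_) ?_
    · have hl1 := hle i
      have hX1 := hX.range (I.offset (c i) l + 2 ^ (I.d - 1 - l) - 1) (by omega)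
      have hX2 := hX.eq (I.offset (c i) l + 2 ^ (I.d - 1 - l) - 1) (by omega)
      rw [Nat.sub_add_cancel (by omega)] at hX1 hX2
      simp only [Ex.eval_add, Ex.eval_mul, Ex.eval_lt, Ex.eval_load, Ex.eval_reg, h2 i hi, h3 i hi,
        g13 i hi, hE'.α i hi, g19 i hi, Nat.mul_mod_mod, Nat.add_mod_mod]
      rw [Nat.mod_eq_of_lt (a := X + _) (b := 2 ^ W) (by omega), hX2, I.offset_succ (c i) hl]
      split_ifs
      · exact Nat.mod_eq_of_lt (by omega)
      · exact Nat.mod_eq_of_lt (by omega)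
    refine WP.assign (fun i => 2 ^ I.d / 2 ^ (l + 1 + 1)) (fun i hi => ?_) ?_
    · have hlt : 2 ^ (I.d - 1 - l) < 2 ^ W := by
        have := hle i
        omega
      simp only [Ex.eval_div, Ex.eval_two, Ex.eval_reg, Function.update_apply, Nat.reduceEqDiff,
        reduceIte, h3 i hi]
      rw [Nat.mod_eq_of_lt (a := 2) (b := 2 ^ W) (by omega), pow_succ _ (l + 1), ← Nat.div_div_eq_div_mul,
        hpow l hl]
      exact Nat.mod_eq_of_lt (lt_of_le_of_lt (Nat.div_le_self _ _) hlt)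
    refine WP.nil ⟨?_, fun i hi => ?_, fun i hi => ?_, rfl⟩
    · repeat refine Same.update (by decide) ?_
      exact h1
    · simp only [Function.update_apply, Nat.reduceEqDiff, reduceIte]
    · simp only [Function.update_apply, reduceIte]
  · rintro R' M' ⟨-, -, h3, -⟩ i hi
    rw [h3 i hi]
    exact Nat.div_eq_of_lt (Nat.pow_lt_pow_right (by decide) (by omega))
  · rintro R' M' ⟨h1, h2, -, h4⟩
    exact ⟨h1, fun i hi => by rw [h2 i hi, I.offset_d], h4⟩

/-- The bucket of the `k`-th input string; the numbers from `n` on get an extra bucket at the end. -/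
def Instance.itemBucket (I : Instance) (k : ℕ) : ℕ :=
  if k < I.n then I.bucket (I.input k) else 2 * I.v + 1

/-- The number of the counter to which item `k` contributes. Processor `k % P` is responsible for
item `k`, and the `P` counters for a bucket are adjacent. -/
def Instance.counter (I : Instance) (P k : ℕ) : ℕ := I.itemBucket k * P + k % P

theorem Instance.itemBucket_le (k : ℕ) : I.itemBucket k ≤ 2 * I.v + 1 := by
  have := I.bucket_le (I.input k)
  unfold Instance.itemBucket
  split_ifs <;> omega

theorem Instance.counter_lt (hP : 0 < P) (k : ℕ) : I.counter P k < (2 * I.v + 2) * P := by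
  have h1 := Nat.mul_le_mul_right P (I.itemBucket_le k)
  have h2 := Nat.mod_lt k hP
  have h3 : (2 * I.v + 2) * P = (2 * I.v + 1) * P + P := by ring
  unfold Instance.counter
  omega

theorem Instance.counter_mod (k : ℕ) : I.counter P k % P = k % P := by
  unfold Instance.counter
  rw [Nat.mul_add_mod_self_right, Nat.mod_mod]

/-- In each round, every processor contributes to one counter of its own. -/
theorem count_counter (r f : ℕ) {i : ℕ} (hi : i ≤ P) :
    Nat.count (fun k => I.counter P k = f) (r * P + i) =
      Nat.count (fun k => I.counter P k = f) (r * P) +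
        if f % P < i ∧ I.counter P (r * P + f % P) = f then 1 else 0 := by
  induction i with
  | zero => simp
  | succ i ih =>
    rw [← Nat.add_assoc, Nat.count_succ, ih (by omega), Nat.add_assoc]
    congr 1
    have hmod : I.counter P (r * P + i) % P = i := by
      rw [I.counter_mod, Nat.mul_add_mod_self_right, Nat.mod_eq_of_lt (by omega)]
    by_cases h : I.counter P (r * P + i) = f
    · rw [h] at hmod
      simp [hmod, h]
    · by_cases h2 : f % P < i
      · simp [h, h2, Nat.lt_succ_of_lt h2]
      · by_cases h3 : f % P < i + 1
        · obtain rfl : f % P = i := by omega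
          simp [h]
        · simp [h, h2, h3]

end

section

variable {p W P : ℕ} {I : Instance}

/-- One round of the classification: register `18` holds the item of the processor, `19` its key, `22` its
bucket, `23` the address of the counter, and `24` the old value of the counter. -/
def classifyRoundCode : List Stmt :=
  assign 18 (.reg 16 * .reg 7 + .reg 0) ++
  (assign 19 (.chars (.load (.reg 18))) ++
  (assign 20 0 ++
  (assign 21 ((.reg 3 + 1) / 2) ++
  ([.loop 21 descendCode] ++
  (assign 22 (.lt (.reg 18) (.reg 2) * (2 * .reg 20 + .lt (.reg 20) (.reg 3) *
      .eq (.load (.reg 13 + .reg 4 * (.reg 20 + 1))) (.reg 19)) +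
    (1 - .lt (.reg 18) (.reg 2)) * (2 * .reg 3 + 1)) ++
  (assign 23 (3 * .reg 9 + (.reg 22 * .reg 7 + .reg 0)) ++
  (assign 24 (.load (.reg 23)) ++
  (put (4 * .reg 9 + .reg 18) (.reg 22) ++
  (put (5 * .reg 9 + .reg 18) (.reg 24) ++
  (put (.reg 23) (.reg 24 + 1) ++ []))))))))))

/-- The strings are distributed to the processors in rounds. Each processor determines the bucket of
its string, and counts the strings of each bucket, with counters of its own. The values of the
counters before the increment number the strings that contribute to the same counter. -/
def classifyCode : List Stmt := forLoop 16 17 (.reg 2 / .reg 7 + 1) classifyRoundCode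

/-- The memory after the classification of the first `m` items. -/
structure Classified (I : Instance) (P m : ℕ) (M₀ M : ℕ → ℕ) : Prop where
  bucket : ∀ k < m, M (4 * I.stride P + k) = I.itemBucket k
  rank : ∀ k < m, M (5 * I.stride P + k) =
    Nat.count (fun k' => I.counter P k' = I.counter P k) k
  count : ∀ f < (2 * I.v + 2) * P, M (3 * I.stride P + f) =
    Nat.count (fun k => I.counter P k = f) m
  frame : ∀ x < 3 * I.stride P, M x = M₀ x

theorem WP.classifyRound (hS : Setup p W P I) {E R : ℕ → ℕ → ℕ} {M₀ M : ℕ → ℕ} {X r : ℕ}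
    (hE : Env I P E) (h13 : ∀ i < P, E i 13 = X) (hX : Splitters I P X M₀)
    (hM₀ : ∀ x < I.n, M₀ x = I.mem x) (hR : Same P 16 E R) (hr : ∀ i < P, R i 16 = r)
    (hrn : r < I.n / P + 1) (h : Classified I P (r * P) M₀ M) :
    WP p W I P classifyRoundCode R M (20 + ((∑ _l ∈ Finset.range I.d, (20 + 0 + 1) + 1) + (60 + 0)))
      fun R' M' => (Same P 16 E R' ∧ Classified I P ((r + 1) * P) M₀ M') ∧ ∀ i < P, R' i 16 = r := by
  have b1 := hS.bound
  have b2 := hS.le_stride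
  have b3 := hS.v_le_mul
  have b4 := hS.one_le_P
  have b5 := hS.P_le_mul
  have b6 := hS.adm.one_le_v
  have hE' := hE.same hR
  have hrP : r * P + P ≤ I.n + P := by
    have h1 := Nat.mul_le_mul_right P hrn
    have h2 := div_add_one_mul_le I.n P
    rw [Nat.succ_mul] at h1
    omega
  have hvP : (2 * I.v + 2) * P = 2 * (P * I.v) + 2 * P := by ring
  refine WP.assign (fun i => r * P + i) (fun i hi => ?_) ?_
  · simp only [Ex.eval_add, Ex.eval_mul, Ex.eval_reg, hr i hi, hE'.procs i hi, hE'.id i hi,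
      Nat.mod_add_mod]
    exact Nat.mod_eq_of_lt (by omega)
  refine WP.assign (fun i => I.key (I.str (M (r * P + i))) % 2 ^ W) (fun i hi => ?_) ?_
  · simp only [Ex.eval_chars, Ex.eval_load, Ex.eval_reg, Function.update_self]
  set c : ℕ → ℕ := fun i => I.key (I.str (M (r * P + i))) % 2 ^ W with hc
  refine WP.assign (fun i => 0) (fun i hi => Nat.zero_mod _) ?_
  refine WP.assign (fun i => (I.v + 1) / 2) (fun i hi => ?_) ?_
  · simp only [Ex.eval_div, Ex.eval_add, Ex.eval_one, Ex.eval_two, Ex.eval_reg, Function.update_apply,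
      Nat.reduceEqDiff, reduceIte, hE'.v i hi, Nat.add_mod_mod]
    rw [Nat.mod_eq_of_lt (a := I.v + 1) (b := 2 ^ W) (by omega),
      Nat.mod_eq_of_lt (a := 2) (b := 2 ^ W) (by omega)]
    exact Nat.mod_eq_of_lt (by omega)
  set R₁ : ℕ → ℕ → ℕ := fun i => Function.update (Function.update (Function.update
    (Function.update (R i) 18 (r * P + i)) 19 (c i)) 20 0) 21 ((I.v + 1) / 2) with hR₁
  have s1 : Same P 16 E R₁ := by
    simp only [hR₁]
    repeat refine Same.update (by decide) ?_
    exact hR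
  have hXM : Splitters I P X M := hX.congr fun x _ hx => h.frame x hx
  refine WP.append (T₁ := _) (S₁ := []) (WP.nil ?_)
  refine WP.append (S₁ := [.loop 21 descendCode]) ((WP.descend hS (hE.same s1)
    (fun i hi => (s1 i hi 13 (by decide)).trans (h13 i hi)) hXM (c := c) ?_ ?_ ?_).mono le_rfl ?_)
  · intro i hi
    simp only [hR₁, Function.update_apply, Nat.reduceEqDiff, reduceIte]
  · intro i hi
    simp only [hR₁, Function.update_apply, Nat.reduceEqDiff, reduceIte]
  · intro i hi
    simp only [hR₁, Function.update_apply, reduceIte]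
  rintro R₂ M' ⟨s2, hq, hMM⟩
  subst hMM
  have hE2 := (hE.same s1).same s2
  have g13 : ∀ i < P, R₂ i 13 = X := fun i hi =>
    (s2 i hi 13 (by decide)).trans ((s1 i hi 13 (by decide)).trans (h13 i hi))
  have g16 : ∀ i < P, R₂ i 16 = r := fun i hi => by
    rw [s2 i hi 16 (by decide)]
    simp only [hR₁, Function.update_apply, Nat.reduceEqDiff, reduceIte, hr i hi]
  have g18 : ∀ i < P, R₂ i 18 = r * P + i := fun i hi => by
    rw [s2 i hi 18 (by decide)]
    simp only [hR₁, Function.update_apply, Nat.reduceEqDiff, reduceIte]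
  have g19 : ∀ i < P, R₂ i 19 = c i := fun i hi => by
    rw [s2 i hi 19 (by decide)]
    simp only [hR₁, Function.update_apply, Nat.reduceEqDiff, reduceIte]
  have m1 : 1 % 2 ^ W = 1 := Nat.mod_eq_of_lt (by omega)
  have hcl := fun i => I.counter_lt b4 (r * P + i)
  have hctr : ∀ i < P, I.counter P (r * P + i) = I.itemBucket (r * P + i) * P + i := by
    intro i hi
    rw [Instance.counter, Nat.mul_add_mod_self_right, Nat.mod_eq_of_lt hi]
  refine WP.assign (fun i => I.itemBucket (r * P + i)) (fun i hi => ?_) ?_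
  · have hql := I.leaf_le (c i)
    simp only [Ex.eval_add, Ex.eval_sub, Ex.eval_mul, Ex.eval_lt, Ex.eval_eq, Ex.eval_load, Ex.eval_one,
      Ex.eval_two, Ex.eval_reg, g18 i hi, hE2.n i hi, hq i hi, hE2.v i hi, g13 i hi, hE2.α i hi, g19 i hi,
      Nat.mul_mod_mod, Nat.mod_mul_mod, Nat.add_mod_mod, Nat.mod_add_mod]
    unfold Instance.itemBucket
    by_cases hk : r * P + i < I.n
    · simp only [hk, if_true, one_mul, m1, Nat.sub_self, zero_mul, add_zero]
      have hck : c i = I.key (I.input (r * P + i)) := by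
        simp only [hc]
        rw [h.frame _ (by omega), hM₀ _ hk]
        exact Nat.mod_eq_of_lt (hS.adm.key_lt hk)
      unfold Instance.bucket
      simp only [← hck]
      by_cases hlv : I.leaf (c i) < I.v
      · have hX1 := hXM.range _ hlv
        rw [Nat.mod_eq_of_lt (a := X + _) (b := 2 ^ W) (by omega), hXM.eq _ hlv]
        simp only [hlv, if_true, one_mul, true_and]
        exact Nat.mod_eq_of_lt (by split_ifs <;> omega)
      · simp only [hlv, if_false, zero_mul, false_and, add_zero]
        exact Nat.mod_eq_of_lt (by omega)
    · simp only [hk, if_false, zero_mul, zero_add, Nat.zero_mod, Nat.sub_zero, m1, one_mul]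
      exact Nat.mod_eq_of_lt (by omega)
  refine WP.assign (fun i => 3 * I.stride P + I.counter P (r * P + i)) (fun i hi => ?_) ?_
  · have := hcl i
    simp only [Ex.eval_add, Ex.eval_mul, Ex.eval_three, Ex.eval_reg, Function.update_apply,
      Nat.reduceEqDiff, reduceIte, hE2.D i hi, hE2.procs i hi, hE2.id i hi, Nat.mod_mul_mod,
      Nat.mod_add_mod, Nat.add_mod_mod]
    rw [← hctr i hi]
    exact Nat.mod_eq_of_lt (by omega)
  refine WP.assign (fun i => Nat.count (fun k => I.counter P k = I.counter P (r * P + i)) (r * P))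
    (fun i hi => ?_) ?_
  · simp only [Ex.eval_load, Ex.eval_reg, Function.update_self]
    exact h.count _ (hcl i)
  have hcinj : ∀ i < P, ∀ j < P, I.counter P (r * P + i) = I.counter P (r * P + j) → i = j := by
    intro i hi j hj hij
    have h1 := congrArg (· % P) hij
    simp only [I.counter_mod, Nat.mul_add_mod_self_right, Nat.mod_eq_of_lt hi, Nat.mod_eq_of_lt hj] at h1
    exact h1
  refine WP.put hS.P_le (fun i => 4 * I.stride P + (r * P + i)) (fun i => I.itemBucket (r * P + i))
    (fun i hi => ?_) (fun i hi => ?_) (fun i hi j hj hij => by omega) ?_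
  · simp only [Ex.eval_add, Ex.eval_mul, Ex.eval_four, Ex.eval_reg, Function.update_apply,
      Nat.reduceEqDiff, reduceIte, hE2.D i hi, g18 i hi, Nat.mod_mul_mod, Nat.mod_add_mod]
    exact Nat.mod_eq_of_lt (by omega)
  · simp only [Ex.eval_reg, Function.update_apply, Nat.reduceEqDiff, reduceIte]
  intro M₁ hM1 hM1'
  refine WP.put hS.P_le (fun i => 5 * I.stride P + (r * P + i))
    (fun i => Nat.count (fun k => I.counter P k = I.counter P (r * P + i)) (r * P))
    (fun i hi => ?_) (fun i hi => ?_) (fun i hi j hj hij => by omega) ?_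
  · simp only [Ex.eval_add, Ex.eval_mul, Ex.eval_five, Ex.eval_reg, Function.update_apply,
      Nat.reduceEqDiff, reduceIte, hE2.D i hi, g18 i hi, Nat.mod_mul_mod, Nat.mod_add_mod]
    exact Nat.mod_eq_of_lt (by omega)
  · simp only [Ex.eval_reg, Function.update_apply, reduceIte]
  intro M₂ hM2 hM2'
  refine WP.put hS.P_le (fun i => 3 * I.stride P + I.counter P (r * P + i))
    (fun i => Nat.count (fun k => I.counter P k = I.counter P (r * P + i)) (r * P) + 1)
    (fun i hi => ?_) (fun i hi => ?_) (fun i hi j hj hij => hcinj i hi j hj (by omega)) ?_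
  · simp only [Ex.eval_reg, Function.update_apply, Nat.reduceEqDiff, reduceIte]
  · simp only [Ex.eval_add, Ex.eval_one, Ex.eval_reg, Function.update_apply, reduceIte,
      Nat.add_mod_mod]
    refine Nat.mod_eq_of_lt ?_
    have := Nat.count_le (p := fun k => I.counter P k = I.counter P (r * P + i)) (n := r * P)
    omega
  intro M₃ hM3 hM3'
  have hmul : (r + 1) * P = r * P + P := by ring
  refine WP.nil ⟨⟨?_, ?_, ?_, ?_, ?_⟩, fun i hi => ?_⟩
  · repeat refine Same.update (by decide) ?_
    exact s1.trans (s2.mono (by decide))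
  · intro k hk
    rw [hM3' _ fun i hi => by have := hcl i; omega, hM2' _ fun i hi => by omega]
    by_cases hkr : k < r * P
    · rw [hM1' _ fun i hi => by omega]
      exact h.bucket k hkr
    · obtain ⟨i, rfl⟩ := Nat.exists_eq_add_of_le (not_lt.1 hkr)
      exact hM1 i (by omega)
  · intro k hk
    rw [hM3' _ fun i hi => by have := hcl i; omega]
    by_cases hkr : k < r * P
    · rw [hM2' _ fun i hi => by omega, hM1' _ fun i hi => by omega]
      exact h.rank k hkr
    · obtain ⟨i, rfl⟩ := Nat.exists_eq_add_of_le (not_lt.1 hkr)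
      have hi : i < P := by omega
      rw [hM2 i hi, count_counter r _ hi.le, if_neg, add_zero]
      rw [I.counter_mod, Nat.mul_add_mod_self_right, Nat.mod_eq_of_lt hi]
      omega
  · intro f hf
    rw [hmul, count_counter r f le_rfl]
    have hfP : f % P < P := Nat.mod_lt _ b4
    by_cases hff : I.counter P (r * P + f % P) = f
    · rw [if_pos ⟨hfP, hff⟩]
      have := hM3 _ hfP
      rw [hff] at this
      exact this
    · rw [if_neg (fun hh => hff hh.2), add_zero, hM3' _ fun i hi => ?_, hM2' _ fun i hi => by omega,
        hM1' _ fun i hi => by omega]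
      · exact h.count f hf
      · intro hh
        have h1 : I.counter P (r * P + i) = f := by omega
        have h2 := congrArg (· % P) h1
        simp only [I.counter_mod, Nat.mul_add_mod_self_right, Nat.mod_eq_of_lt hi] at h2
        rw [← h2] at hff
        exact hff h1
  · intro x hx
    rw [hM3' _ fun i hi => by omega, hM2' _ fun i hi => by omega, hM1' _ fun i hi => by omega]
    exact h.frame x hx
  · simp only [Function.update_apply, Nat.reduceEqDiff, reduceIte, g16 i hi]

theorem WP.classifyCode (hS : Setup p W P I) {E R : ℕ → ℕ → ℕ} {M : ℕ → ℕ} {X : ℕ}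
    {S : List Stmt} {T : ℕ} {Q : (ℕ → ℕ → ℕ) → (ℕ → ℕ) → Prop}
    (hE : Env I P E) (h13 : ∀ i < P, E i 13 = X) (hX : Splitters I P X M)
    (hM : ∀ x < I.n, M x = I.mem x) (hR : Same P 16 E R)
    (hzero : ∀ f < (2 * I.v + 2) * P, M (3 * I.stride P + f) = 0)
    (hQ : ∀ R' M', Same P 16 E R' → Classified I P ((I.n / P + 1) * P) M M' →
      WP p W I P S R' M' T Q) :
    WP p W I P (classifyCode ++ S) R M (10 + (I.n / P + 1) * (100 + 21 * I.d) + T) Q := by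
  have b1 := hS.bound
  have b2 := hS.le_stride
  have b3 := hS.adm.one_le_v
  have b4 := hS.v_le_mul
  have hdiv : I.n / P ≤ I.n := Nat.div_le_self _ _
  have hW : I.n / P + 1 < 2 ^ W := by
    generalize I.n / P = y at *
    omega
  refine (WP.forLoop (fun r R' M' => Same P 16 E R' ∧ Classified I P (r * P) M M') (I.n / P + 1)
    (20 + ((∑ _l ∈ Finset.range I.d, (20 + 0 + 1) + 1) + (60 + 0))) hW
    (by decide) (by decide) (by decide) rfl ?_ ?_ ?_ ?_ (fun R' M' h => hQ R' M' h.1 h.2)).mono ?_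
    (fun _ _ h => h)
  · intro j R' M' h i hi
    have hE' := hE.same h.1
    simp only [Ex.eval_add, Ex.eval_div, Ex.eval_one, Ex.eval_reg, hE'.n i hi, hE'.procs i hi,
      Nat.add_mod_mod, Nat.mod_add_mod]
    exact Nat.mod_eq_of_lt hW
  · rintro j R' M' c hc x ⟨h1, h2⟩
    refine ⟨h1.update ?_, h2⟩
    simp at hc
    omega
  · refine ⟨hR, fun k hk => by omega, fun k hk => by omega, fun f hf => ?_, fun _ _ => rfl⟩
    rw [zero_mul, Nat.count_zero]
    exact hzero f hf
  · rintro r hr R' M' ⟨h1, h2⟩ hRr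
    exact WP.classifyRound hS hE h13 hX hM h1 hRr hr h2
  · rw [Finset.sum_const, Finset.card_range, smul_eq_mul]
    change 3 + 3 + (I.n / P + 1) * (20 + (I.d * (20 + 0 + 1) + 1 + (60 + 0)) + 3 + 4) + T ≤ _
    have : (I.n / P + 1) * (20 + (I.d * (20 + 0 + 1) + 1 + (60 + 0)) + 3 + 4) ≤
        (I.n / P + 1) * (100 + 21 * I.d) := Nat.mul_le_mul_left _ (by omega)
    omega

end

/-! ### Prefix sums -/

/-- Register `17` gets the sum of the numbers in the block of the processor. -/
def blockSumCode : List Stmt :=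
  forLoop 18 19 (.reg 16)
    (assign 17 (.reg 17 + .load (3 * .reg 9 + .reg 0 * .reg 16 + .reg 18)) ++ [])

/-- One round of the prefix sums over the processors: each adds the sum of the processor whose number
is smaller by the distance in register `21`. -/
def scanStepCode : List Stmt :=
  assign 23 (.load (6 * .reg 9 + (.reg 0 - .reg 21))) ++
  (assign 17 (.reg 17 + (1 - .lt (.reg 0) (.reg 21)) * .reg 23) ++
  (put (6 * .reg 9 + .reg 0) (.reg 17) ++
  (assign 21 (2 * .reg 21) ++
  (assign 22 (.lt (.reg 21) (.reg 7)) ++ []))))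

/-- The numbers in the block of the processor are replaced by their prefix sums. -/
def blockScanCode : List Stmt :=
  forLoop 18 19 (.reg 16)
    (assign 24 (.load (3 * .reg 9 + .reg 0 * .reg 16 + .reg 18)) ++
    (put (3 * .reg 9 + .reg 0 * .reg 16 + .reg 18) (.reg 17) ++
    (assign 17 (.reg 17 + .reg 24) ++ [])))

/-- The counters are replaced by their prefix sums. -/
def prefixCode : List Stmt :=
  assign 16 (2 * .reg 3 + 2) ++ (assign 17 0 ++
  (blockSumCode ++
  (assign 20 (.reg 17 + 0) ++ (put (6 * .reg 9 + .reg 0) (.reg 17) ++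
  (assign 21 1 ++ (assign 22 (.lt (.reg 21) (.reg 7)) ++
  ([.loop 22 scanStepCode] ++
  (assign 17 (.reg 17 - .reg 20) ++ (blockScanCode ++ [])))))))))

section

variable {p W P : ℕ} {I : Instance}

/-- The sum of the first `m` terms of a sequence. -/
def psum (c : ℕ → ℕ) (m : ℕ) : ℕ := ∑ g ∈ Finset.range m, c g

theorem psum_succ (c : ℕ → ℕ) (m : ℕ) : psum c (m + 1) = psum c m + c m :=
  Finset.sum_range_succ _ _

theorem psum_mono (c : ℕ → ℕ) {m m' : ℕ} (h : m ≤ m') : psum c m ≤ psum c m' :=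
  Finset.sum_le_sum_of_subset (Finset.range_mono h)

theorem block_index_lt {len i t : ℕ} (hi : i < P) (ht : t < len) : i * len + t < len * P := by
  have := Nat.mul_le_mul_right len (Nat.succ_le_of_lt hi)
  rw [Nat.succ_mul] at this
  rw [mul_comm len]
  omega

theorem block_index_inj {len t i j : ℕ} (ht : t < len) (h : i * len + t = j * len + t) : i = j :=
  Nat.eq_of_mul_eq_mul_right (by omega) (Nat.add_right_cancel h)

theorem WP.blockSum (hS : Setup p W P I) {E R : ℕ → ℕ → ℕ} {M : ℕ → ℕ} {c : ℕ → ℕ} {len : ℕ}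
    {S : List Stmt} {T : ℕ} {Q : (ℕ → ℕ → ℕ) → (ℕ → ℕ) → Prop}
    (hE : Env I P E) (h16 : ∀ i < P, E i 16 = len) (hR : Same P 17 E R) (h17 : ∀ i < P, R i 17 = 0)
    (hlen : len * P ≤ I.stride P)
    (hM : ∀ f < len * P, M (3 * I.stride P + f) = c f) (hsum : psum c (len * P) < 2 ^ W)
    (hQ : ∀ R', Same P 17 E R' → (∀ i < P, R' i 17 = psum c ((i + 1) * len) - psum c (i * len)) →
      WP p W I P S R' M T Q) :
    WP p W I P (blockSumCode ++ S) R M (3 + len * 24 + T) Q := by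
  have b1 := hS.bound
  have b4 := hS.one_le_P
  have hlenP : len ≤ len * P := Nat.le_mul_of_pos_right _ b4
  refine (WP.forLoop (T := T) (fun t R' M' => Same P 17 E R' ∧ M' = M ∧
    ∀ i < P, R' i 17 = psum c (i * len + t) - psum c (i * len)) len (20 + 0) (by omega)
    (by decide) (by decide) (by decide) rfl ?_ ?_ ?_ ?_ ?_).mono ?_ (fun _ _ h => h)
  · intro j R' M' h i hi
    exact (h.1 i hi 16 (by decide)).trans (h16 i hi)
  · rintro j R' M' r hr x ⟨h1, h2, h3⟩
    have hr' : r = 18 ∨ r = 19 := by simpa using hr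
    refine ⟨h1.update (by omega), h2, fun i hi => ?_⟩
    exact (Function.update_of_ne (show 17 ≠ r by omega) _ _).trans (h3 i hi)
  · exact ⟨hR, rfl, fun i hi => by rw [h17 i hi, add_zero, Nat.sub_self]⟩
  · rintro t ht R' M' ⟨h1, rfl, h3⟩ hRt
    have hE' := hE.same h1
    have g16 : ∀ i < P, R' i 16 = len := fun i hi => (h1 i hi 16 (by decide)).trans (h16 i hi)
    refine WP.assign (fun i => psum c (i * len + (t + 1)) - psum c (i * len)) (fun i hi => ?_) ?_
    · have hlt := block_index_lt hi ht
      have m1 := psum_mono c (Nat.succ_le_of_lt hlt)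
      have m2 := psum_mono c (Nat.le_add_right (i * len) t)
      simp only [Ex.eval_add, Ex.eval_mul, Ex.eval_load, Ex.eval_three, Ex.eval_reg, hE'.D i hi, hE'.id i hi,
        g16 i hi, hRt i hi, h3 i hi, Nat.mod_mul_mod, Nat.mod_add_mod, Nat.add_mod_mod]
      rw [Nat.mod_eq_of_lt (a := 3 * I.stride P + _ + _) (b := 2 ^ W) (by omega), Nat.add_assoc (3 * _), hM _ hlt,
        ← Nat.add_assoc, psum_succ]
      rw [Nat.succ_eq_add_one, psum_succ] at m1
      rw [Nat.mod_eq_of_lt (by omega)]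
      omega
    refine WP.nil ⟨⟨h1.update (by decide), rfl, fun i hi => ?_⟩, fun i hi => ?_⟩
    · simp only [Function.update_self]
    · simp only [Function.update_apply, Nat.reduceEqDiff, reduceIte, hRt i hi]
  · rintro R' M' ⟨h1, rfl, h3⟩
    refine hQ R' h1 fun i hi => ?_
    rw [h3 i hi, Nat.succ_mul]
  · change 0 + 3 + len * (20 + 0 + 0 + 4) + T ≤ _
    omega

/-- After `l` rounds, processor `i` knows the sum of the blocks of the last `2 ^ l` processors up to `i`;
the truncated subtraction in `i + 1 - 2 ^ l` covers the processors that already know the whole sum. -/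
theorem WP.scan (hS : Setup p W P I) {E R : ℕ → ℕ → ℕ} {M : ℕ → ℕ} {c : ℕ → ℕ} {len : ℕ}
    (hE : Env I P E) (hR : Same P 17 E R)
    (h17 : ∀ i < P, R i 17 = psum c ((i + 1) * len) - psum c (i * len))
    (h21 : ∀ i < P, R i 21 = 1) (h22 : ∀ i < P, R i 22 = if 1 < P then 1 else 0)
    (hM : ∀ i < P, M (6 * I.stride P + i) = psum c ((i + 1) * len) - psum c (i * len))
    (hsum : psum c (len * P) < 2 ^ W) :
    WP p W I P [.loop 22 scanStepCode] R M (∑ _l ∈ Finset.range (Nat.clog 2 P), (40 + 0 + 1) + 1)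
      fun R' M' => Same P 17 E R' ∧ (∀ i < P, R' i 20 = R i 20) ∧
        (∀ i < P, R' i 17 = psum c ((i + 1) * len)) ∧ ∀ x < 6 * I.stride P, M' x = M x := by
  have b1 := hS.bound
  have b2 := hS.le_stride
  have b4 := hS.one_le_P
  have b5 := hS.P_le_mul
  refine (WP.loop (fun l R' M' => Same P 17 E R' ∧ (∀ i < P, R' i 20 = R i 20) ∧
    (∀ i < P, R' i 17 = psum c ((i + 1) * len) - psum c ((i + 1 - 2 ^ l) * len)) ∧
    (∀ i < P, R' i 21 = 2 ^ l) ∧ (∀ i < P, R' i 22 = if 2 ^ l < P then 1 else 0) ∧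
    (∀ i < P, M' (6 * I.stride P + i) = psum c ((i + 1) * len) - psum c ((i + 1 - 2 ^ l) * len)) ∧
    ∀ x < 6 * I.stride P, M' x = M x) (Nat.clog 2 P) (fun _ => 40 + 0) (by decide) ?_ ?_ ?_).mono
    le_rfl ?_
  · refine ⟨hR, fun i hi => rfl, fun i hi => ?_, fun i hi => ?_, fun i hi => ?_, fun i hi => ?_,
      fun _ _ => rfl⟩
    · rw [h17 i hi, pow_zero, Nat.add_sub_cancel]
    · rw [h21 i hi, pow_zero]
    · rw [h22 i hi, pow_zero]
    · rw [hM i hi, pow_zero, Nat.add_sub_cancel]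
  · rintro l hl R' M' ⟨h1, h20, h17, h21, h22, hM, hfr⟩
    have hlP : 2 ^ l < P := (Nat.lt_clog_iff_pow_lt (by decide)).1 hl
    refine ⟨fun i hi => by rw [h22 i hi, if_pos hlP]; decide, ?_⟩
    have hE' := hE.same h1
    have m1 : 1 % 2 ^ W = 1 := Nat.mod_eq_of_lt (by omega)
    have hbd : ∀ i < P, psum c ((i + 1) * len) < 2 ^ W := by
      intro i hi
      refine lt_of_le_of_lt (psum_mono c ?_) hsum
      rw [mul_comm len P]
      exact Nat.mul_le_mul_right _ hi
    refine WP.assign (fun i => psum c ((i - 2 ^ l + 1) * len) -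
      psum c ((i - 2 ^ l + 1 - 2 ^ l) * len)) (fun i hi => ?_) ?_
    · have hsub := Nat.sub_le i (2 ^ l)
      simp only [Ex.eval_add, Ex.eval_mul, Ex.eval_sub, Ex.eval_load, Ex.eval_six, Ex.eval_reg,
        hE'.D i hi, hE'.id i hi, h21 i hi, Nat.mod_mul_mod, Nat.mod_add_mod, Nat.add_mod_mod]
      rw [Nat.mod_eq_of_lt (by omega), hM _ (by omega)]
    have step : ∀ i < P, (psum c ((i + 1) * len) - psum c ((i + 1 - 2 ^ l) * len)) +
        (if i < 2 ^ l then 0 else psum c ((i - 2 ^ l + 1) * len) -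
          psum c ((i - 2 ^ l + 1 - 2 ^ l) * len)) =
        psum c ((i + 1) * len) - psum c ((i + 1 - 2 ^ (l + 1)) * len) := by
      intro i hi
      rw [pow_succ]
      generalize 2 ^ l = z
      split_ifs with hil
      · rw [show i + 1 - z = 0 by omega, show i + 1 - z * 2 = 0 by omega, add_zero]
      · rw [show i - z + 1 - z = i + 1 - z * 2 by omega,
          show i - z + 1 = i + 1 - z by omega]
        have k1 := psum_mono c (Nat.mul_le_mul_right len (show i + 1 - z * 2 ≤ i + 1 - z by omega))
        have k2 := psum_mono c (Nat.mul_le_mul_right len (show i + 1 - z ≤ i + 1 by omega))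
        omega
    refine WP.assign (fun i => psum c ((i + 1) * len) - psum c ((i + 1 - 2 ^ (l + 1)) * len))
      (fun i hi => ?_) ?_
    · simp only [Ex.eval_add, Ex.eval_mul, Ex.eval_sub, Ex.eval_lt, Ex.eval_one, Ex.eval_reg,
        Function.update_apply, Nat.reduceEqDiff, reduceIte, hE'.id i hi, h21 i hi, h17 i hi]
      have := hbd i hi
      rw [← step i hi]
      have hst := step i hi
      split_ifs at hst ⊢ with hil
      · simp only [m1, Nat.sub_self, Nat.zero_mod, zero_mul, add_zero]
        exact Nat.mod_eq_of_lt (by omega)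
      · simp only [m1, Nat.zero_mod, Nat.sub_zero, one_mul, Nat.add_mod_mod]
        exact Nat.mod_eq_of_lt (by omega)
    refine WP.put hS.P_le (fun i => 6 * I.stride P + i)
      (fun i => psum c ((i + 1) * len) - psum c ((i + 1 - 2 ^ (l + 1)) * len))
      (fun i hi => ?_) (fun i hi => ?_) (fun i hi j hj hij => by omega) ?_
    · simp only [Ex.eval_add, Ex.eval_mul, Ex.eval_six, Ex.eval_reg, Function.update_apply,
        Nat.reduceEqDiff, reduceIte, hE'.D i hi, hE'.id i hi, Nat.mod_mul_mod, Nat.mod_add_mod]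
      exact Nat.mod_eq_of_lt (by omega)
    · simp only [Ex.eval_reg, Function.update_apply, reduceIte]
    intro M₁ hM1 hM1'
    refine WP.assign (fun i => 2 ^ (l + 1)) (fun i hi => ?_) ?_
    · simp only [Ex.eval_mul, Ex.eval_two, Ex.eval_reg, Function.update_apply, Nat.reduceEqDiff,
        reduceIte, h21 i hi, Nat.mod_mul_mod, pow_succ']
      exact Nat.mod_eq_of_lt (by omega)
    refine WP.assign (fun i => if 2 ^ (l + 1) < P then 1 else 0) (fun i hi => ?_) ?_
    · simp only [Ex.eval_lt, Ex.eval_reg, Function.update_apply, Nat.reduceEqDiff, reduceIte,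
        hE'.procs i hi]
      split_ifs
      · exact m1
      · exact Nat.zero_mod _
    refine WP.nil ⟨?_, fun i hi => ?_, fun i hi => ?_, fun i hi => ?_, fun i hi => ?_, hM1, ?_⟩
    · repeat refine Same.update (by decide) ?_
      exact h1
    · simp only [Function.update_apply, Nat.reduceEqDiff, reduceIte, h20 i hi]
    · simp only [Function.update_apply, Nat.reduceEqDiff, reduceIte]
    · simp only [Function.update_apply, Nat.reduceEqDiff, reduceIte]
    · simp only [Function.update_apply, reduceIte]
    · intro x hx
      rw [hM1' _ fun i hi => by omega]
      exact hfr x hx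
  · rintro R' M' ⟨-, -, -, -, h, -⟩ i hi
    rw [h i hi, if_neg]
    exact not_lt.2 (Nat.le_pow_clog (by decide) P)
  · rintro R' M' ⟨h1, h2, h3, -, -, -, h4⟩
    refine ⟨h1, h2, fun i hi => ?_, h4⟩
    have hpow : P ≤ 2 ^ Nat.clog 2 P := Nat.le_pow_clog (by decide) P
    rw [h3 i hi, show i + 1 - 2 ^ Nat.clog 2 P = 0 by omega, zero_mul]
    simp [psum]

theorem WP.blockScan (hS : Setup p W P I) {E R : ℕ → ℕ → ℕ} {M : ℕ → ℕ} {c : ℕ → ℕ} {len : ℕ}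
    {S : List Stmt} {T : ℕ} {Q : (ℕ → ℕ → ℕ) → (ℕ → ℕ) → Prop}
    (hE : Env I P E) (h16 : ∀ i < P, E i 16 = len) (hR : Same P 17 E R)
    (h17 : ∀ i < P, R i 17 = psum c (i * len)) (hlen : len * P ≤ I.stride P)
    (hM : ∀ f < len * P, M (3 * I.stride P + f) = c f) (hsum : psum c (len * P) < 2 ^ W)
    (hQ : ∀ R' M', Same P 17 E R' → (∀ f < len * P, M' (3 * I.stride P + f) = psum c f) →
      (∀ x, x < 3 * I.stride P ∨ 4 * I.stride P ≤ x → M' x = M x) → WP p W I P S R' M' T Q) :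
    WP p W I P (blockScanCode ++ S) R M (3 + len * 34 + T) Q := by
  have b1 := hS.bound
  have b4 := hS.one_le_P
  have hlenP : len ≤ len * P := Nat.le_mul_of_pos_right _ b4
  -- a cell determines the block and the position in the block
  have huniq : ∀ {i j t u : ℕ}, t < len → u < len → i * len + t = j * len + u → i = j ∧ t = u := by
    intro i j t u ht hu h
    have hpos : 0 < len := by omega
    have h1 := congrArg (· / len) h
    have h2 := congrArg (· % len) h
    simp only [mul_comm _ len, Nat.mul_add_div hpos, Nat.div_eq_of_lt ht, Nat.div_eq_of_lt hu,
      add_zero, Nat.mul_add_mod, Nat.mod_eq_of_lt ht, Nat.mod_eq_of_lt hu] at h1 h2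
    exact ⟨h1, h2⟩
  refine (WP.forLoop (T := T) (fun t R' M' => Same P 17 E R' ∧
    (∀ i < P, R' i 17 = psum c (i * len + t)) ∧
    (∀ i < P, ∀ u < len, M' (3 * I.stride P + (i * len + u)) =
      if u < t then psum c (i * len + u) else c (i * len + u)) ∧
    ∀ x, x < 3 * I.stride P ∨ 4 * I.stride P ≤ x → M' x = M x) len (30 + 0) (by omega)
    (by decide) (by decide) (by decide) rfl ?_ ?_ ?_ ?_ ?_).mono ?_ (fun _ _ h => h)
  · intro j R' M' h i hi
    exact (h.1 i hi 16 (by decide)).trans (h16 i hi)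
  · rintro j R' M' r hr x ⟨h1, h2, h3⟩
    have hr' : r = 18 ∨ r = 19 := by simpa using hr
    refine ⟨h1.update (by omega), fun i hi => ?_, h3⟩
    exact (Function.update_of_ne (show 17 ≠ r by omega) _ _).trans (h2 i hi)
  · refine ⟨hR, h17, fun i hi u hu => ?_, fun _ _ => rfl⟩
    rw [if_neg (Nat.not_lt_zero _)]
    exact hM _ (block_index_lt hi hu)
  · rintro t ht R' M' ⟨h1, h2, h3, h4⟩ hRt
    have hE' := hE.same h1
    have g16 : ∀ i < P, R' i 16 = len := fun i hi => (h1 i hi 16 (by decide)).trans (h16 i hi)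
    refine WP.assign (fun i => c (i * len + t)) (fun i hi => ?_) ?_
    · have hlt := block_index_lt hi ht
      simp only [Ex.eval_add, Ex.eval_mul, Ex.eval_load, Ex.eval_three, Ex.eval_reg, hE'.D i hi, hE'.id i hi,
        g16 i hi, hRt i hi, Nat.mod_mul_mod, Nat.mod_add_mod, Nat.add_mod_mod]
      rw [Nat.mod_eq_of_lt (by omega), Nat.add_assoc, h3 i hi t ht, if_neg (lt_irrefl t)]
    refine WP.put hS.P_le (fun i => 3 * I.stride P + (i * len + t)) (fun i => psum c (i * len + t))
      (fun i hi => ?_) (fun i hi => ?_) (fun i hi j hj hij => block_index_inj ht (by omega)) ?_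
    · have hlt := block_index_lt hi ht
      simp only [Ex.eval_add, Ex.eval_mul, Ex.eval_three, Ex.eval_reg, Function.update_apply,
        Nat.reduceEqDiff, reduceIte, hE'.D i hi, hE'.id i hi, g16 i hi, hRt i hi, Nat.mod_mul_mod,
        Nat.mod_add_mod, Nat.add_mod_mod]
      rw [← Nat.add_assoc]
      exact Nat.mod_eq_of_lt (by omega)
    · simp only [Ex.eval_reg, Function.update_apply, Nat.reduceEqDiff, reduceIte, h2 i hi]
    intro M₁ hM1 hM1'
    refine WP.assign (fun i => psum c (i * len + (t + 1))) (fun i hi => ?_) ?_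
    · have hlt := block_index_lt hi ht
      simp only [Ex.eval_add, Ex.eval_reg, Function.update_apply, Nat.reduceEqDiff, reduceIte, h2 i hi]
      rw [← psum_succ, ← Nat.add_assoc]
      exact Nat.mod_eq_of_lt (lt_of_le_of_lt (psum_mono c hlt) hsum)
    refine WP.nil ⟨⟨?_, fun i hi => ?_, fun i hi u hu => ?_, fun x hx => ?_⟩, fun i hi => ?_⟩
    · repeat refine Same.update (by decide) ?_
      exact h1
    · simp only [Function.update_apply, reduceIte]
    · by_cases hut : u = t
      · subst hut
        rw [hM1 i hi, if_pos (Nat.lt_succ_self _)]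
      · rw [hM1' _ fun j hj hh => hut (huniq ht hu (by omega : j * len + t = i * len + u)).2.symm, h3 i hi u hu]
        by_cases h5 : u < t
        · rw [if_pos h5, if_pos (by omega)]
        · rw [if_neg h5, if_neg (by omega)]
    · rw [hM1' _ fun j hj => ?_]
      · exact h4 x hx
      · have := block_index_lt hj ht
        omega
    · simp only [Function.update_apply, Nat.reduceEqDiff, reduceIte, hRt i hi]
  · rintro R' M' ⟨h1, -, h3, h4⟩
    refine hQ R' M' h1 (fun f hf => ?_) h4
    have hpos : 0 < len := Nat.pos_of_ne_zero fun h => by simp [h] at hf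
    have hfl := Nat.mod_lt f hpos
    have := h3 (f / len) ((Nat.div_lt_iff_lt_mul hpos).2 (by rwa [mul_comm])) (f % len) hfl
    rw [if_pos hfl, Nat.div_add_mod'] at this
    exact this
  · change 0 + 3 + len * (30 + 0 + 0 + 4) + T ≤ _
    omega

/-- Each processor sums its block of `2 v + 2` counters, the sums are added up over the processors in
`log P` rounds, and each processor then scans its block. -/
theorem WP.prefixCode (hS : Setup p W P I) {E R : ℕ → ℕ → ℕ} {M : ℕ → ℕ} {c : ℕ → ℕ}
    {S : List Stmt} {T : ℕ} {Q : (ℕ → ℕ → ℕ) → (ℕ → ℕ) → Prop}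
    (hE : Env I P E) (hR : Same P 16 E R)
    (hM : ∀ f < (2 * I.v + 2) * P, M (3 * I.stride P + f) = c f)
    (hsum : psum c ((2 * I.v + 2) * P) < 2 ^ W)
    (hQ : ∀ R' M', Same P 16 E R' →
      (∀ f < (2 * I.v + 2) * P, M' (3 * I.stride P + f) = psum c f) →
      (∀ x < 6 * I.stride P, x < 3 * I.stride P ∨ 4 * I.stride P ≤ x → M' x = M x) →
      WP p W I P S R' M' T Q) :
    WP p W I P (prefixCode ++ S) R M (200 + (2 * I.v + 2) * 58 + 41 * Nat.clog 2 P + T) Q := by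
  have b1 := hS.bound
  have b2 := hS.le_stride
  have b3 := hS.v_le_mul
  have b4 := hS.one_le_P
  have b5 := hS.P_le_mul
  have hlen : (2 * I.v + 2) * P ≤ I.stride P := by
    have : (2 * I.v + 2) * P = 2 * (P * I.v) + 2 * P := by ring
    omega
  have hE' := hE.same hR
  refine WP.append ?_
  refine WP.mono (T := 10 + (3 + (2 * I.v + 2) * 24 + (30 +
    (∑ _l ∈ Finset.range (Nat.clog 2 P), (40 + 0 + 1) + 1 + (10 + (3 + (2 * I.v + 2) * 34 + 0))))))
    (Q := fun R' M' => WP p W I P S R' M' T Q) ?_ ?_ (fun _ _ h => h)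
  swap
  · rw [Finset.sum_const, Finset.card_range, smul_eq_mul]
    omega
  unfold S5.prefixCode
  refine WP.assign (fun i => 2 * I.v + 2) (fun i hi => ?_) ?_
  · simp only [Ex.eval_add, Ex.eval_mul, Ex.eval_two, Ex.eval_reg, hE'.v i hi,
      Nat.mod_add_mod, Nat.add_mod_mod, Nat.mod_mul_mod]
    exact Nat.mod_eq_of_lt (by omega)
  refine WP.assign (fun i => 0) (fun i hi => Nat.zero_mod _) ?_
  refine WP.append (S₁ := []) (T₁ := _) (WP.nil ?_)
  set R₁ : ℕ → ℕ → ℕ := fun i => Function.update (R i) 16 (2 * I.v + 2) with hR₁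
  have s1 : Same P 16 E R₁ := hR.update le_rfl
  have hE1 := hE.same s1
  have f16 : ∀ i < P, R₁ i 16 = 2 * I.v + 2 := fun i hi => by simp only [hR₁, Function.update_self]
  refine WP.blockSum hS hE1 f16 ((Same.refl _ _ _).update le_rfl)
    (fun i hi => by simp only [Function.update_self]) hlen hM hsum ?_
  intro R₂ s2 h17
  have hE2 := hE1.same s2
  have hbd : ∀ i < P, psum c ((i + 1) * (2 * I.v + 2)) < 2 ^ W := by
    intro i hi
    refine lt_of_le_of_lt (psum_mono c ?_) hsum
    rw [mul_comm _ P]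
    exact Nat.mul_le_mul_right _ hi
  refine WP.assign (fun i => psum c ((i + 1) * (2 * I.v + 2)) - psum c (i * (2 * I.v + 2)))
    (fun i hi => ?_) ?_
  · have := hbd i hi
    simp only [Ex.eval_add, Ex.eval_zero, Ex.eval_reg, h17 i hi, Nat.zero_mod, add_zero]
    exact Nat.mod_eq_of_lt (by omega)
  refine WP.put hS.P_le (fun i => 6 * I.stride P + i)
    (fun i => psum c ((i + 1) * (2 * I.v + 2)) - psum c (i * (2 * I.v + 2)))
    (fun i hi => ?_) (fun i hi => ?_) (fun i hi j hj hij => by omega) ?_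
  · simp only [Ex.eval_add, Ex.eval_mul, Ex.eval_six, Ex.eval_reg, Function.update_apply,
      Nat.reduceEqDiff, reduceIte, hE2.D i hi, hE2.id i hi, Nat.mod_mul_mod, Nat.mod_add_mod]
    exact Nat.mod_eq_of_lt (by omega)
  · simp only [Ex.eval_reg, Function.update_apply, Nat.reduceEqDiff, reduceIte, h17 i hi]
  intro M₁ hM1 hM1'
  refine WP.assign (fun i => 1) (fun i hi => ?_) ?_
  · rw [Ex.eval_one]
    exact Nat.mod_eq_of_lt (by omega)
  refine WP.assign (fun i => if 1 < P then 1 else 0) (fun i hi => ?_) ?_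
  · simp only [Ex.eval_lt, Ex.eval_reg, Function.update_apply, Nat.reduceEqDiff, reduceIte,
      hE2.procs i hi]
    split_ifs
    · exact Nat.mod_eq_of_lt (by omega)
    · exact Nat.zero_mod _
  refine WP.append (S₁ := []) (T₁ := _) (WP.nil ?_)
  refine WP.append (S₁ := [.loop 22 scanStepCode]) ((WP.scan hS hE1 (c := c) (len := 2 * I.v + 2)
    ?_ ?_ ?_ ?_ hM1 hsum).mono le_rfl ?_)
  · repeat refine Same.update (by decide) ?_
    exact s2
  · intro i hi
    simp only [Function.update_apply, Nat.reduceEqDiff, reduceIte, h17 i hi]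
  · intro i hi
    simp only [Function.update_apply, Nat.reduceEqDiff, reduceIte]
  · intro i hi
    simp only [Function.update_apply, reduceIte]
  rintro R₃ M₂ ⟨s3, h20, h17', hM2⟩
  have h20' : ∀ i < P, R₃ i 20 = psum c ((i + 1) * (2 * I.v + 2)) - psum c (i * (2 * I.v + 2)) := by
    intro i hi
    rw [h20 i hi]
    simp only [Function.update_apply, Nat.reduceEqDiff, reduceIte]
  refine WP.assign (fun i => psum c (i * (2 * I.v + 2))) (fun i hi => ?_) ?_
  · have h1 := hbd i hi
    have h2 := psum_mono c (Nat.mul_le_mul_right (2 * I.v + 2) (Nat.le_succ i))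
    simp only [Ex.eval_sub, Ex.eval_reg, h17' i hi, h20' i hi]
    rw [Nat.mod_eq_of_lt (by omega)]
    simp only [Nat.succ_eq_add_one] at h2
    omega
  refine WP.append (S₁ := []) (T₁ := _) (WP.nil ?_)
  refine WP.blockScan hS hE1 f16 (s3.update le_rfl) (fun i hi => by simp only [Function.update_self])
    hlen (c := c) (fun f hf => ?_) hsum ?_
  · rw [hM2 _ (by omega), hM1' _ fun i hi => by omega]
    exact hM f hf
  · intro R₄ M₃ s4 hres hfr
    refine WP.nil (hQ R₄ M₃ (s1.trans (s4.mono (by decide))) hres fun x hx hx' => ?_)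
    rw [hfr x hx', hM2 x hx, hM1' _ fun i hi => by omega]

end

/-! ### Longest common prefixes of keys -/

section

variable {W : ℕ} {I : Instance}

theorem xor_div_two_pow (x y s : ℕ) : (x ^^^ y) / 2 ^ s = x / 2 ^ s ^^^ y / 2 ^ s := by
  rw [← Nat.shiftRight_eq_div_pow, Nat.shiftRight_xor_distrib, Nat.shiftRight_eq_div_pow,
    Nat.shiftRight_eq_div_pow]

/-- The first `l + 1` characters of a key, as a number, are the first `l` ones and one more. -/
theorem Instance.div_pow_succ (x : ℕ) {l : ℕ} (hl : l < I.w) :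
    x / 2 ^ (I.β * (I.w - (l + 1))) =
      2 ^ I.β * (x / 2 ^ (I.β * (I.w - l))) + I.keyChar x l := by
  have e : I.β * (I.w - l) = I.β * (I.w - (l + 1)) + I.β := by
    rw [show I.w - l = I.w - (l + 1) + 1 by omega, Nat.mul_succ]
  unfold Instance.keyChar
  rw [e, pow_add, ← Nat.div_div_eq_div_mul, show I.w - 1 - l = I.w - (l + 1) by omega,
    Nat.div_add_mod]

/-- Keys agree in their first `l` characters if and only if they agree as numbers when the remaining
characters are cut off. -/
theorem Instance.keyChar_eq_iff {x y : ℕ} (hx : x < 2 ^ (I.β * I.w)) (hy : y < 2 ^ (I.β * I.w))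
    {l : ℕ} (hl : l ≤ I.w) : (∀ j < l, I.keyChar x j = I.keyChar y j) ↔
      x / 2 ^ (I.β * (I.w - l)) = y / 2 ^ (I.β * (I.w - l)) := by
  induction l with
  | zero => simp [Nat.div_eq_of_lt hx, Nat.div_eq_of_lt hy]
  | succ l ih =>
    rw [Nat.forall_lt_succ_right, ih (by omega), I.div_pow_succ x hl, I.div_pow_succ y hl]
    constructor
    · rintro ⟨h1, h2⟩
      rw [h1, h2]
    · intro h
      have hx' : I.keyChar x l < 2 ^ I.β := Nat.mod_lt _ (by positivity)
      have hy' : I.keyChar y l < 2 ^ I.β := Nat.mod_lt _ (by positivity)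
      have h1 := congrArg (· / 2 ^ I.β) h
      have h2 := congrArg (· % 2 ^ I.β) h
      simp only [Nat.mul_add_div (Nat.two_pow_pos _), Nat.div_eq_of_lt hx', Nat.div_eq_of_lt hy',
        Nat.mul_add_mod, Nat.mod_eq_of_lt hx', Nat.mod_eq_of_lt hy', add_zero] at h1 h2
      exact ⟨h1, h2⟩

/-- The longest common prefix of two keys is determined by the most significant bit in which they
differ. -/
theorem Instance.keyLcp_eq (hβ : 1 ≤ I.β) {x y : ℕ} (hx : x < 2 ^ (I.β * I.w))
    (hy : y < 2 ^ (I.β * I.w)) : I.keyLcp x y =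
      I.w - ((if 0 < x ^^^ y then 1 else 0) + Nat.log 2 (x ^^^ y) / I.β) := by
  unfold Instance.keyLcp
  rw [Nat.findGreatest_eq_iff]
  by_cases hz : x ^^^ y = 0
  · obtain rfl := Nat.xor_eq_zero_iff.1 hz
    simp
  · have hz' : 0 < x ^^^ y := Nat.pos_of_ne_zero hz
    rw [if_pos hz']
    obtain ⟨t, ht⟩ : ∃ t, t = Nat.log 2 (x ^^^ y) / I.β := ⟨_, rfl⟩
    have hlow : 2 ^ (I.β * t) ≤ x ^^^ y := by
      refine le_trans (Nat.pow_le_pow_right (by decide) ?_) (Nat.pow_log_le_self 2 hz)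
      rw [ht]
      exact Nat.mul_div_le _ _
    have hhigh : x ^^^ y < 2 ^ (I.β * (t + 1)) := by
      refine lt_of_lt_of_le (Nat.lt_pow_succ_log_self (b := 2) (by decide) _)
        (Nat.pow_le_pow_right (by decide) ?_)
      rw [ht]
      exact Nat.lt_mul_div_succ _ hβ
    have htw : t < I.w := by
      have h1 := Nat.xor_lt_two_pow hx hy
      have h2 := (Nat.pow_lt_pow_iff_right (by decide : 1 < 2)).1 (hlow.trans_lt h1)
      exact lt_of_mul_lt_mul_left h2 (Nat.zero_le _)
    rw [← ht]
    refine ⟨Nat.sub_le _ _, fun _ => ?_, fun n hn hnw => ?_⟩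
    · rw [I.keyChar_eq_iff hx hy (Nat.sub_le _ _), ← Nat.xor_eq_zero_iff, ← xor_div_two_pow,
        show I.w - (I.w - (1 + t)) = t + 1 by omega]
      exact Nat.div_eq_of_lt hhigh
    · intro h
      have h' : ∀ j < I.w - t, I.keyChar x j = I.keyChar y j := fun j hj => h j (by omega)
      rw [I.keyChar_eq_iff hx hy (Nat.sub_le _ _), ← Nat.xor_eq_zero_iff, ← xor_div_two_pow,
        show I.w - (I.w - t) = t by omega] at h'
      have := Nat.div_pos hlow (Nat.two_pow_pos _)
      omega

theorem Instance.Admissible.splitter_lt (h : I.Admissible W) (j : ℕ) :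
    I.splitter j < 2 ^ (I.β * I.w) := by
  unfold Instance.splitter
  by_cases hj : I.α * (j + 1) - 1 < I.sortedSample.length
  · rw [List.getD_eq_getElem _ _ hj]
    have := (List.mergeSort_perm _ _).subset (List.getElem_mem hj)
    obtain ⟨k, -, hk⟩ := List.mem_map.1 this
    rw [← hk]
    exact h.key_lt_pow (h.draws_lt k)
  · rw [List.getD_eq_default _ _ (not_lt.1 hj)]
    positivity

end

/-! ### Positions in the output -/

section

variable (F : ℕ → ℕ) (m : ℕ)

/-- The position of item `k < m` in the order by `F`, where items with equal values are in the order
of their numbers. -/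
def position (k : ℕ) : ℕ := Nat.count (fun k' => F k' < F k) m + Nat.count (fun k' => F k' = F k) k

theorem count_lt_succ (g : ℕ) : Nat.count (fun k => F k < g) m + Nat.count (fun k => F k = g) m =
    Nat.count (fun k => F k < g + 1) m := by
  induction m with
  | zero => simp
  | succ m ih =>
    simp only [Nat.count_succ]
    split_ifs <;> omega

/-- The prefix sums of the final counters count the items with smaller counters. -/
theorem psum_count (g : ℕ) : psum (fun f => Nat.count (fun k => F k = f) m) g =
    Nat.count (fun k => F k < g) m := by
  induction g with
  | zero => simp [psum, Nat.count_false]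
  | succ g ih =>
    rw [psum_succ, ih, count_lt_succ]

theorem count_eq_lt {k : ℕ} (hk : k < m) :
    Nat.count (fun k' => F k' = F k) k < Nat.count (fun k' => F k' = F k) m :=
  Nat.count_strict_mono (p := fun k' => F k' = F k) rfl hk

theorem count_lt_mono {g g' : ℕ} (h : g ≤ g') :
    Nat.count (fun k => F k < g) m ≤ Nat.count (fun k => F k < g') m :=
  Nat.count_mono_left fun _ _ hk => lt_of_lt_of_le hk h

theorem position_lt {k : ℕ} (hk : k < m) {g : ℕ} (hg : F k < g) :
    position F m k < Nat.count (fun k' => F k' < g) m := by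
  have h1 := count_eq_lt F m hk
  have h2 := count_lt_succ F m (F k)
  have h3 := count_lt_mono F m (Nat.succ_le_of_lt hg)
  unfold position
  simp only [Nat.succ_eq_add_one] at h3
  omega

theorem le_position {k g : ℕ} (hg : g ≤ F k) :
    Nat.count (fun k' => F k' < g) m ≤ position F m k :=
  (count_lt_mono F m hg).trans (Nat.le_add_right _ _)

theorem position_injective {k k' : ℕ} (hk : k < m) (hk' : k' < m)
    (h : position F m k = position F m k') : k = k' := by
  rcases lt_trichotomy (F k) (F k') with hF | hF | hF
  · have h1 := position_lt F m hk hF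
    have h2 := le_position F m (le_refl (F k'))
    omega
  · unfold position at h
    rw [hF] at h
    have h' : Nat.count (fun a => F a = F k') k = Nat.count (fun a => F a = F k') k' := by omega
    exact Nat.count_injective (p := fun a => F a = F k') hF rfl h'
  · have h1 := position_lt F m hk' hF
    have h2 := le_position F m (le_refl (F k))
    omega

end

/-! ### The output arrays -/

/-- Each processor moves its strings to their positions in the output. -/
def scatterCode : List Stmt :=
  forLoop 16 17 (.reg 2 / .reg 7 + 1)
    (assign 18 (.reg 16 * .reg 7 + .reg 0) ++
    (assign 19 (.reg 2 + (.load (3 * .reg 9 + (.load (4 * .reg 9 + .reg 18) * .reg 7 + .reg 0)) +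
      .load (5 * .reg 9 + .reg 18))) ++
    (assign 20 (.load (.reg 18)) ++ (put (.reg 19 + 0) (.reg 20) ++ []))))

/-- The bucket boundaries are the prefix sums up to the first counter of each bucket. -/
def boundaryCode : List Stmt :=
  parFor ((2 * .reg 3 + 2) / .reg 7 + 1) (2 * .reg 2) (.load (3 * .reg 9 + .reg 22 * .reg 7))

/-- The bits in which the splitters before and after a bucket differ. -/
abbrev splitterXor : Ex :=
  .xor (.load (.reg 13 + .reg 4 * .reg 22)) (.load (.reg 13 + .reg 4 * (.reg 22 + 1)))

/-- The longest common prefixes of the splitters, by the formula of `Instance.keyLcp_eq`, multiplied by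
`0` at both ends of the array. -/
def lcpCode : List Stmt :=
  parFor (.reg 3 / .reg 7 + 1) (2 * .reg 2 + (2 * .reg 3 + 2))
    (.lt 0 (.reg 22) * .lt (.reg 22) (.reg 3) *
      (.reg 5 - (.lt 0 splitterXor + .msb splitterXor / .reg 6)))

/-- The number of items, that is of strings and items without a string that fill the last round. -/
def Instance.items (I : Instance) (P : ℕ) : ℕ := (I.n / P + 1) * P

section

variable {p W P : ℕ} {I : Instance}

theorem Instance.items_le (I : Instance) (P : ℕ) : I.items P ≤ I.n + P := div_add_one_mul_le _ _

theorem Setup.lt_items (hS : Setup p W P I) : I.n < I.items P := lt_div_add_one_mul _ hS.one_le_P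

theorem WP.scatterCode (hS : Setup p W P I) {E R : ℕ → ℕ → ℕ} {M : ℕ → ℕ}
    {S : List Stmt} {T : ℕ} {Q : (ℕ → ℕ → ℕ) → (ℕ → ℕ) → Prop}
    (hE : Env I P E) (hR : Same P 16 E R) (hM : ∀ x < I.n, M x = I.mem x)
    (hbucket : ∀ k < I.items P, M (4 * I.stride P + k) = I.itemBucket k)
    (hrank : ∀ k < I.items P, M (5 * I.stride P + k) =
      Nat.count (fun k' => I.counter P k' = I.counter P k) k)
    (hpre : ∀ f < (2 * I.v + 2) * P, M (3 * I.stride P + f) =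
      Nat.count (fun k => I.counter P k < f) (I.items P))
    (hQ : ∀ R' M', Same P 16 E R' →
      (∀ k < I.n, M' (I.n + position (I.counter P) (I.items P) k) = I.mem k) →
      (∀ x, x < I.n ∨ I.stride P ≤ x → M' x = M x) → WP p W I P S R' M' T Q) :
    WP p W I P (scatterCode ++ S) R M (100 + (I.n / P + 1) * 100 + T) Q := by
  have b1 := hS.bound
  have b2 := hS.le_stride
  have b3 := hS.adm.one_le_v
  have b4 := hS.v_le_mul
  have b5 := hS.one_le_P
  have b6 := hS.P_le_mul
  have hitems := I.items_le P
  have hdiv : I.n / P ≤ I.n := Nat.div_le_self _ _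
  have hW : I.n / P + 1 < 2 ^ W := by
    generalize I.n / P = y at *
    omega
  have hvP : (2 * I.v + 2) * P = 2 * (P * I.v) + 2 * P := by ring
  have hpos : ∀ k < I.items P, position (I.counter P) (I.items P) k < I.items P := by
    intro k hk
    exact (position_lt _ _ hk (Nat.lt_succ_self _)).trans_le (Nat.count_le _)
  refine (WP.forLoop (T := T) (fun r R' M' => Same P 16 E R' ∧
    (∀ k < r * P, k < I.n → M' (I.n + position (I.counter P) (I.items P) k) = I.mem k) ∧
    ∀ x, x < I.n ∨ I.stride P ≤ x → M' x = M x) (I.n / P + 1) (60 + 0) hW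
    (by decide) (by decide) (by decide) rfl ?_ ?_ ?_ ?_ ?_).mono ?_ (fun _ _ h => h)
  · intro j R' M' h i hi
    have hE' := hE.same h.1
    simp only [Ex.eval_add, Ex.eval_div, Ex.eval_one, Ex.eval_reg, hE'.n i hi, hE'.procs i hi,
      Nat.add_mod_mod, Nat.mod_add_mod]
    exact Nat.mod_eq_of_lt hW
  · rintro j R' M' c hc x ⟨h1, h2⟩
    refine ⟨h1.update ?_, h2⟩
    simp at hc
    omega
  · exact ⟨hR, fun k hk => by omega, fun _ _ => rfl⟩
  · rintro r hr R' M' ⟨h1, h2, h3⟩ hRr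
    have hE' := hE.same h1
    have hrP : r * P + P ≤ I.items P := by
      have h1 := Nat.mul_le_mul_right P hr
      rwa [Nat.succ_mul] at h1
    have hctr : ∀ i < P, I.counter P (r * P + i) = I.itemBucket (r * P + i) * P + i := by
      intro i hi
      rw [Instance.counter, Nat.mul_add_mod_self_right, Nat.mod_eq_of_lt hi]
    refine WP.assign (fun i => r * P + i) (fun i hi => ?_) ?_
    · simp only [Ex.eval_add, Ex.eval_mul, Ex.eval_reg, hRr i hi, hE'.procs i hi, hE'.id i hi,
        Nat.mod_add_mod]
      exact Nat.mod_eq_of_lt (by omega)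
    refine WP.assign (fun i => I.n + position (I.counter P) (I.items P) (r * P + i)) (fun i hi => ?_) ?_
    · have hcl := I.counter_lt b5 (r * P + i)
      have hp := hpos (r * P + i) (by omega)
      simp only [Ex.eval_add, Ex.eval_mul, Ex.eval_load, Ex.eval_three, Ex.eval_four, Ex.eval_five,
        Ex.eval_reg, Function.update_apply, Nat.reduceEqDiff, reduceIte, hE'.D i hi, hE'.n i hi,
        hE'.procs i hi, hE'.id i hi, Nat.mod_mul_mod, Nat.mod_add_mod, Nat.add_mod_mod]
      rw [Nat.mod_eq_of_lt (a := 4 * _ + _) (b := 2 ^ W) (by omega),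
        Nat.mod_eq_of_lt (a := 5 * _ + _) (b := 2 ^ W) (by omega), h3 (4 * _ + _) (Or.inr (by omega)),
        h3 (5 * _ + _) (Or.inr (by omega)), hbucket _ (by omega), hrank _ (by omega), ← hctr i hi,
        Nat.mod_eq_of_lt (a := 3 * _ + _) (b := 2 ^ W) (by omega), h3 _ (Or.inr (by omega)),
        hpre _ hcl]
      exact Nat.mod_eq_of_lt (by change I.n + position (I.counter P) (I.items P) (r * P + i) < _; omega)
    refine WP.assign (fun i => M' (r * P + i)) (fun i hi => ?_) ?_
    · simp only [Ex.eval_load, Ex.eval_reg, Function.update_apply, Nat.reduceEqDiff, reduceIte]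
    refine WP.put hS.P_le (fun i => I.n + position (I.counter P) (I.items P) (r * P + i))
      (fun i => M' (r * P + i)) (fun i hi => ?_) (fun i hi => ?_) (fun i hi j hj hij => ?_) ?_
    · have hp := hpos (r * P + i) (by omega)
      simp only [Ex.eval_add, Ex.eval_zero, Ex.eval_reg, Function.update_apply, Nat.reduceEqDiff,
        reduceIte, Nat.zero_mod, add_zero]
      exact Nat.mod_eq_of_lt (by omega)
    · simp only [Ex.eval_reg, Function.update_apply, reduceIte]
    · have := position_injective (I.counter P) (I.items P) (k := r * P + i) (k' := r * P + j)
        (by omega) (by omega) (by omega)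
      omega
    intro M₁ hM1 hM1'
    refine WP.nil ⟨⟨?_, fun k hk hkn => ?_, fun x hx => ?_⟩, fun i hi => ?_⟩
    · repeat refine Same.update (by decide) ?_
      exact h1
    · rw [Nat.succ_mul] at hk
      by_cases hkr : k < r * P
      · rw [hM1' _ fun i hi hh => ?_]
        · exact h2 k hkr hkn
        · have := position_injective (I.counter P) (I.items P) (k := r * P + i) (k' := k)
            (by omega) (by omega) (by omega)
          omega
      · obtain ⟨i, rfl⟩ := Nat.exists_eq_add_of_le (not_lt.1 hkr)
        rw [hM1 i (by omega), h3 _ (Or.inl hkn), hM _ hkn]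
    · rw [hM1' _ fun i hi => ?_]
      · exact h3 x hx
      · have hp := hpos (r * P + i) (by omega)
        omega
    · simp only [Function.update_apply, Nat.reduceEqDiff, reduceIte, hRr i hi]
  · rintro R' M' ⟨h1, h2, h3⟩
    exact hQ R' M' h1 (fun k hk => h2 k (hk.trans hS.lt_items) hk) h3
  · change 3 + 3 + (I.n / P + 1) * (60 + 0 + 3 + 4) + T ≤ _
    generalize I.n / P + 1 = y
    omega

theorem WP.boundaryCode (hS : Setup p W P I) {E R : ℕ → ℕ → ℕ} {M : ℕ → ℕ}
    {S : List Stmt} {T : ℕ} {Q : (ℕ → ℕ → ℕ) → (ℕ → ℕ) → Prop} {g : ℕ → ℕ}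
    (hE : Env I P E) (hR : Same P 16 E R)
    (hpre : ∀ f < (2 * I.v + 2) * P, M (3 * I.stride P + f) = g f)
    (hQ : ∀ R' M', Same P 16 E R' → (∀ k < 2 * I.v + 2, M' (2 * I.n + k) = g (k * P)) →
      (∀ x, x < 2 * I.n ∨ I.stride P ≤ x → M' x = M x) → WP p W I P S R' M' T Q) :
    WP p W I P (boundaryCode ++ S) R M (100 + (2 * I.v + 3) * 100 + T) Q := by
  have b1 := hS.bound
  have b2 := hS.le_stride
  have b4 := hS.v_le_mul
  have b5 := hS.one_le_P
  have b6 := hS.P_le_mul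
  have hvP : (2 * I.v + 2) * P = 2 * (P * I.v) + 2 * P := by ring
  have h3 := div_add_one_mul_le (2 * I.v + 2) P
  have h9 : (2 * I.v + 2) / P ≤ 2 * I.v + 2 := Nat.div_le_self _ _
  have hcW : (2 * I.v + 2) / P + 1 < 2 ^ W := by
    generalize (2 * I.v + 2) / P = y at *
    omega
  refine (WP.parFor (T := T) hS ((2 * I.v + 2) / P + 1) (2 * I.n) (2 * I.v + 2) (fun k => g (k * P)) hE hR
    (lt_div_add_one_mul _ b5).le (by omega) (fun M R hR i hi => ?_) (fun M R hR i hi => ?_) ?_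
    (fun R' M' a b c => hQ R' M' a b fun x hx => c x (by omega))).mono ?_ (fun _ _ h => h)
  · have hE' := hE.same hR
    simp only [Ex.eval_add, Ex.eval_mul, Ex.eval_div, Ex.eval_one, Ex.eval_two, Ex.eval_reg, hE'.v i hi,
      hE'.procs i hi, Nat.mod_add_mod, Nat.add_mod_mod, Nat.mod_mul_mod]
    rw [Nat.mod_eq_of_lt (a := 2 * I.v + 2) (b := 2 ^ W) (by omega)]
    exact Nat.mod_eq_of_lt hcW
  · have hE' := hE.same hR
    simp only [Ex.eval_mul, Ex.eval_two, Ex.eval_reg, hE'.n i hi, Nat.mod_mul_mod]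
    exact Nat.mod_eq_of_lt (by omega)
  · intro M' R hM' hR i hi hk
    have hE' := hE.same hR
    have hkP : R i 22 * P + P ≤ (2 * I.v + 2) * P := by
      have := Nat.mul_le_mul_right P hk
      rwa [Nat.succ_mul] at this
    simp only [Ex.eval_add, Ex.eval_mul, Ex.eval_load, Ex.eval_three, Ex.eval_reg, hE'.D i hi, hE'.procs i hi,
      Nat.mod_mul_mod, Nat.mod_add_mod, Nat.add_mod_mod]
    rw [Nat.mod_eq_of_lt (by omega), hM' _ (Or.inr (by omega)), hpre _ (by omega)]
  · change 7 + 3 + ((2 * I.v + 2) / P + 1) * (2 + 5 + 4 + 7 + 4) + T ≤ _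
    generalize (2 * I.v + 2) / P = y at *
    omega

theorem WP.lcpCode (hS : Setup p W P I) {E R : ℕ → ℕ → ℕ} {M : ℕ → ℕ} {X : ℕ}
    {S : List Stmt} {T : ℕ} {Q : (ℕ → ℕ → ℕ) → (ℕ → ℕ) → Prop}
    (hE : Env I P E) (h13 : ∀ i < P, E i 13 = X) (hX : Splitters I P X M) (hR : Same P 16 E R)
    (hQ : ∀ R' M', Same P 16 E R' →
      (∀ k < I.v + 1, M' (2 * I.n + (2 * I.v + 2) + k) = I.splitterLcp k) →
      (∀ x, x < 2 * I.n + (2 * I.v + 2) → M' x = M x) → WP p W I P S R' M' T Q) :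
    WP p W I P (lcpCode ++ S) R M (100 + (I.v + 1) * 100 + T) Q := by
  have b1 := hS.bound
  have b2 := hS.le_stride
  have b3 := hS.adm.one_le_v
  have b4 := hS.v_le_mul
  have b5 := hS.one_le_P
  have b6 := hS.P_le_mul
  have h3 := div_add_one_mul_le I.v P
  have h9 : I.v / P ≤ I.v := Nat.div_le_self _ _
  have hcW : I.v / P + 1 < 2 ^ W := by
    generalize I.v / P = y at *
    omega
  refine (WP.parFor (T := T) hS (I.v / P + 1) (2 * I.n + (2 * I.v + 2)) (I.v + 1) I.splitterLcp hE hR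
    (lt_div_add_one_mul _ b5) (by omega) (fun M R hR i hi => ?_) (fun M R hR i hi => ?_) ?_
    (fun R' M' a b c => hQ R' M' a b fun x hx => c x (by omega))).mono ?_ (fun _ _ h => h)
  · have hE' := hE.same hR
    simp only [Ex.eval_add, Ex.eval_div, Ex.eval_one, Ex.eval_reg, hE'.v i hi,
      hE'.procs i hi, Nat.mod_add_mod, Nat.add_mod_mod]
    exact Nat.mod_eq_of_lt hcW
  · have hE' := hE.same hR
    simp only [Ex.eval_add, Ex.eval_mul, Ex.eval_two, Ex.eval_reg, hE'.n i hi, hE'.v i hi,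
      Nat.mod_add_mod, Nat.add_mod_mod, Nat.mod_mul_mod]
    exact Nat.mod_eq_of_lt (by omega)
  · intro M' R hM' hR i hi hk
    have hE' := hE.same hR
    have hXM : Splitters I P X M' := hX.congr fun x hx _ => hM' x (Or.inr (by omega))
    have g13 : R i 13 = X := (hR i hi 13 (by decide)).trans (h13 i hi)
    simp only [Ex.eval_add, Ex.eval_sub, Ex.eval_mul, Ex.eval_div, Ex.eval_lt, Ex.eval_xor, Ex.eval_msb,
      Ex.eval_load, Ex.eval_zero, Ex.eval_one, Ex.eval_reg, g13, hE'.v i hi, hE'.α i hi, hE'.w i hi,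
      hE'.β i hi, Nat.zero_mod, Nat.mul_mod_mod, Nat.mod_mul_mod, Nat.add_mod_mod, Nat.mod_add_mod]
    unfold Instance.splitterLcp
    by_cases hk0 : 0 < R i 22
    · by_cases hkv : R i 22 < I.v
      · rw [if_neg (show ¬(R i 22 = 0 ∨ I.v ≤ R i 22) by omega)]
        simp only [hk0, hkv, if_true]
        obtain ⟨k, hkk⟩ := Nat.exists_eq_add_of_le' hk0
        rw [hkk] at hkv ⊢
        have r1 := hXM.range k (by omega)
        have r2 := hXM.range (k + 1) hkv
        have s1 := hS.adm.splitter_lt k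
        have s2 := hS.adm.splitter_lt (k + 1)
        have hβ := hS.adm.one_le_β
        have hβw : I.β * I.w < 2 ^ W := lt_of_le_of_lt hS.adm.key_fits Nat.lt_two_pow_self
        have hw : I.w < 2 ^ W := lt_of_le_of_lt (Nat.le_mul_of_pos_left _ hβ) hβw
        have hz := Nat.xor_lt_two_pow s1 s2
        have hz' : I.splitter k ^^^ I.splitter (k + 1) < 2 ^ W :=
          hz.trans_le (Nat.pow_le_pow_right (by decide) hS.adm.key_fits)
        have hlog : Nat.log 2 (I.splitter k ^^^ I.splitter (k + 1)) / I.β < I.w := by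
          rw [Nat.div_lt_iff_lt_mul hβ, mul_comm]
          have hpos : 0 < I.β * I.w := Nat.mul_pos hβ hS.adm.one_le_w
          exact Nat.log_lt_of_lt_pow' (by omega) hz
        rw [Nat.add_sub_cancel, I.keyLcp_eq hβ s1 s2,
          Nat.mod_eq_of_lt (a := X + I.α * (k + 1)) (b := 2 ^ W) (by omega),
          Nat.mod_eq_of_lt (a := X + I.α * (k + 1 + 1)) (b := 2 ^ W) (by omega), hXM.eq k (by omega),
          hXM.eq (k + 1) hkv, Nat.mod_eq_of_lt hz']
        rw [Nat.mod_eq_of_lt (a := _ + Nat.log 2 _ / I.β) (b := 2 ^ W) (by split_ifs <;> omega), one_mul, one_mul]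
        exact Nat.mod_eq_of_lt (lt_of_le_of_lt (Nat.sub_le _ _) hw)
      · rw [if_pos (show R i 22 = 0 ∨ I.v ≤ R i 22 by omega)]
        simp [hkv]
    · rw [if_pos (show R i 22 = 0 ∨ I.v ≤ R i 22 by omega)]
      simp [hk0]
  · change 3 + 3 + (I.v / P + 1) * (7 + 29 + 4 + 3 + 4) + T ≤ _
    generalize I.v / P = y at *
    omega

end

/-! ### Keys and the order of strings -/

section

variable {W : ℕ} {I : Instance}

theorem sum_digits_succ (β : ℕ) (f : ℕ → ℕ) (w : ℕ) :
    ∑ j ∈ Finset.range (w + 1), f j * 2 ^ (β * (w + 1 - 1 - j)) =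
      2 ^ β * ∑ j ∈ Finset.range w, f j * 2 ^ (β * (w - 1 - j)) + f w := by
  rw [Finset.sum_range_succ, Finset.mul_sum]
  congr 1
  · refine Finset.sum_congr rfl fun j hj => ?_
    rw [Finset.mem_range] at hj
    rw [show w + 1 - 1 - j = (w - 1 - j) + 1 by omega, Nat.mul_succ, pow_add]
    ring
  · simp

/-- The digits of a number can be recovered from it. -/
theorem digit_sum_digits (β : ℕ) (f : ℕ → ℕ) (hf : ∀ j, f j < 2 ^ β) {w i : ℕ} (hi : i < w) :
    (∑ j ∈ Finset.range w, f j * 2 ^ (β * (w - 1 - j))) / 2 ^ (β * (w - 1 - i)) % 2 ^ β = f i := by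
  induction w with
  | zero => omega
  | succ w ih =>
    rw [sum_digits_succ]
    rcases Nat.lt_succ_iff_lt_or_eq.1 hi with h | rfl
    · rw [show w + 1 - 1 - i = (w - 1 - i) + 1 by omega, Nat.mul_succ, pow_add,
        mul_comm (2 ^ (β * (w - 1 - i))), ← Nat.div_div_eq_div_mul, Nat.mul_add_div (Nat.two_pow_pos _),
        Nat.div_eq_of_lt (hf w), add_zero, ih h]
    · simp [Nat.mod_eq_of_lt (hf i)]

/-- If two numbers with `w` digits differ, then the smaller one has the smaller digit in the first
place where they differ. -/
theorem exists_digit_lt (β : ℕ) (f g : ℕ → ℕ) (hf : ∀ j, f j < 2 ^ β) (hg : ∀ j, g j < 2 ^ β) (w : ℕ)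
    (h : ∑ j ∈ Finset.range w, f j * 2 ^ (β * (w - 1 - j)) <
      ∑ j ∈ Finset.range w, g j * 2 ^ (β * (w - 1 - j))) :
    ∃ i < w, (∀ j < i, f j = g j) ∧ f i < g i := by
  induction w with
  | zero => simp at h
  | succ w ih =>
    rw [sum_digits_succ, sum_digits_succ] at h
    rcases lt_trichotomy (∑ j ∈ Finset.range w, f j * 2 ^ (β * (w - 1 - j)))
      (∑ j ∈ Finset.range w, g j * 2 ^ (β * (w - 1 - j))) with hlt | heq | hgt
    · obtain ⟨i, hi, h1⟩ := ih hlt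
      exact ⟨i, by omega, h1⟩
    · refine ⟨w, by omega, fun j hj => ?_, by rw [heq] at h; omega⟩
      rw [← digit_sum_digits β f hf hj, heq, digit_sum_digits β g hg hj]
    · have h1 := Nat.mul_le_mul_left (2 ^ β) (Nat.succ_le_of_lt hgt)
      have h2 := hg w
      rw [Nat.mul_succ] at h1
      omega

/-- The lexicographic order is decided by the first difference, also if that lies behind the end of
the smaller string. -/
theorem lt_of_getD_lt {k : ℕ} {s t : List ℕ} (hs : ∀ c ∈ s, 0 < c) (hst : CommonPrefix k s t)
    (h : s.getD k 0 < t.getD k 0) : s < t := by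
  induction k generalizing s t with
  | zero =>
    cases t with
    | nil => simp at h
    | cons b t =>
      cases s with
      | nil => exact List.nil_lt_cons _ _
      | cons a s => exact List.cons_lt_cons_iff.2 (Or.inl (by simpa using h))
  | succ k ih =>
    cases t with
    | nil => simp at h
    | cons b t =>
      cases s with
      | nil => exact List.nil_lt_cons _ _
      | cons a s =>
        have h0 : a = b := by simpa using hst 0 (by omega)
        refine List.cons_lt_cons_iff.2 (Or.inr ⟨h0, ih (fun c hc => hs c (by simp [hc])) ?_ ?_⟩)
        · intro j hj
          simpa using hst (j + 1) (by omega)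
        · simpa using h

theorem Instance.Admissible.keyChar_key (h : I.Admissible W) {k : ℕ} (hk : k < I.n) {j : ℕ}
    (hj : j < I.w) : I.keyChar (I.key (I.input k)) j = (I.input k).getD (I.h + j) 0 :=
  digit_sum_digits I.β (fun j => (I.input k).getD (I.h + j) 0) (fun _ => h.getD_lt hk _) hj

/-- Keys are ordered like the strings that they come from, since these have a common prefix. -/
theorem Instance.Admissible.lt_of_key_lt (h : I.Admissible W) {k k' : ℕ} (hk : k < I.n)
    (hk' : k' < I.n) (hkey : I.key (I.input k) < I.key (I.input k')) : I.input k < I.input k' := by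
  obtain ⟨i, -, h1, h2⟩ := exists_digit_lt I.β (fun j => (I.input k).getD (I.h + j) 0)
    (fun j => (I.input k').getD (I.h + j) 0) (fun _ => h.getD_lt hk _) (fun _ => h.getD_lt hk' _) I.w hkey
  refine lt_of_getD_lt (k := I.h + i) (fun c hc => (h.char_range k hk c hc).1) (fun j hj => ?_) h2
  by_cases hjh : j < I.h
  · exact h.common_prefix k hk k' hk' j hjh
  · have := h1 (j - I.h) (by omega)
    simpa [Nat.add_sub_cancel' (not_lt.1 hjh)] using this

theorem Instance.Admissible.commonPrefix (h : I.Admissible W) {k k' : ℕ} (hk : k < I.n)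
    (hk' : k' < I.n) {l : ℕ} (hl : l ≤ I.w)
    (hkey : ∀ j < l, I.keyChar (I.key (I.input k)) j = I.keyChar (I.key (I.input k')) j) :
    CommonPrefix (I.h + l) (I.input k) (I.input k') := by
  intro j hj
  by_cases hjh : j < I.h
  · exact h.common_prefix k hk k' hk' j hjh
  · have := hkey (j - I.h) (by omega)
    rwa [h.keyChar_key hk (by omega), h.keyChar_key hk' (by omega),
      Nat.add_sub_cancel' (not_lt.1 hjh)] at this

/-! ### The leaves of the classification tree -/

theorem Instance.sortedSample_length : I.sortedSample.length = I.sampleSize := by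
  simp [Instance.sortedSample]

theorem Instance.Admissible.splitter_mono (h : I.Admissible W) {j j' : ℕ} (hjj : j ≤ j')
    (hj' : j' < I.v) : I.splitter j ≤ I.splitter j' := by
  have h1 : I.α * (j' + 1) ≤ I.α * I.v := Nat.mul_le_mul_left _ hj'
  have h2 : I.α * (j + 1) ≤ I.α * (j' + 1) := Nat.mul_le_mul_left _ (by omega)
  have h3 : 1 ≤ I.α * (j + 1) := Nat.mul_pos h.one_le_α (Nat.succ_pos _)
  have h4 := h.sampleSize_add_one
  have h5 := h.one_le_α
  rw [Nat.mul_add] at h4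
  have hl := I.sortedSample_length
  have hs : I.sortedSample.Pairwise (· ≤ ·) := List.pairwise_mergeSort' _ _
  unfold Instance.splitter
  rw [List.getD_eq_getElem _ _ (by omega), List.getD_eq_getElem _ _ (by omega)]
  exact hs.rel_get_of_le (a := ⟨_, by omega⟩) (b := ⟨_, by omega⟩) (by
    simp only [Fin.mk_le_mk]
    omega)

/-- The descent is a binary search: the splitters before the current subtree are smaller than the
key, and the splitters after it are not. -/
theorem Instance.Admissible.offset_spec (h : I.Admissible W) (c : ℕ) {l : ℕ} (hl : l ≤ I.d) :
    (∀ j < I.offset c l, I.splitter j < c) ∧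
      ∀ j, I.offset c l + 2 ^ (I.d - l) ≤ j + 1 → j < I.v → c ≤ I.splitter j := by
  induction l with
  | zero =>
    rw [I.offset_zero, Nat.sub_zero, ← I.v_add_one]
    exact ⟨fun j hj => by omega, fun j hj hj' => by omega⟩
  | succ l ih =>
    obtain ⟨h1, h2⟩ := ih (by omega)
    have h3 := I.offset_le c (l := l) (by omega)
    rw [I.offset_succ c (by omega), show I.d - (l + 1) = I.d - 1 - l by omega]
    rw [show I.d - l = I.d - 1 - l + 1 by omega, pow_succ] at h2 h3
    have hpos : 0 < 2 ^ (I.d - 1 - l) := Nat.two_pow_pos _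
    generalize 2 ^ (I.d - 1 - l) = y at *
    split_ifs with hc
    · refine ⟨fun j hj => ?_, fun j hj hj' => h2 j (by omega) hj'⟩
      exact (h.splitter_mono (by omega) (by omega)).trans_lt hc
    · refine ⟨fun j hj => h1 j (by omega), fun j hj hj' => ?_⟩
      exact (not_lt.1 hc).trans (h.splitter_mono (by omega) hj')

theorem Instance.Admissible.splitter_lt_of_lt_leaf (h : I.Admissible W) {c j : ℕ} (hj : j < I.leaf c) :
    I.splitter j < c :=
  (h.offset_spec c le_rfl).1 j (by rwa [I.offset_d])

theorem Instance.Admissible.le_splitter_of_leaf_le (h : I.Admissible W) {c j : ℕ} (hj : I.leaf c ≤ j)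
    (hjv : j < I.v) : c ≤ I.splitter j :=
  (h.offset_spec c le_rfl).2 j (by rw [I.offset_d, Nat.sub_self]; simpa using hj) hjv

theorem Instance.Admissible.key_lt_of_bucket_lt (h : I.Admissible W) {s t : List ℕ}
    (hst : I.bucket s < I.bucket t) : I.key s < I.key t := by
  unfold Instance.bucket at hst
  simp only at hst
  rcases lt_trichotomy (I.leaf (I.key s)) (I.leaf (I.key t)) with hl | hl | hl
  · exact (h.le_splitter_of_leaf_le le_rfl (hl.trans_le (I.leaf_le _))).trans_lt
      (h.splitter_lt_of_lt_leaf hl)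
  · rw [← hl] at hst
    split_ifs at hst with h1 h2 h2
    all_goals try omega
    have h3 := h.le_splitter_of_leaf_le (c := I.key s) le_rfl h2.1
    have h4 : I.splitter (I.leaf (I.key s)) ≠ I.key s := fun h5 => h1 ⟨h2.1, h5⟩
    omega
  · exfalso
    split_ifs at hst <;> omega

theorem Instance.leaf_of_bucket_even {s : List ℕ} {i : ℕ} (h : I.bucket s = 2 * i) :
    I.leaf (I.key s) = i := by
  unfold Instance.bucket at h
  simp only at h
  split_ifs at h <;> omega

theorem Instance.key_of_bucket_odd {s : List ℕ} {i : ℕ} (h : I.bucket s = 2 * i + 1) :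
    I.key s = I.splitter i := by
  unfold Instance.bucket at h
  simp only at h
  split_ifs at h with h1
  · obtain rfl : I.leaf (I.key s) = i := by omega
    exact h1.2.symm
  · omega

theorem Instance.keyLcp_spec (x y : ℕ) :
    I.keyLcp x y ≤ I.w ∧ ∀ j < I.keyLcp x y, I.keyChar x j = I.keyChar y j :=
  ⟨Nat.findGreatest_le _, Nat.findGreatest_spec (P := fun l => ∀ j < l, I.keyChar x j = I.keyChar y j)
    (m := 0) (Nat.zero_le _) (fun j hj => by omega)⟩

/-- Keys between two splitters share the common prefix of the splitters. -/
theorem Instance.Admissible.keyChar_eq_of_between (h : I.Admissible W) {i i' x j : ℕ}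
    (h1 : I.splitter i ≤ x) (h2 : x ≤ I.splitter i')
    (hj : j < I.keyLcp (I.splitter i) (I.splitter i')) : I.keyChar x j = I.keyChar (I.splitter i) j := by
  obtain ⟨hl, hs⟩ := I.keyLcp_spec (I.splitter i) (I.splitter i')
  have a1 := h.splitter_lt i
  have a2 := h.splitter_lt i'
  rw [I.keyChar_eq_iff a1 a2 hl] at hs
  refine (I.keyChar_eq_iff (h2.trans_lt a2) a1 hl).2 (le_antisymm ?_ (Nat.div_le_div_right h1)) j hj
  rw [hs]
  exact Nat.div_le_div_right h2

/-! ### Correctness of the output -/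

theorem Instance.counter_lt_iff {P : ℕ} (hP : 1 ≤ P) (k i : ℕ) :
    I.counter P k < i * P ↔ I.itemBucket k < i := by
  have h := Nat.mod_lt k hP
  unfold Instance.counter
  constructor
  · intro h1
    by_contra h2
    have := Nat.mul_le_mul_right P (not_lt.1 h2)
    omega
  · intro h1
    have := Nat.mul_le_mul_right P (Nat.succ_le_of_lt h1)
    rw [Nat.succ_mul] at this
    omega

/-- The items without a string lie in a bucket behind all others, so that they do not affect the
bucket boundaries. -/
theorem Instance.count_counter_lt {P : ℕ} (hP : 1 ≤ P) {i : ℕ} (hi : i ≤ 2 * I.v + 1) :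
    Nat.count (fun k => I.counter P k < i * P) (I.items P) = I.boundary i := by
  have hn : I.n < I.items P := lt_div_add_one_mul _ hP
  rw [Nat.count_eq_card_filter_range]
  unfold Instance.boundary
  congr 1
  ext k
  simp only [Finset.mem_filter, Finset.mem_range, I.counter_lt_iff hP]
  unfold Instance.itemBucket
  split_ifs with hk <;> omega

theorem Instance.boundary_last : I.boundary (2 * I.v + 1) = I.n := by
  unfold Instance.boundary
  rw [Finset.filter_true_of_mem fun j _ => Nat.lt_succ_of_le (I.bucket_le _), Finset.card_range]

/-- The positions of the strings of bucket `i` are exactly those between two boundaries: they lie there,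
they are distinct, and their number is the difference of the boundaries. -/
theorem Instance.Ico_boundary {P : ℕ} (hP : 1 ≤ P) {i : ℕ} (hi : i ≤ 2 * I.v) :
    Finset.Ico (I.boundary i) (I.boundary (i + 1)) =
      ((Finset.range I.n).filter fun j => I.bucket (I.input j) = i).image
        (position (I.counter P) (I.items P)) := by
  have hn : I.n < I.items P := lt_div_add_one_mul _ hP
  symm
  refine Finset.eq_of_subset_of_card_le ?_ ?_
  · intro j hj
    obtain ⟨k, hk, rfl⟩ := Finset.mem_image.1 hj
    rw [Finset.mem_filter, Finset.mem_range] at hk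
    have hb : I.itemBucket k = i := by
      unfold Instance.itemBucket
      rw [if_pos hk.1, hk.2]
    rw [Finset.mem_Ico, ← I.count_counter_lt hP (i := i) (by omega), ← I.count_counter_lt hP (by omega)]
    refine ⟨le_position _ _ (not_lt.1 fun h => ?_), position_lt _ _ (by omega) ?_⟩
    · have := (I.counter_lt_iff hP k i).1 h
      omega
    · rw [I.counter_lt_iff hP]
      omega
  · rw [Finset.card_image_of_injOn]
    · rw [Nat.card_Ico, Nat.sub_le_iff_le_add]
      unfold Instance.boundary
      refine (Finset.card_le_card fun k hk => ?_).trans (Finset.card_union_le _ _)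
      simp only [Finset.mem_union, Finset.mem_filter] at hk ⊢
      rcases Nat.lt_succ_iff_lt_or_eq.1 hk.2 with h | h
      · exact Or.inr ⟨hk.1, h⟩
      · exact Or.inl ⟨hk.1, h⟩
    · intro k hk k' hk' hkk
      simp only [Finset.coe_filter, Finset.mem_range, Set.mem_ofPred_eq] at hk hk'
      exact position_injective _ _ (by omega) (by omega) hkk

/-- Strings that are moved to their positions in the order by counters are partitioned into the
buckets. -/
theorem Instance.Admissible.output (h : I.Admissible W) {P : ℕ} (hP : 1 ≤ P) {M : ℕ → ℕ}
    (hpos : ∀ k < I.n, M (I.n + position (I.counter P) (I.items P) k) = I.mem k)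
    (hbound : ∀ i ≤ 2 * I.v + 1, M (2 * I.n + i) =
      Nat.count (fun k => I.counter P k < i * P) (I.items P))
    (hlcp : ∀ i ≤ I.v, M (2 * I.n + (2 * I.v + 2) + i) = I.splitterLcp i) : I.Output M := by
  have hb : ∀ i ≤ 2 * I.v + 1, M (2 * I.n + i) = I.boundary i := fun i hi =>
    (hbound i hi).trans (I.count_counter_lt hP hi)
  have hmem : ∀ i ≤ 2 * I.v, ∀ j ∈ Finset.Ico (M (2 * I.n + i)) (M (2 * I.n + (i + 1))),
      ∃ k < I.n, I.bucket (I.input k) = i ∧ I.str (M (I.n + j)) = I.input k := by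
    intro i hi j hj
    rw [hb i (by omega), hb (i + 1) (by omega), I.Ico_boundary hP hi] at hj
    obtain ⟨k, hk, rfl⟩ := Finset.mem_image.1 hj
    rw [Finset.mem_filter, Finset.mem_range] at hk
    exact ⟨k, hk.1, hk.2, by rw [hpos k hk.1]; rfl⟩
  refine ⟨hb, hlcp, (hb _ le_rfl).trans I.boundary_last, fun i hi => ?_,
    fun i i' hii hi' j hj j' hj' => ?_, fun i hi j hj j' hj' => ?_, fun i hi j hj j' hj' => ?_⟩
  · have hn : I.n < I.items P := lt_div_add_one_mul _ hP
    rw [hb i (by omega), hb (i + 1) (by omega), I.Ico_boundary hP hi, Finset.image_val_of_injOn,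
      Multiset.map_map]
    · refine Multiset.map_congr rfl fun k hk => ?_
      rw [Finset.mem_val, Finset.mem_filter, Finset.mem_range] at hk
      exact hpos k hk.1
    · intro k hk k' hk' hkk
      simp only [Finset.coe_filter, Finset.mem_range, Set.mem_ofPred_eq] at hk hk'
      exact position_injective _ _ (by omega) (by omega) hkk
  · obtain ⟨k, hk, hki, hs⟩ := hmem i (by omega) j hj
    obtain ⟨k', hk', hki', hs'⟩ := hmem i' hi' j' hj'
    rw [hs, hs']
    exact h.lt_of_key_lt hk hk' (h.key_lt_of_bucket_lt (by omega))
  · obtain ⟨k, hk, hki, hs⟩ := hmem (2 * i) (by omega) j hj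
    obtain ⟨k', hk', hki', hs'⟩ := hmem (2 * i) (by omega) j' hj'
    rw [hs, hs', hlcp i hi]
    have hl := I.leaf_of_bucket_even hki
    have hl' := I.leaf_of_bucket_even hki'
    unfold Instance.splitterLcp
    split_ifs with hi0
    · exact h.common_prefix k hk k' hk'
    · have between : ∀ c, I.leaf c = i → I.splitter (i - 1) ≤ c ∧ c ≤ I.splitter i := fun c hc =>
        ⟨(h.splitter_lt_of_lt_leaf (by omega)).le, h.le_splitter_of_leaf_le hc.le (by omega)⟩
      refine h.commonPrefix hk hk' (I.keyLcp_spec _ _).1 fun l hl1 => ?_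
      rw [h.keyChar_eq_of_between (between _ hl).1 (between _ hl).2 hl1,
        h.keyChar_eq_of_between (between _ hl').1 (between _ hl').2 hl1]
  · obtain ⟨k, hk, hki, hs⟩ := hmem (2 * i + 1) (by omega) j hj
    obtain ⟨k', hk', hki', hs'⟩ := hmem (2 * i + 1) (by omega) j' hj'
    rw [hs, hs']
    refine h.commonPrefix hk hk' le_rfl fun l _ => ?_
    rw [I.key_of_bucket_odd hki, I.key_of_bucket_odd hki']

end

/-! ### The program -/

section

variable {p W P : ℕ} {I : Instance}

/-- The number of processors that take part. The others halt at once: with more processors the time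
would decrease by a constant factor at most, but the work would exceed its bound, since every
processor takes part in the `log p` rounds of the summation over the processors. -/
def Instance.procs (I : Instance) (p : ℕ) : ℕ :=
  min p (I.n / ((Nat.log 2 p + 1) / I.d + 1) + 1)

/-- Register `7` gets the number of processors that take part, register `8` gets the value `1` in these
processors and `0` in the others. -/
def procsCode : List Stmt :=
  assign 7 ((.msb (.reg 1) + 1) / (.msb (.reg 3) + 1) + 1) ++
  (assign 7 (.reg 2 / .reg 7 + 1) ++
  (assign 8 (.lt (.reg 7) (.reg 1)) ++
  (assign 7 (.reg 8 * .reg 7 + (1 - .reg 8) * .reg 1) ++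
  (assign 8 (.lt (.reg 0) (.reg 7)) ++ []))))

theorem WP.procsCode (h : I.Admissible W) (hp : 2 * (I.n + p) < 2 ^ W) {M : ℕ → ℕ} :
    WP p W I p procsCode (fun i => initRegs p I i) M (50 + 0) fun R' M' =>
      M' = M ∧ ∀ i < p, (∀ r < 7, R' i r = initRegs p I i r) ∧ R' i 7 = I.procs p ∧
        R' i 8 = if i < I.procs p then 1 else 0 := by
  have hv := h.one_le_v
  have hvn := h.v_le_n
  have hlp : Nat.log 2 p ≤ p := Nat.log_le_self 2 p
  have hd := h.log_v
  have hd1 : I.d ≤ I.v := by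
    have := Nat.log_lt_self 2 (show I.v ≠ 0 by omega)
    omega
  have m1 : 1 % 2 ^ W = 1 := Nat.mod_eq_of_lt (by omega)
  have hq : (Nat.log 2 p + 1) / I.d ≤ Nat.log 2 p + 1 := Nat.div_le_self _ _
  have hx : I.n / ((Nat.log 2 p + 1) / I.d + 1) + 1 ≤ I.n + 1 := Nat.succ_le_succ (Nat.div_le_self _ _)
  have hproc : I.procs p =
      if I.n / ((Nat.log 2 p + 1) / I.d + 1) + 1 < p then I.n / ((Nat.log 2 p + 1) / I.d + 1) + 1 else p := by
    unfold Instance.procs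
    split_ifs <;> omega
  rw [hproc]
  generalize hqq : (Nat.log 2 p + 1) / I.d = q at *
  generalize hxx : I.n / (q + 1) + 1 = x at *
  unfold S5.procsCode
  refine WP.assign (fun i => q + 1) (fun i hi => ?_) ?_
  · simp only [Ex.eval_add, Ex.eval_div, Ex.eval_msb, Ex.eval_one, Ex.eval_reg, Nat.add_mod_mod,
      Nat.mod_add_mod]
    change ((Nat.log 2 p + 1) % 2 ^ W / ((Nat.log 2 I.v + 1) % 2 ^ W) + 1) % 2 ^ W = _
    rw [hd, Nat.mod_eq_of_lt (a := I.d) (b := 2 ^ W) (by omega),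
      Nat.mod_eq_of_lt (a := Nat.log 2 p + 1) (b := 2 ^ W) (by omega), hqq]
    exact Nat.mod_eq_of_lt (by omega)
  refine WP.assign (fun i => x) (fun i hi => ?_) ?_
  · simp only [Ex.eval_add, Ex.eval_div, Ex.eval_one, Ex.eval_reg, Function.update_apply,
      Nat.reduceEqDiff, reduceIte, Nat.add_mod_mod, Nat.mod_add_mod]
    change (I.n / (q + 1) + 1) % 2 ^ W = _
    rw [hxx]
    exact Nat.mod_eq_of_lt (by omega)
  refine WP.assign (fun i => if x < p then 1 else 0) (fun i hi => ?_) ?_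
  · simp only [Ex.eval_lt, Ex.eval_reg, Function.update_apply, Nat.reduceEqDiff, reduceIte]
    change (if x < p then 1 else 0) % 2 ^ W = _
    split_ifs
    · exact m1
    · exact Nat.zero_mod _
  refine WP.assign (fun i => if x < p then x else p) (fun i hi => ?_) ?_
  · simp only [Ex.eval_add, Ex.eval_sub, Ex.eval_mul, Ex.eval_one, Ex.eval_reg, Function.update_apply,
      Nat.reduceEqDiff, reduceIte, Nat.add_mod_mod, Nat.mod_add_mod, m1]
    change (_ + _ * p) % 2 ^ W = _
    split_ifs
    · rw [Nat.sub_self, Nat.zero_mod, Nat.zero_mul, one_mul, add_zero]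
      exact Nat.mod_eq_of_lt (by omega)
    · rw [Nat.zero_mul, Nat.sub_zero, m1, one_mul, zero_add]
      exact Nat.mod_eq_of_lt (by omega)
  refine WP.assign (fun i => if i < (if x < p then x else p) then 1 else 0) (fun i hi => ?_) ?_
  · simp only [Ex.eval_lt, Ex.eval_reg, Function.update_apply, Nat.reduceEqDiff, reduceIte]
    change (if i < _ then 1 else 0) % 2 ^ W = _
    generalize (if x < p then x else p) = y
    split_ifs
    · exact m1
    · exact Nat.zero_mod _
  refine WP.nil ⟨rfl, fun i hi => ⟨fun r hr => ?_, ?_, ?_⟩⟩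
  · simp only [Function.update_apply]
    rw [if_neg (by omega), if_neg (by omega), if_neg (by omega), if_neg (by omega), if_neg (by omega)]
  · simp only [Function.update_apply, Nat.reduceEqDiff, reduceIte]
  · simp only [Function.update_apply, reduceIte]

/-- The code of the processors that take part. -/
def stepCode : List Stmt :=
  assign 9 (16 * .reg 4 * (.reg 2 + .reg 7 * .reg 3)) ++
  (assign 10 (.reg 4 * .reg 3 + (.reg 4 - 1)) ++
  (assign 11 (.bin .shl 1 (.msb (.reg 10) + 1)) ++
  (sampleCode ++ (sortCode ++ (zeroCode ++ (classifyCode ++ (prefixCode ++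
  (scatterCode ++ (boundaryCode ++ (lcpCode ++ []))))))))))

/-- A bound for the number of steps of `stepCode`. -/
def Instance.stepTime (I : Instance) (P : ℕ) : ℕ :=
  50 + (100 * (I.sortSize / P + 1) + (sortTime I.sortSize P (Nat.log 2 I.sampleSize + 1) +
    (100 * (2 * I.v + 3) + (10 + (I.n / P + 1) * (100 + 21 * I.d) +
    (200 + (2 * I.v + 2) * 58 + 41 * Nat.clog 2 P + (100 + (I.n / P + 1) * 100 +
    (100 + (2 * I.v + 3) * 100 + (100 + (I.v + 1) * 100 + 0))))))))

theorem WP.stepCode (hS : Setup p W P I) {R : ℕ → ℕ → ℕ}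
    (hR : ∀ i < P, (∀ r < 7, R i r = initRegs p I i r) ∧ R i 7 = P) :
    WP p W I P stepCode R I.mem (I.stepTime P) fun _ M => I.Output M := by
  have b1 := hS.bound
  have b2 := hS.le_stride
  have b3 := hS.v_le_mul
  have b4 := hS.one_le_P
  have b5 := hS.P_le_mul
  have b6 := hS.sort_le
  have ha := hS.adm.sampleSize_add_one
  have hα := hS.adm.one_le_α
  have hα' : I.α ≤ I.α * (I.v + 1) := Nat.le_mul_of_pos_right _ (Nat.succ_pos _)
  have hvα := I.sampleSize_lt_sortSize
  unfold S5.stepCode Instance.stepTime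
  have g0 : ∀ i < P, R i 0 = i := fun i hi => (hR i hi).1 0 (by decide)
  have g2 : ∀ i < P, R i 2 = I.n := fun i hi => (hR i hi).1 2 (by decide)
  have g3 : ∀ i < P, R i 3 = I.v := fun i hi => (hR i hi).1 3 (by decide)
  have g4 : ∀ i < P, R i 4 = I.α := fun i hi => (hR i hi).1 4 (by decide)
  have g5 : ∀ i < P, R i 5 = I.w := fun i hi => (hR i hi).1 5 (by decide)
  have g6 : ∀ i < P, R i 6 = I.β := fun i hi => (hR i hi).1 6 (by decide)
  have g7 : ∀ i < P, R i 7 = P := fun i hi => (hR i hi).2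
  refine WP.assign (fun i => I.stride P) (fun i hi => ?_) ?_
  · simp only [Ex.eval_add, Ex.eval_mul, Ex.eval_sixteen, Ex.eval_reg, g2 i hi, g3 i hi, g4 i hi, g7 i hi,
      Nat.add_mod_mod, Nat.mod_mul_mod, Nat.mul_mod_mod]
    change I.stride P % _ = _
    exact Nat.mod_eq_of_lt (by omega)
  refine WP.assign (fun i => I.sampleSize) (fun i hi => ?_) ?_
  · simp only [Ex.eval_add, Ex.eval_mul, Ex.eval_sub, Ex.eval_one, Ex.eval_reg, Function.update_apply,
      Nat.reduceEqDiff, reduceIte, g3 i hi, g4 i hi, Nat.add_mod_mod, Nat.mod_add_mod]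
    rw [Nat.mod_eq_of_lt (a := 1) (b := 2 ^ W) (by omega), ← Nat.add_sub_assoc hα]
    change I.sampleSize % _ = _
    exact Nat.mod_eq_of_lt (by omega)
  refine WP.assign (fun i => I.sortSize) (fun i hi => ?_) ?_
  · change (1 % 2 ^ W) <<< ((Nat.log 2 I.sampleSize + 1 % 2 ^ W) % 2 ^ W) % 2 ^ W = I.sortSize
    have hl : Nat.log 2 I.sampleSize + 1 < I.sortSize := Nat.lt_two_pow_self
    rw [Nat.mod_eq_of_lt (a := 1) (b := 2 ^ W) (by omega),
      Nat.mod_eq_of_lt (a := _ + 1) (b := 2 ^ W) (by omega), Nat.one_shiftLeft]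
    change I.sortSize % _ = _
    exact Nat.mod_eq_of_lt (by omega)
  have hE : Env I P fun i => Function.update (Function.update (Function.update (R i) 9 (I.stride P))
      10 I.sampleSize) 11 I.sortSize := by
    constructor <;> intro i hi <;> simp only [Function.update_apply, Nat.reduceEqDiff, reduceIte,
      g0 i hi, g2 i hi, g3 i hi, g4 i hi, g5 i hi, g6 i hi, g7 i hi]
  refine WP.mono (T := _) ?_ (Nat.le_add_left _ _) fun _ _ h => h
  refine WP.sampleCode hS hE (Same.refl _ _ _) (fun _ _ => rfl) fun R₁ M₁ s₁ sample₁ frame₁ => ?_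
  refine WP.sortCode hS hE s₁ sample₁ fun R₂ M₂ X s₂ h13 _ sorted₂ frame₂ => ?_
  have hE₂ := hE.same s₂
  have mem₂ : ∀ x < I.n, M₂ x = I.mem x := fun x hx =>
    (frame₂ x (by omega)).trans (frame₁ x (by omega))
  -- splitter `j` is element `α (j + 1) - 1` of the sorted sample, which exists since `α v ≤ a`
  have split₂ : Splitters I P X M₂ := by
    have hj : ∀ j < I.v, 1 ≤ I.α * (j + 1) ∧ I.α * (j + 1) ≤ I.sampleSize := by
      intro j hj
      have h1 : I.α * (j + 1) ≤ I.α * I.v := Nat.mul_le_mul_left _ hj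
      have h2 : 1 ≤ I.α * (j + 1) := Nat.mul_pos hα (Nat.succ_pos _)
      rw [Nat.mul_add] at ha
      omega
    exact ⟨fun j hjv => (sorted₂ _ (hj j hjv).1 (hj j hjv).2).2.2, fun j hjv =>
      ⟨(sorted₂ _ (hj j hjv).1 (hj j hjv).2).1, (sorted₂ _ (hj j hjv).1 (hj j hjv).2).2.1⟩⟩
  refine WP.zeroCode hS hE₂ (Same.refl _ _ _) fun R₃ M₃ s₃ zero₃ frame₃ => ?_
  refine WP.classifyCode hS hE₂ h13 (split₂.congr fun x _ hx => frame₃ x hx)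
    (fun x hx => (frame₃ x (by omega)).trans (mem₂ x hx)) s₃ zero₃ fun R₄ M₄ s₄ class₄ => ?_
  have hitems := I.items_le P
  have hcount : ∀ g, psum (fun f => Nat.count (fun k => I.counter P k = f) (I.items P)) g =
      Nat.count (fun k => I.counter P k < g) (I.items P) := psum_count _ _
  refine WP.prefixCode hS hE₂ s₄ class₄.count ?_ fun R₅ M₅ s₅ sum₅ frame₅ => ?_
  · refine lt_of_le_of_lt ((hcount _).trans_le (Nat.count_le _)) ?_
    omega
  replace sum₅ := fun f hf => (sum₅ f hf).trans (hcount f)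
  have mem₅ : ∀ x < 3 * I.stride P, M₅ x = M₂ x := fun x hx =>
    (frame₅ x (by omega) (Or.inl hx)).trans ((class₄.frame x hx).trans (frame₃ x hx))
  refine WP.scatterCode hS hE₂ s₅ (fun x hx => (mem₅ x (by omega)).trans (mem₂ x hx))
    (fun k hk => (frame₅ _ (by omega) (Or.inr (by omega))).trans (class₄.bucket k hk))
    (fun k hk => (frame₅ _ (by omega) (Or.inr (by omega))).trans (class₄.rank k hk)) sum₅
    fun R₆ M₆ s₆ out₆ frame₆ => ?_
  refine WP.boundaryCode hS hE₂ s₆ (fun f hf => (frame₆ _ (Or.inr (by omega))).trans (sum₅ f hf))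
    fun R₇ M₇ s₇ bound₇ frame₇ => ?_
  refine WP.lcpCode hS hE₂ h13 (split₂.congr fun x hx hx' => ?_) s₇ fun R₈ M₈ s₈ lcp₈ frame₈ =>
    WP.nil (hS.adm.output b4 (fun k hk => ?_) (fun i hi => ?_) fun i hi => lcp₈ i (by omega))
  · rw [frame₇ x (Or.inr hx), frame₆ x (Or.inr hx), mem₅ x hx']
  · have hlt : position (I.counter P) (I.items P) k < I.n := by
      rw [← I.boundary_last, ← I.count_counter_lt b4 le_rfl]
      refine position_lt _ _ (hk.trans hS.lt_items) ((I.counter_lt_iff b4 _ _).2 ?_)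
      unfold Instance.itemBucket
      rw [if_pos hk]
      exact Nat.lt_succ_of_le (I.bucket_le _)
    rw [frame₈ _ (by omega), frame₇ _ (Or.inl (by omega)), out₆ k hk]
  · rw [frame₈ _ (by omega), bound₇ i (by omega)]

end

/-! ### The execution of the program -/

section

variable {p W P : ℕ} {I : Instance}

theorem Config.Halted.step_eq {c : Config p} (h : c.Halted) : c.step W I = c := by
  obtain ⟨procs, mem⟩ := c
  have h1 := nextMem_of_no_write (c := ⟨procs, mem⟩) fun i => Proc.write?_of_nil (h i)
  simp only [Config.step, h1, Config.mk.injEq, and_true]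
  exact funext fun i => Proc.next_of_nil (h i)

theorem Config.Halted.iterate_eq {c : Config p} (h : c.Halted) (t : ℕ) :
    (Config.step W I)^[t] c = c := Function.iterate_fixed h.step_eq t

/-- The program: the processors with numbers below `Instance.procs` execute `stepCode`, and the others
halt. -/
def program : List Stmt := procsCode ++ [.ite 8 stepCode []]

/-- The first `t₁` steps, up to the test that halts the superfluous processors, are executed by all
processors, and the remaining `t₂` ones by those that take part. -/
theorem program_spec (h : I.Admissible W) (hp : 1 ≤ p) (hW : 2 * (I.n + p) < 2 ^ W)
    (hb : 64 * I.stride (I.procs p) ≤ 2 ^ W) :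
    (∀ t, (run program p W I t).ExclusiveWrite) ∧ ∃ t₁ ≤ 51, ∃ t₂ ≤ I.stepTime (I.procs p),
      (run program p W I (t₁ + t₂)).Halted ∧ I.Output (run program p W I (t₁ + t₂)).mem ∧
      work program p W I (t₁ + t₂) ≤ t₁ * p + t₂ * I.procs p := by
  have hPp : I.procs p ≤ p := min_le_left _ _
  have hS : Setup p W (I.procs p) I := ⟨le_min hp (Nat.succ_pos _), hPp, h, hb⟩
  obtain ⟨t₁, ht₁, R₁, M₁, run₁, rfl, regs₁⟩ := WP.procsCode h hW (M := I.mem)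
  obtain ⟨t₂, ht₂, R₂, M₂, run₂, out⟩ := WP.stepCode hS (R := R₁) fun i hi =>
    ⟨(regs₁ i (hi.trans_le hPp)).1, (regs₁ i (hi.trans_le hPp)).2.1⟩
  obtain ⟨lock₁, ok₁⟩ := run₁ (init program p I) [.ite 8 stepCode []]
    ⟨rfl, fun _ _ => rfl, fun _ _ _ _ => rfl, fun i hi => absurd hi (not_le.2 i.2)⟩
  change Lock p _ R₁ I.mem (run program p W I t₁) at lock₁
  have hw : ∀ i, ((run program p W I t₁).procs i).write? = none := fun i => by
    simp [Proc.write?, lock₁.cont_eq i i.2]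
  have hsucc : run program p W I (t₁ + 1) = (run program p W I t₁).step W I :=
    Function.iterate_succ_apply' ..
  have lock₂ : Lock (I.procs p) (stepCode ++ []) R₁ I.mem (run program p W I (t₁ + 1)) := by
    rw [hsucc]
    refine ⟨?_, fun i hi => ?_, fun i hi r hr => ?_, fun i hi => ?_⟩
    · exact (nextMem_of_no_write hw).trans lock₁.mem_eq
    · simp [Config.step, Proc.next, lock₁.cont_eq i i.2, lock₁.regs_eq i i.2 8 (by decide),
        (regs₁ i i.2).2.2, hi]
    · simp [Config.step, Proc.next, lock₁.cont_eq i i.2, lock₁.regs_eq i i.2 r hr]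
    · simp [Config.step, Proc.next, lock₁.cont_eq i i.2, lock₁.regs_eq i i.2 8 (by decide),
        (regs₁ i i.2).2.2, not_lt.2 hi]
  obtain ⟨lock₃, ok₃⟩ := run₂ _ _ lock₂
  have hadd : ∀ k, (Config.step W I)^[k] (run program p W I (t₁ + 1)) = run program p W I (t₁ + 1 + k) := by
    intro k
    rw [Nat.add_comm (t₁ + 1)]
    exact (Function.iterate_add_apply ..).symm
  rw [hadd] at lock₃
  simp only [hadd] at ok₃
  have halt : (run program p W I (t₁ + 1 + t₂)).Halted := fun i =>
    if hi : i.val < I.procs p then lock₃.cont_eq i hi else lock₃.halted i (not_lt.1 hi)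
  have ok₂ : ∀ t < t₁ + 1, (run program p W I t).ExclusiveWrite ∧ (run program p W I t).active ≤ p := by
    intro t ht
    rcases Nat.lt_succ_iff_lt_or_eq.1 ht with ht | rfl
    · exact ok₁ t ht
    · exact ⟨exclusiveWrite_of_no_write hw, lock₁.active_le⟩
  refine ⟨fun t => ?_, t₁ + 1, by omega, t₂, ht₂, halt, ?_, ?_⟩
  · by_cases h1 : t < t₁ + 1
    · exact (ok₂ t h1).1
    · obtain ⟨k, rfl⟩ := Nat.exists_eq_add_of_le (not_lt.1 h1)
      by_cases h2 : k < t₂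
      · exact (ok₃ k h2).1
      · obtain ⟨k', rfl⟩ := Nat.exists_eq_add_of_le (not_lt.1 h2)
        have : run program p W I (t₁ + 1 + (t₂ + k')) = run program p W I (t₁ + 1 + t₂) := by
          rw [← add_assoc, Nat.add_comm _ k']
          exact (Function.iterate_add_apply ..).trans (halt.iterate_eq k')
        rw [this]
        exact exclusiveWrite_of_no_write fun i => Proc.write?_of_nil (halt i)
  · rw [lock₃.mem_eq]
    exact out
  · unfold work
    rw [Finset.sum_range_add]
    refine Nat.add_le_add ?_ ?_
    · simpa using Finset.sum_le_card_nsmul (Finset.range (t₁ + 1)) _ p fun t ht =>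
        (ok₂ t (Finset.mem_range.1 ht)).2
    · simpa using Finset.sum_le_card_nsmul (Finset.range t₂) _ (I.procs p) fun t ht =>
        (ok₃ t (Finset.mem_range.1 ht)).2

/-! ### Time and work -/

/-- A level takes time `O(N / P + 2 ^ k)`, where the second summand grows geometrically. -/
theorem sum_levelTime_le (N P e : ℕ) :
    ∑ k ∈ Finset.range e, levelTime N P k ≤ 100 * (e * (N / P) + 2 * 2 ^ e) := by
  induction e with
  | zero => simp
  | succ e ih =>
    have h : (N / (2 * 2 ^ e) / P + 1) * (2 * 2 ^ e) ≤ N / P + 2 * 2 ^ e := by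
      rw [Nat.div_div_eq_div_mul, mul_comm (2 * 2 ^ e), ← Nat.div_div_eq_div_mul, add_mul, one_mul]
      exact Nat.add_le_add_right (Nat.div_mul_le_self _ _) _
    rw [Finset.sum_range_succ, pow_succ]
    unfold levelTime at *
    nlinarith

/-- The number of levels of the merge sort is logarithmic in the number of splitters. -/
theorem Instance.Admissible.log_sampleSize_le (h : I.Admissible W) :
    Nat.log 2 I.sampleSize + 1 ≤ 3 * (I.α * I.d) := by
  have h1 := h.one_le_α
  have h2 := h.one_le_d
  -- `a < α 2 ^ d` and `α ≤ 2 ^ α`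
  have h3 : I.sampleSize < 2 ^ (I.α + I.d) := by
    have h4 := h.sampleSize_add_one
    rw [I.v_add_one] at h4
    have h5 : I.α * 2 ^ I.d ≤ 2 ^ I.α * 2 ^ I.d := Nat.mul_le_mul_right _ Nat.lt_two_pow_self.le
    rw [← pow_add] at h5
    omega
  have h4 := Nat.log_lt_of_lt_pow' (by omega) h3
  nlinarith

/-- With `P` processors, the time is `O(α (n / P log v + v) + log P)`. -/
theorem Instance.Admissible.stepTime_le (h : I.Admissible W) (hP : 1 ≤ P) (hPp : P ≤ p) :
    I.stepTime P ≤ 5000 * I.α * (I.n / P * I.d + I.v + (Nat.log 2 p + 1)) := by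
  have h1 := h.one_le_α
  have h2 := h.one_le_d
  have h3 := h.one_le_v
  have h4 := h.sortSize_le
  have h5 := h.sampleSize_le
  have h6 := h.log_sampleSize_le
  have h7 := h.log_v
  have h8 := h.sample_le
  have hsum := sum_levelTime_le I.sortSize P (Nat.log 2 I.sampleSize + 1)
  change _ ≤ 100 * (_ + 2 * I.sortSize) at hsum
  have hdv : I.d ≤ I.v := by
    have := Nat.log_lt_self 2 (show I.v ≠ 0 by omega)
    omega
  have hclog : Nat.clog 2 P ≤ Nat.log 2 p + 1 :=
    (Nat.clog_mono_right 2 hPp).trans (Nat.clog_le_of_le_pow (Nat.lt_pow_succ_log_self (by decide) p).le)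
  have hN : I.sortSize / P ≤ 2 * (I.n / P) + 1 := by
    have : I.sortSize / P < 2 * (I.n / P) + 2 := by
      rw [Nat.div_lt_iff_lt_mul hP]
      have := lt_div_add_one_mul I.n hP
      nlinarith
    omega
  have hmul := Nat.mul_le_mul h6 hN
  unfold Instance.stepTime sortTime
  generalize I.sortSize / P = x at *
  generalize (Nat.log 2 I.sampleSize + 1) * x = z at *
  generalize ∑ k ∈ _, levelTime _ _ k = s at *
  generalize Nat.log 2 p + 1 = l at *
  generalize I.n / P = y at *
  have e1 : I.v ≤ I.α * I.v := Nat.le_mul_of_pos_left _ h1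
  have e2 : l ≤ I.α * l := Nat.le_mul_of_pos_left _ h1
  have e3 : y * I.d ≤ I.α * (y * I.d) := Nat.le_mul_of_pos_left _ h1
  have e4 : y ≤ y * I.d := Nat.le_mul_of_pos_right _ h2
  have e5 : I.α * I.d ≤ I.α * I.v := Nat.mul_le_mul_left _ hdv
  have e6 : 3 * (I.α * I.d) * (2 * y + 1) = 6 * (I.α * (y * I.d)) + 3 * (I.α * I.d) := by ring
  have e7 : (y + 1) * (100 + 21 * I.d) = 100 * y + 21 * (y * I.d) + 100 + 21 * I.d := by ring
  have e8 : 5000 * I.α * (y * I.d + I.v + l) =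
    5000 * (I.α * (y * I.d)) + 5000 * (I.α * I.v) + 5000 * (I.α * l) := by ring
  rw [e7, e8]
  omega

/-- With fewer than `p` processors, the strings of each of them are so few that their classification
takes time `O(log p)`. -/
theorem Instance.div_procs_mul_le (I : Instance) (hp : I.procs p ≠ p) :
    I.n / I.procs p * I.d ≤ Nat.log 2 p + 1 := by
  have hP : I.procs p = I.n / ((Nat.log 2 p + 1) / I.d + 1) + 1 := by
    unfold Instance.procs at *
    omega
  rw [hP]
  refine (Nat.mul_le_mul_right _ ?_).trans (Nat.div_mul_le_self (Nat.log 2 p + 1) I.d)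
  refine Nat.lt_succ_iff.1 ((Nat.div_lt_iff_lt_mul (Nat.succ_pos _)).2 ?_)
  rw [mul_comm]
  exact lt_div_add_one_mul _ (Nat.succ_pos _)

/-- The number of processors is so small that all of them together afford the `log p` rounds of the
summation. -/
theorem Instance.procs_mul_log_le (I : Instance) (hd : 1 ≤ I.d) (hp : 1 ≤ p) :
    I.procs p * (Nat.log 2 p + 1) ≤ I.n * I.d + p := by
  have h1 : I.procs p ≤ I.n / ((Nat.log 2 p + 1) / I.d + 1) + 1 := min_le_right _ _
  have h2 : Nat.log 2 p + 1 ≤ ((Nat.log 2 p + 1) / I.d + 1) * I.d := (lt_div_add_one_mul _ hd).le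
  have h3 : Nat.log 2 p + 1 ≤ p := Nat.log_lt_self 2 (by omega)
  generalize (Nat.log 2 p + 1) / I.d + 1 = q at *
  calc I.procs p * (Nat.log 2 p + 1) ≤ (I.n / q + 1) * (Nat.log 2 p + 1) := Nat.mul_le_mul_right _ h1
    _ = I.n / q * (Nat.log 2 p + 1) + (Nat.log 2 p + 1) := by ring
    _ ≤ I.n / q * (q * I.d) + p := Nat.add_le_add (Nat.mul_le_mul_left _ h2) h3
    _ = I.n / q * q * I.d + p := by ring
    _ ≤ I.n * I.d + p := Nat.add_le_add_right (Nat.mul_le_mul_right _ (Nat.div_mul_le_self _ _)) _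

theorem Instance.logb_v_add_one (I : Instance) : Real.logb 2 ((I.v : ℝ) + 1) = I.d := by
  have h : (I.v : ℝ) + 1 = 2 ^ I.d := by exact_mod_cast I.v_add_one
  rw [h, Real.logb_pow, Real.logb_self_eq_one one_lt_two, mul_one]

theorem log_le_logb_mul {v : ℕ} (hp : 1 ≤ p) (hv : 1 ≤ v) :
    (Nat.log 2 p : ℝ) ≤ Real.logb 2 (p * v) := by
  rw [Real.le_logb_iff_rpow_le one_lt_two (by positivity), Real.rpow_natCast]
  have h1 : 2 ^ Nat.log 2 p ≤ p * v :=
    (Nat.pow_log_le_self 2 (by omega)).trans (Nat.le_mul_of_pos_right _ hv)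
  exact_mod_cast h1

theorem Instance.Admissible.time_le (h : I.Admissible W) (hp : 1 ≤ p) :
    ((51 + I.stepTime (I.procs p) : ℕ) : ℝ) ≤ 20000 * I.α *
      ((I.n : ℝ) / p * Real.logb 2 (I.v + 1) + Real.logb 2 (p * I.v) + I.v) := by
  have h1 := h.stepTime_le (P := I.procs p) (p := p) (le_min hp (Nat.succ_pos _)) (min_le_left _ _)
  have hα : (1 : ℝ) ≤ I.α := by exact_mod_cast h.one_le_α
  have hv : (1 : ℝ) ≤ I.v := by exact_mod_cast h.one_le_v
  have hl := log_le_logb_mul hp h.one_le_v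
  rw [I.logb_v_add_one]
  have h2 : ((I.n / I.procs p * I.d : ℕ) : ℝ) ≤ I.n / p * I.d + (Nat.log 2 p + 1) := by
    by_cases hP : I.procs p = p
    · rw [hP, Nat.cast_mul]
      have : ((I.n / p : ℕ) : ℝ) ≤ I.n / p := Nat.cast_div_le
      nlinarith [Nat.cast_nonneg (α := ℝ) I.d, Nat.cast_nonneg (α := ℝ) (Nat.log 2 p)]
    · have h3 : ((I.n / I.procs p * I.d : ℕ) : ℝ) ≤ (Nat.log 2 p + 1 : ℕ) :=
        Nat.cast_le.2 (I.div_procs_mul_le hP)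
      have h4 : (0 : ℝ) ≤ I.n / p * I.d := by positivity
      push_cast at h3 ⊢
      linarith
  have h3 : (I.stepTime (I.procs p) : ℝ) ≤
      5000 * I.α * ((I.n / I.procs p * I.d : ℕ) + I.v + (Nat.log 2 p + 1)) := by
    exact_mod_cast h1
  have h4 : ((I.n / I.procs p * I.d : ℕ) : ℝ) + I.v + (Nat.log 2 p + 1) ≤
      3 * ((I.n : ℝ) / p * I.d + Real.logb 2 (p * I.v) + I.v) := by
    have : (0 : ℝ) ≤ I.n / p * I.d := by positivity
    linarith
  have h5 : (1 : ℝ) ≤ (I.n : ℝ) / p * I.d + Real.logb 2 (p * I.v) + I.v := by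
    have : (0 : ℝ) ≤ I.n / p * I.d := by positivity
    have : (0 : ℝ) ≤ Nat.log 2 p := by positivity
    linarith
  push_cast
  generalize (I.n : ℝ) / p * I.d + Real.logb 2 (p * I.v) + I.v = X at *
  have h6 := mul_le_mul_of_nonneg_left h4 (show (0 : ℝ) ≤ 5000 * I.α by positivity)
  nlinarith

theorem Instance.Admissible.work_le (h : I.Admissible W) (hp : 1 ≤ p) :
    51 * p + I.stepTime (I.procs p) * I.procs p ≤ 20000 * I.α * (I.n * I.d + p * I.v) := by
  have hPp : I.procs p ≤ p := min_le_left _ _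
  have h1 := h.stepTime_le (P := I.procs p) (p := p) (le_min hp (Nat.succ_pos _)) hPp
  have h2 := I.procs_mul_log_le h.one_le_d hp
  have h3 := Nat.mul_le_mul_right I.d (Nat.div_mul_le_self I.n (I.procs p))
  have h4 := Nat.mul_le_mul_right I.v hPp
  have h5 : p ≤ p * I.v := Nat.le_mul_of_pos_right _ h.one_le_v
  have h6 := h.one_le_α
  generalize I.procs p = P at *
  calc 51 * p + I.stepTime P * P
      ≤ 51 * p + 5000 * I.α * (I.n / P * I.d + I.v + (Nat.log 2 p + 1)) * P :=
        Nat.add_le_add_left (Nat.mul_le_mul_right _ h1) _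
    _ = 51 * p + 5000 * I.α * (I.n / P * P * I.d + P * I.v + P * (Nat.log 2 p + 1)) := by ring
    _ ≤ 51 * I.α * (p * I.v) + 5000 * I.α * (I.n * I.d + p * I.v + (I.n * I.d + p * I.v)) := by
        refine Nat.add_le_add ?_ (Nat.mul_le_mul_left _ (by omega))
        nlinarith
    _ ≤ 20000 * I.α * (I.n * I.d + p * I.v) := by nlinarith [Nat.zero_le (I.α * (I.n * I.d))]

end

end S5

theorem mainTheorem6 :
    ∃ prog : List S5.Stmt, ∀ α : ℕ, 1 ≤ α → ∃ (C : ℝ) (K : ℕ),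
      ∀ (p W : ℕ) (I : S5.Instance), 1 ≤ p → I.α = α → I.Admissible W →
        K * (I.n + p * I.v) ≤ 2 ^ W →
        (∀ t, (S5.run prog p W I t).ExclusiveWrite) ∧
        ∃ T : ℕ,
          (S5.run prog p W I T).Halted ∧
          I.Output (S5.run prog p W I T).mem ∧
          (T : ℝ) ≤ C * ((I.n : ℝ) / p * Real.logb 2 (I.v + 1) + Real.logb 2 (p * I.v) + I.v) ∧
          (S5.work prog p W I T : ℝ) ≤ C * (I.n * Real.logb 2 (I.v + 1) + p * I.v) := by
  -- the memory below `64 * stride` must be addressable, and `64 * 16 = 1024`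
  refine ⟨S5.program, fun α hα => ⟨20000 * α, 1024 * α, ?_⟩⟩
  rintro p W I hp rfl h hK
  have hv := h.one_le_v
  have hpv : p ≤ p * I.v := Nat.le_mul_of_pos_right _ hv
  have hle := Nat.mul_le_mul_right (I.n + p * I.v) (Nat.mul_le_mul_left 1024 hα)
  have hstride : 64 * I.stride (I.procs p) ≤ 2 ^ W := by
    have h1 : I.procs p * I.v ≤ p * I.v := Nat.mul_le_mul_right _ (min_le_left _ _)
    calc 64 * I.stride (I.procs p) = 1024 * I.α * (I.n + I.procs p * I.v) := by
          unfold S5.Instance.stride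
          ring
      _ ≤ 1024 * I.α * (I.n + p * I.v) := Nat.mul_le_mul_left _ (by omega)
      _ ≤ 2 ^ W := hK
  obtain ⟨hex, t₁, ht₁, t₂, ht₂, hhalt, hout, hwork⟩ := S5.program_spec h hp (by omega) hstride
  refine ⟨hex, t₁ + t₂, hhalt, hout, ?_, ?_⟩
  · exact (Nat.cast_le.2 (Nat.add_le_add ht₁ ht₂)).trans (h.time_le hp)
  · rw [I.logb_v_add_one]
    have h1 := hwork.trans ((Nat.add_le_add (Nat.mul_le_mul_right _ ht₁)
      (Nat.mul_le_mul_right _ ht₂)).trans (h.work_le hp))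
    exact_mod_cast h1
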